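/- **Setting.** Let $\Phi$ be a physical theory, entering through a nonempty set $D$ of decorations (primitive divergent 1PI Feynman diagrams with gluing information) and distinct weights $w(d)\in(0,1)$, $d\in D$. Feynman diagrams are encoded by non-planar $D$-decorated rooted trees $t$. The graphon $W_t:[0,1]^2\to[0,1]$ of a tree with $n$ vertices is the step function, on the partition of $[0,1]$ into $n$ equal cells, of the matrix with the weights of the decorations on the diagonal, $1$ at the pairs (vertex, child), and $0$ elsewhere. Its unlabeled class $[W_t]$ is taken modulo invertible measure preserving transformations of $[0,1]$ and almost everywhere equality. Let $\mathcal S^\Phi_{\rm graphon}$ be the free commutative $\mathbb C$-algebra on the classes $[W_t]$, with the counit $\varepsilon$ that vanishes on all $[W_t]$ and the multiplicative coproduct $$\Delta[W_t]=[W_t]\otimes 1+\sum_c\Big(\prod_{s\in P_c(t)}[W_s]\Big)\otimes[W_{R_c(t)}],$$ where $c$ runs over the admissible cuts (including the empty one), $P_c(t)$ is the forest cut off (the subdivergences) and $R_c(t)$ is the trunk (the quotient diagram). Let $A_{\rm dr}$ be the algebra $\mathbb C((z))$ of Laurent series with finite pole parts or, more generally, any subalgebra of it that contains $z^{-1}$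 and the pole parts of its elements (e.g. the convergent series). Let $R_{\rm ms}:A_{\rm dr}\to A_{\rm dr}$ be the projection onto pole parts (strictly negative powers of $z$). **Symplectic geometry of an associative algebra.** Let $C$ be an associative, not necessarily unital, $\mathbb C$-algebra with product $\circ$, commutator $[\cdot,\cdot]$ and center $Z(C)$; a *coefficient* is an element of $\mathbb C\oplus Z(C)$, acting on $C$ by $(c,z)a=ca+z\circ a$. Put $\{f,g\}=[f,g]$, let ${\rm ham}(f)=\{f,\cdot\}$, let ${\rm Der}(C)$ be the space of derivations, and let ${\rm Ham}(C)$ be the set of finite sums of $u\,{\rm ham}(f)$ with $u$ a coefficient and $f\in C$. Let $\Omega^0=C$, and for $n\ge1$ let $\Omega^n$ be the space of antisymmetric maps ${\rm Ham}(C)^n\to C$ that are multilinear over the coefficients. Put $$d\omega(\theta_0,\dots,\theta_n)=\sum_k(-1)^k\theta_k\,\omega(\dots,\hat\theta_k,\dots)+\sum_{r<s}(-1)^{r+s}\omega([\theta_r,\theta_s],\dots,\hat\theta_r,\dots,\hat\theta_s,\dots),$$ let the product of $\alpha\in\Omega^m$ and $\beta\in\Omega^n$ be $\frac1{m!\,n!}\sum_{\sigma\in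 S_{m+n}}{\rm sgn}(\sigma)\,\alpha(\theta_{\sigma(1)},\dots,\theta_{\sigma(m)})\circ\beta(\theta_{\sigma(m+1)},\dots,\theta_{\sigma(m+n)})$, and let $(i_\theta\omega)(\theta_1,\dots)=\omega(\theta,\theta_1,\dots)$, with $i_\theta=0$ on $\Omega^0$. We say that *$C$ carries its canonical noncommutative symplectic geometry* if * $[\cdot,\cdot]$ is a Lie bracket, $\{f,\cdot\}$ satisfies the Leibniz rule for $\circ$, ${\rm Der}(C)$ is closed under commutators, and ${\rm Ham}(C)\subseteq{\rm Der}(C)$; * $(\Omega^\bullet,d)$ is a differential graded algebra: the product is associative (and a unit of $C$, if there is one, is its unit), $d\,\Omega^n\subseteq\Omega^{n+1}$, $d^2=0$ and $d(\alpha\beta)=(d\alpha)\beta+(-1)^m\alpha\,d\beta$ for $\alpha\in\Omega^m$; * each $i_\theta$, $\theta\in{\rm Ham}(C)$, is a super-derivation of degree $-1$ with $i_\theta(da)=\theta(a)$ for $a\in C$; * there is a unique map $\omega:{\rm Ham}(C)^2\to C$ with $\omega\big(\sum_iu_i\,{\rm ham}(f_i),\sum_jv_j\,{\rm ham}(h_j)\big)=\sum_{i,j}u_iv_j[f_i,h_j]$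 for all coefficients $u_i,v_j$ and all $f_i,h_j\in C$; it is a nondegenerate closed form in $\Omega^2$; for $f\in C$ the unique $\theta\in{\rm Ham}(C)$ with $i_\theta\omega=-df$ is $\theta_f={\rm ham}(f)$; and $\{f,g\}=i_{\theta_f}(dg)=\omega(\theta_f,\theta_g)=i_{\theta_g}i_{\theta_f}\omega$. **Theorem.** (a) $\mathcal S^\Phi_{\rm graphon}$, with the well-defined $\Delta$ and with $\varepsilon$, is a non-cocommutative Hopf algebra, and (b), (c) below hold for $H=\mathcal S^\Phi_{\rm graphon}$. More generally, (b) and (c) hold for every non-cocommutative Hopf algebra $H$ over $\mathbb C$. (b) *Minimal subtraction.* $R_{\rm ms}$ is an idempotent Rota–Baxter map: $R(a)R(b)=R(R(a)b+aR(b)-ab)$. The space $L(H,A_{\rm dr})$ of linear maps with the convolution product $*$ is an associative unital algebra, on which $\mathcal R(\phi)=R_{\rm ms}\circ\phi$ is again an idempotent Rota–Baxter map. For $\lambda\in\mathbb R$ put $\mathcal R_\lambda=\mathcal R-\lambda({\rm Id}-\mathcal R)$ and $$\phi_1\circ_\lambda\phi_2=\mathcal R_\lambda(\phi_1)*\phi_2+\phi_1*\mathcal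 R_\lambda(\phi_2)-\mathcal R_\lambda(\phi_1*\phi_2).$$ Then $\mathcal R_\lambda$ is a Nijenhuis map, $\mathcal R_\lambda(\phi_1\circ_\lambda\phi_2)=\mathcal R_\lambda(\phi_1)*\mathcal R_\lambda(\phi_2)$, and $C_\lambda=(L(H,A_{\rm dr}),\circ_\lambda)$ is an associative noncommutative algebra, which is unital if and only if $\lambda\ne0$. Its commutator is $[\phi_1,\phi_2]_\lambda=[\mathcal R_\lambda(\phi_1),\phi_2]+[\phi_1,\mathcal R_\lambda(\phi_2)]-\mathcal R_\lambda([\phi_1,\phi_2])$, where brackets without index are commutators for $*$. $C_\lambda$ carries its canonical noncommutative symplectic geometry, with differential graded algebra $(\Omega_\lambda^\bullet,d_\lambda)$ and symplectic form $\omega_\lambda$. (c) *Dimensional regularization.* Let $T(A_{\rm dr})$ be the tensor algebra (words in $A_{\rm dr}$), $\overline T(A_{\rm dr})=\bigoplus_{n\ge1}A_{\rm dr}^{\otimes n}$, $e$ the letter $1\in A_{\rm dr}$, and $[fg]$ the product in $A_{\rm dr}$. Let $\circledcirc$ be the bilinear product on $T(A_{\rm dr})$ with the empty word as unit and $fU\circledcirc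 gV=f(U\circledcirc gV)+g(fU\circledcirc V)-e[fg](U\circledcirc V)$; on $\overline T(A_{\rm dr})$ put $fU\circleddash gV=[fg](U\circledcirc V)$ and $B^+_e(U)=eU$. Then $(\overline T(A_{\rm dr}),\circleddash,B_e^+)$ is the universal (free) commutative unital Nijenhuis algebra generated by the algebra $A_{\rm dr}$. The space $L(H,\overline T(A_{\rm dr}))$ with the convolution product is an associative unital algebra, $\mathcal N(\psi)=B_e^+\circ\psi$ is a Nijenhuis map on it, and the product $\circ_u$, obtained from $\mathcal N$ as $\circ_\lambda$ is obtained from $\mathcal R_\lambda$, is associative and noncommutative, but has no unit. It has the same further properties as in (b): $\mathcal N(\psi_1\circ_u\psi_2)$ is the convolution of $\mathcal N(\psi_1)$ and $\mathcal N(\psi_2)$, the commutator $[\cdot,\cdot]_u$ is given by the analogous formula, and $(L(H,\overline T(A_{\rm dr})),\circ_u)$ carries its canonical noncommutative symplectic geometry. -/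

import Mathlib

open MeasureTheory
open scoped TensorProduct

noncomputable section

/-! ## Feynman graphons

Feynman diagrams of a theory are encoded by non-planar rooted trees whose vertices are decorated by
primitive (1PI, superficially divergent, without subdivergences) diagrams of the theory together
with gluing information, and a decorated tree is encoded by the unlabeled graphon class of its
weighted adjacency matrix. -/

/-- The combinatorial data of a physical theory which enter the construction: the decorations, and
the distinct weights in the open interval `(0, 1)` by which decorations are recorded on the diagonal
of adjacency matrices. A theory has at least one primitive divergent diagram. -/
structure FeynmanTheory where
  Decoration : Type
  nonempty : Nonempty Decoration
  weight : Decoration → ℝ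
  weight_pos : ∀ d, 0 < weight d
  weight_lt_one : ∀ d, weight d < 1
  weight_injective : Function.Injective weight

/-- Decorated rooted trees: a root decorated by `d` with the list of the branches at the root. The
order of branches is forgotten by the passage to unlabeled graphon classes. -/
inductive DTree (D : Type) : Type
  | node : D → List (DTree D) → DTree D

namespace DTree

variable {D : Type}

mutual
/-- The vertices of a tree in depth-first order, each given by its address (the path of branch
numbers leading to it from the root) and its decoration. -/
def vertices : DTree D → List (List ℕ × D)
  | node d F => ([], d) :: forestVertices 0 F
/-- The vertices of the branches numbered `k, k + 1, ...`. -/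
def forestVertices : ℕ → List (DTree D) → List (List ℕ × D)
  | _, [] => []
  | k, t :: F => (vertices t).map (fun v => (k :: v.1, v.2)) ++ forestVertices (k + 1) F
end

mutual
/-- The admissible cuts of a tree, including the empty one, and excluding the total cut (in which
the whole tree is cut off). On each path from the root to a leaf at most one edge is cut. A cut is
recorded as the pair of the forest `P` that is cut off and the trunk `R` containing the root. -/
def cuts : DTree D → List (List (DTree D) × DTree D)
  | node d F => (forestCuts F).map (fun q => (q.1, node d q.2))
/-- The same for the list of branches at a vertex: for every branch either the edge above it is cut
or an admissible cut is made inside the branch. -/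
def forestCuts : List (DTree D) → List (List (DTree D) × List (DTree D))
  | [] => [([], [])]
  | t :: F =>
      (forestCuts F).map (fun q => (t :: q.1, q.2)) ++
        (cuts t).flatMap (fun p => (forestCuts F).map (fun q => (p.1 ++ q.1, p.2 :: q.2)))
end

theorem vertices_length_pos (t : DTree D) : 0 < t.vertices.length := by
  cases t; simp [vertices]

end DTree

/-- Labeled (bi)graphons on the probability space `[0, 1]` with the Lebesgue measure. They are not
required to be symmetric, since trees are oriented. -/
structure Graphon where
  toFun : unitInterval → unitInterval → ℝ
  measurable_uncurry : Measurable (Function.uncurry toFun)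
  mem_unit : ∀ x y, toFun x y ∈ Set.Icc (0 : ℝ) 1

/-- `U` is, almost everywhere, the rearrangement of `W` by an invertible measure preserving
transformation of `[0, 1]`. -/
def Graphon.Relabeling (W U : Graphon) : Prop :=
  ∃ e : unitInterval ≃ᵐ unitInterval, MeasurePreserving e volume volume ∧
    ∀ᵐ p ∂((volume : Measure unitInterval).prod volume), U.toFun p.1 p.2 = W.toFun (e p.1) (e p.2)

instance graphonSetoid : Setoid Graphon where
  r := Graphon.Relabeling
  iseqv :=
    { refl := fun W => ⟨MeasurableEquiv.refl unitInterval, MeasurePreserving.id volume, by simp⟩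
      symm := by
        rintro W U ⟨e, he, h⟩
        refine ⟨e.symm, he.symm e, ?_⟩
        have h2 := ((he.symm e).prod (he.symm e)).quasiMeasurePreserving.ae h
        filter_upwards [h2] with p hp
        simpa using hp.symm
      trans := by
        rintro W U X ⟨e, he, h⟩ ⟨e', he', h'⟩
        refine ⟨e'.trans e, he.comp he', ?_⟩
        have h2 := (he'.prod he').quasiMeasurePreserving.ae h
        filter_upwards [h2, h'] with p hp hp'
        rw [hp']
        simpa using hp }

/-- Unlabeled graphon classes. -/
abbrev UnlabeledGraphon : Type := Quotient graphonSetoid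

/-- The index of the cell `((i - 1) / n, i / n]` of `[0, 1]` that contains `x`, counted from zero. -/
def cellIndex (n : ℕ) (hn : 0 < n) (x : unitInterval) : Fin n :=
  ⟨⌈(n : ℝ) * (x : ℝ)⌉₊ - 1, by
    have h1 : ⌈(n : ℝ) * (x : ℝ)⌉₊ ≤ n := by
      apply Nat.ceil_le.mpr
      have := x.2.2
      nlinarith [(Nat.cast_nonneg n : (0 : ℝ) ≤ n)]
    omega⟩

theorem measurable_cellIndex (n : ℕ) (hn : 0 < n) : Measurable (cellIndex n hn) := by
  have h : Measurable (fun x : unitInterval => ⌈(n : ℝ) * (x : ℝ)⌉₊ - 1) :=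
    (measurable_from_top (f := fun k : ℕ => k - 1)).comp
      (Nat.measurable_ceil.comp (measurable_subtype_coe.const_mul (n : ℝ)))
  refine measurable_to_countable' fun i => ?_
  have : cellIndex n hn ⁻¹' {i} = (fun x : unitInterval => ⌈(n : ℝ) * (x : ℝ)⌉₊ - 1) ⁻¹' {(i : ℕ)} := by
    ext x; simp [cellIndex, Fin.ext_iff]
  rw [this]
  exact h (measurableSet_singleton _)

open Classical in
/-- The weighted adjacency matrix of a decorated rooted tree: the weight of the decoration on the
diagonal, `1` for an edge going from a vertex `i` to its child `j`, and `0` otherwise. -/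
def adjacency (Φ : FeynmanTheory) (t : DTree Φ.Decoration) (i j : Fin t.vertices.length) : ℝ :=
  if i = j then Φ.weight (t.vertices.get i).2
  else if ∃ k : ℕ, (t.vertices.get j).1 = (t.vertices.get i).1 ++ [k] then 1 else 0

/-- The labeled graphon `W_t` of a decorated rooted tree with `n` vertices: the step function (pixel
picture) of the adjacency matrix with respect to the partition of `[0, 1]` into `n` equal cells. -/
def treeGraphon (Φ : FeynmanTheory) (t : DTree Φ.Decoration) : Graphon where
  toFun x y := adjacency Φ t (cellIndex _ t.vertices_length_pos x)
    (cellIndex _ t.vertices_length_pos y)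
  measurable_uncurry := by
    have h : Measurable (Function.uncurry (adjacency Φ t)) := measurable_of_countable _
    have h2 := measurable_cellIndex _ t.vertices_length_pos
    exact h.comp ((h2.comp measurable_fst).prodMk (h2.comp measurable_snd))
  mem_unit x y := by
    unfold adjacency
    split_ifs
    · exact ⟨(Φ.weight_pos _).le, (Φ.weight_lt_one _).le⟩
    · simp
    · simp

/-- The unlabeled graphon class `[W_t]`. -/
def graphonClass (Φ : FeynmanTheory) (t : DTree Φ.Decoration) : UnlabeledGraphon :=
  Quotient.mk _ (treeGraphon Φ t)

/-- The set of all Feynman graphons of the theory. -/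
def feynmanGraphons (Φ : FeynmanTheory) : Set UnlabeledGraphon := Set.range (graphonClass Φ)

/-- The underlying algebra of the Hopf algebra of Feynman graphons: the free commutative algebra on
the Feynman graphons. Its unit stands for the class of the empty graph. -/
abbrev GraphonAlgebra (Φ : FeynmanTheory) : Type := MvPolynomial (feynmanGraphons Φ) ℂ

/-- The generator `[W_t]`. -/
def graphonGen (Φ : FeynmanTheory) (t : DTree Φ.Decoration) : GraphonAlgebra Φ :=
  MvPolynomial.X ⟨graphonClass Φ t, t, rfl⟩

/-- The renormalization coproduct of a tree, `∑ [W_P] ⊗ [W_R]` over all admissible cuts: the forest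
`P` that is cut off is the disjoint union of subdivergences, the trunk `R` is the quotient by it. -/
def treeCoproduct (Φ : FeynmanTheory) (t : DTree Φ.Decoration) :
    GraphonAlgebra Φ ⊗[ℂ] GraphonAlgebra Φ :=
  graphonGen Φ t ⊗ₜ[ℂ] 1 +
    (t.cuts.map (fun c => (c.1.map (graphonGen Φ)).prod ⊗ₜ[ℂ] graphonGen Φ c.2)).sum

/-- The coproduct on Feynman graphons: the algebra homomorphism given on a generator by the formula
for a tree that represents it. -/
def graphonCoproduct (Φ : FeynmanTheory) :
    GraphonAlgebra Φ →ₐ[ℂ] GraphonAlgebra Φ ⊗[ℂ] GraphonAlgebra Φ :=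
  MvPolynomial.aeval (fun x => treeCoproduct Φ x.2.choose)

/-- The counit vanishes on all nonempty Feynman graphons. -/
def graphonCounit (Φ : FeynmanTheory) : GraphonAlgebra Φ →ₐ[ℂ] ℂ :=
  MvPolynomial.aeval (fun _ => 0)

/-- `(H, Δ, ε)` is a Hopf algebra. -/
structure IsHopfAlgebra {H : Type} [Ring H] [Algebra ℂ H] (Δ : H →ₐ[ℂ] H ⊗[ℂ] H)
    (ε : H →ₐ[ℂ] ℂ) : Prop where
  coassoc : ∀ x, TensorProduct.assoc ℂ H H H
      (TensorProduct.map Δ.toLinearMap LinearMap.id (Δ x)) =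
    TensorProduct.map LinearMap.id Δ.toLinearMap (Δ x)
  counit_left : ∀ x, TensorProduct.lid ℂ H
    (TensorProduct.map ε.toLinearMap LinearMap.id (Δ x)) = x
  counit_right : ∀ x, TensorProduct.rid ℂ H
    (TensorProduct.map LinearMap.id ε.toLinearMap (Δ x)) = x
  antipode : ∃ S : H →ₗ[ℂ] H, ∀ x,
    LinearMap.mul' ℂ H (TensorProduct.map S LinearMap.id (Δ x)) = algebraMap ℂ H (ε x) ∧
    LinearMap.mul' ℂ H (TensorProduct.map LinearMap.id S (Δ x)) = algebraMap ℂ H (ε x)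

/-- `Δ` is not cocommutative. -/
def NonCocommutative {H : Type} [Ring H] [Algebra ℂ H] (Δ : H →ₐ[ℂ] H ⊗[ℂ] H) : Prop :=
  ∃ x, TensorProduct.comm ℂ H H (Δ x) ≠ Δ x

/-! ## Products on spaces of linear maps, Rota–Baxter and Nijenhuis maps -/

section Products

variable {V : Type} [AddCommGroup V] [Module ℂ V]

/-- The convolution product of linear maps `φ, ψ : H → B`, that is, `m ∘ (φ ⊗ ψ) ∘ Δ` for a bilinear
product `m` on `B`. -/
def convolution {H B : Type} [AddCommGroup H] [Module ℂ H] [AddCommGroup B] [Module ℂ B]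
    (Δ : H →ₗ[ℂ] H ⊗[ℂ] H) (m : B →ₗ[ℂ] B →ₗ[ℂ] B) :
    (H →ₗ[ℂ] B) →ₗ[ℂ] (H →ₗ[ℂ] B) →ₗ[ℂ] (H →ₗ[ℂ] B) :=
  LinearMap.mk₂ ℂ (fun φ ψ => TensorProduct.lift (m.compl₁₂ φ ψ) ∘ₗ Δ)
    (fun a b c => by
      rw [← LinearMap.add_comp]; congr 1; ext x y; simp)
    (fun c a b => by
      rw [← LinearMap.smul_comp]; congr 1; ext x y; simp)
    (fun a b c => by
      rw [← LinearMap.add_comp]; congr 1; ext x y; simp)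
    (fun c a b => by
      rw [← LinearMap.smul_comp]; congr 1; ext x y; simp)

/-- The lift `φ ↦ R ∘ φ` of a linear map `R` on `B` to linear maps with values in `B`. -/
def liftMap (H : Type) {B : Type} [AddCommGroup H] [Module ℂ H] [AddCommGroup B] [Module ℂ B]
    (R : B →ₗ[ℂ] B) : (H →ₗ[ℂ] B) →ₗ[ℂ] (H →ₗ[ℂ] B) :=
  LinearMap.llcomp ℂ H B B R

/-- The associative law for a bilinear product. -/
def IsAssoc (m : V →ₗ[ℂ] V →ₗ[ℂ] V) : Prop := ∀ a b c, m (m a b) c = m a (m b c)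

/-- `e` is a two-sided unit of a bilinear product. -/
def IsUnitOf (m : V →ₗ[ℂ] V →ₗ[ℂ] V) (e : V) : Prop := ∀ a, m e a = a ∧ m a e = a

/-- The Rota–Baxter relation, in the normalization satisfied by idempotent Rota–Baxter maps. -/
def IsRotaBaxter (m : V →ₗ[ℂ] V →ₗ[ℂ] V) (R : V →ₗ[ℂ] V) : Prop :=
  ∀ a b, m (R a) (R b) = R (m (R a) b + m a (R b) - m a b)

/-- The Nijenhuis relation. -/
def IsNijenhuis (m : V →ₗ[ℂ] V →ₗ[ℂ] V) (N : V →ₗ[ℂ] V) : Prop :=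
  ∀ a b, m (N a) (N b) = N (m (N a) b + m a (N b) - N (m a b))

/-- The deformation `N a ⬝ b + a ⬝ N b - N (a ⬝ b)` of a product by a linear map `N`. -/
def deformedProduct (m : V →ₗ[ℂ] V →ₗ[ℂ] V) (N : V →ₗ[ℂ] V) : V →ₗ[ℂ] V →ₗ[ℂ] V :=
  m.comp N + m.compl₂ N - m.compr₂ N

/-- `R - lam (Id - R)`. -/
def lambdaDeformation (R : V →ₗ[ℂ] V) (lam : ℝ) : V →ₗ[ℂ] V :=
  R - (lam : ℂ) • (LinearMap.id - R)

end Products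

/-! ## Derivation-based differential calculus of an associative algebra -/

/-- An associative, possibly non-unital, complex algebra structure on the vector space `V`. -/
structure AssocProduct (V : Type) [AddCommGroup V] [Module ℂ V] where
  mul : V →ₗ[ℂ] V →ₗ[ℂ] V
  assoc : IsAssoc mul

namespace AssocProduct

variable {V : Type} [AddCommGroup V] [Module ℂ V] (C : AssocProduct V)

/-- The commutator. -/
def bracket (a b : V) : V := C.mul a b - C.mul b a

/-- The center. -/
def center : Submodule ℂ V where
  carrier := {z | ∀ a, C.mul z a = C.mul a z}
  add_mem' := by intro x y hx hy a; simp [hx a, hy a]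
  zero_mem' := by intro a; simp
  smul_mem' := by intro c x hx a; simp [hx a]

/-- Derivations: linear maps that satisfy the Leibniz rule. -/
def der : Submodule ℂ (V →ₗ[ℂ] V) where
  carrier := {θ | ∀ a b, θ (C.mul a b) = C.mul (θ a) b + C.mul a (θ b)}
  add_mem' := by
    intro x y hx hy a b
    simp only [LinearMap.add_apply, hx a b, hy a b, map_add]
    abel
  zero_mem' := by intro a b; simp
  smul_mem' := by intro c x hx a b; simp [hx a b]

/-- The Hamiltonian derivation `a ↦ {f, a}`, where the Poisson bracket is the commutator. -/
def ham (f : V) : V →ₗ[ℂ] V := C.mul f - C.mul.flip f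

theorem ham_apply (f a : V) : C.ham f a = C.bracket f a := rfl

/-- The action of a coefficient `p = (c, z)`, with `c` a scalar and `z` central, by `c + z`. If there
is a unit then scalars are already contained in the center. -/
def coeff (p : ℂ × C.center) : V →ₗ[ℂ] V := p.1 • LinearMap.id + C.mul p.2

/-- The module over the center that is generated by all Hamiltonian derivations. -/
def Ham : Submodule ℂ (V →ₗ[ℂ] V) :=
  Submodule.span ℂ {θ | ∃ (p : ℂ × C.center) (f : V), θ = C.coeff p ∘ₗ C.ham f}

theorem ham_mem (f : V) : C.ham f ∈ C.Ham :=
  Submodule.subset_span ⟨(1, 0), f, by ext a; simp [coeff]⟩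

theorem coeff_comp_ham (p : ℂ × C.center) (f : V) :
    C.coeff p ∘ₗ C.ham f = C.ham (C.coeff p f) := by
  obtain ⟨c, z, hz⟩ := p
  ext a
  have h1 : C.mul a (C.mul z f) = C.mul z (C.mul a f) := by
    rw [← C.assoc, ← hz a, C.assoc]
  simp [coeff, ham, h1, C.assoc z f a, smul_sub]
  abel

theorem exists_eq_ham {θ : V →ₗ[ℂ] V} (h : θ ∈ C.Ham) : ∃ f, θ = C.ham f := by
  induction h using Submodule.span_induction with
  | mem x hx =>
    obtain ⟨p, f, rfl⟩ := hx
    exact ⟨_, C.coeff_comp_ham p f⟩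
  | zero => exact ⟨0, by ext a; simp [ham]⟩
  | add x y _ _ hx hy =>
    obtain ⟨f, rfl⟩ := hx
    obtain ⟨g, rfl⟩ := hy
    exact ⟨f + g, by ext a; simp [ham]; abel⟩
  | smul c x _ hx =>
    obtain ⟨f, rfl⟩ := hx
    exact ⟨c • f, by ext a; simp [ham, smul_sub]⟩

/-- Multiplication of an element of `Ham` by a coefficient. -/
def hamSMul (p : ℂ × C.center) (θ : C.Ham) : C.Ham :=
  ⟨C.coeff p ∘ₗ θ.1, by
    obtain ⟨f, hf⟩ := C.exists_eq_ham θ.2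
    rw [hf, C.coeff_comp_ham]
    exact C.ham_mem _⟩

/-- The commutator of derivations in `Ham`. -/
def hamLie (θ η : C.Ham) : C.Ham :=
  ⟨θ.1 ∘ₗ η.1 - η.1 ∘ₗ θ.1, by
    obtain ⟨f, hf⟩ := C.exists_eq_ham θ.2
    obtain ⟨g, hg⟩ := C.exists_eq_ham η.2
    have : θ.1 ∘ₗ η.1 - η.1 ∘ₗ θ.1 = C.ham (C.bracket f g) := by
      rw [hf, hg]
      ext a
      simp only [ham, bracket, LinearMap.sub_apply, LinearMap.comp_apply, LinearMap.flip_apply,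
        map_sub]
      simp only [C.assoc _ _ _]
      abel
    rw [this]
    exact C.ham_mem _⟩

/-- The Hamiltonian derivation of `f`, as an element of `Ham`. -/
def hamElt (f : V) : C.Ham := ⟨C.ham f, C.ham_mem f⟩

/-- Maps from `Ham × ... × Ham` (`n` times) to the algebra. For `n = 0` these are elements of the
algebra. -/
abbrev Cochain (n : ℕ) : Type := (Fin n → C.Ham) → V

/-- The forms of degree `n`: the antisymmetric maps that are multilinear over the center (and over
the scalars). -/
structure IsForm (n : ℕ) (ω : C.Cochain n) : Prop where
  map_add : ∀ (m : Fin n → C.Ham) (i : Fin n) (x y : C.Ham),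
    ω (Function.update m i (x + y)) = ω (Function.update m i x) + ω (Function.update m i y)
  map_coeff : ∀ (m : Fin n → C.Ham) (i : Fin n) (p : ℂ × C.center) (x : C.Ham),
    ω (Function.update m i (C.hamSMul p x)) = C.coeff p (ω (Function.update m i x))
  map_swap : ∀ (m : Fin n → C.Ham) (i j : Fin n), i ≠ j → ω (m ∘ Equiv.swap i j) = - ω m

/-- The differential. In degree `n + 1` the second sum runs over all pairs `r < s` of positions, and
`s.succAbove ∘ r.succAbove` enumerates the remaining positions. -/
def d : {n : ℕ} → C.Cochain n → C.Cochain (n + 1)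
  | 0, ω => fun θ => (θ 0).1 (ω Fin.elim0)
  | n + 1, ω => fun θ =>
      (∑ k : Fin (n + 2), (-1 : ℂ) ^ (k : ℕ) • (θ k).1 (ω (fun i => θ (k.succAbove i)))) +
      ∑ s : Fin (n + 2), ∑ r : Fin (n + 1),
        if r.castSucc < s then
          (-1 : ℂ) ^ ((r : ℕ) + (s : ℕ)) •
            ω (Fin.cons (C.hamLie (θ r.castSucc) (θ s))
              (fun i : Fin n => θ (s.succAbove (r.succAbove i))))
        else 0

/-- The product of forms. -/
def wedge {m n : ℕ} (α : C.Cochain m) (β : C.Cochain n) : C.Cochain (m + n) := fun θ =>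
  ((m.factorial * n.factorial : ℕ) : ℂ)⁻¹ •
    ∑ σ : Equiv.Perm (Fin (m + n)), ((Equiv.Perm.sign σ : ℤ) : ℂ) •
      C.mul (α (fun i => θ (σ (Fin.castAdd n i)))) (β (fun j => θ (σ (Fin.natAdd m j))))

/-- The transport of cochains along an equality of degrees. -/
def castDeg {m n : ℕ} (h : m = n) (ω : C.Cochain m) : C.Cochain n := fun θ => ω (θ ∘ Fin.cast h)

/-- An element of the algebra as a form of degree zero. -/
def zeroForm (f : V) : C.Cochain 0 := fun _ => f

/-- The contraction of a form with an element of `Ham`. (It is zero in degree zero.) -/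
def interior {n : ℕ} (θ : C.Ham) (ω : C.Cochain (n + 1)) : C.Cochain n :=
  fun η => ω (Fin.cons θ η)

/-- The forms on `Ham`, with the product and the differential above, are a differential graded
algebra whose component of degree zero is the given algebra. -/
structure IsDGA : Prop where
  wedge_form : ∀ {m n : ℕ} {α : C.Cochain m} {β : C.Cochain n}, C.IsForm m α → C.IsForm n β →
    C.IsForm (m + n) (C.wedge α β)
  wedge_zero : ∀ a b : V, C.wedge (C.zeroForm a) (C.zeroForm b) = C.zeroForm (C.mul a b)
  wedge_assoc : ∀ {l m n : ℕ} {α : C.Cochain l} {β : C.Cochain m} {γ : C.Cochain n},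
    C.IsForm l α → C.IsForm m β → C.IsForm n γ →
    C.castDeg (add_assoc l m n) (C.wedge (C.wedge α β) γ) = C.wedge α (C.wedge β γ)
  unit_wedge : ∀ e, IsUnitOf C.mul e → ∀ {n : ℕ} {α : C.Cochain n}, C.IsForm n α →
    C.castDeg (zero_add n) (C.wedge (C.zeroForm e) α) = α ∧ C.wedge α (C.zeroForm e) = α
  d_form : ∀ {n : ℕ} {α : C.Cochain n}, C.IsForm n α → C.IsForm (n + 1) (C.d α)
  d_d : ∀ {n : ℕ} {α : C.Cochain n}, C.IsForm n α → C.d (C.d α) = 0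
  d_wedge : ∀ {m n : ℕ} {α : C.Cochain m} {β : C.Cochain n}, C.IsForm m α → C.IsForm n β →
    C.d (C.wedge α β) =
      C.castDeg (by omega) (C.wedge (C.d α) β) + (-1 : ℂ) ^ m • C.wedge α (C.d β)

/-- Contraction with an element of `Ham` is a super-derivation of degree `-1` (it is zero in degree
zero), and takes `d a` to `θ a`. Consequently it is given on `a₀ da₁ ⋯ daₙ` by the alternating sum of
the `a₀ da₁ ⋯ θ(aⱼ) ⋯ daₙ`. -/
structure InteriorIsDerivation : Prop where
  interior_form : ∀ {n : ℕ} (θ : C.Ham) {α : C.Cochain (n + 1)}, C.IsForm (n + 1) α →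
    C.IsForm n (C.interior θ α)
  interior_d : ∀ (θ : C.Ham) (a : V), C.interior θ (C.d (C.zeroForm a)) = C.zeroForm (θ.1 a)
  interior_wedge : ∀ {m n : ℕ} (θ : C.Ham) {α : C.Cochain (m + 1)} {β : C.Cochain (n + 1)},
    C.IsForm (m + 1) α → C.IsForm (n + 1) β →
    C.interior θ (C.castDeg (n := m + 1 + n + 1) (by omega) (C.wedge α β)) =
      C.castDeg (by omega) (C.wedge (C.interior θ α) β) +
        (-1 : ℂ) ^ (m + 1) • C.wedge α (C.interior θ β)
  interior_wedge_zero_left : ∀ {n : ℕ} (θ : C.Ham) (a : V) {β : C.Cochain (n + 1)},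
    C.IsForm (n + 1) β →
    C.interior θ (C.castDeg (n := 0 + n + 1) (by omega) (C.wedge (C.zeroForm a) β)) = C.wedge (C.zeroForm a) (C.interior θ β)
  interior_wedge_zero_right : ∀ {m : ℕ} (θ : C.Ham) {α : C.Cochain (m + 1)} (a : V),
    C.IsForm (m + 1) α →
    C.interior θ (C.castDeg (n := m + 0 + 1) (by omega) (C.wedge α (C.zeroForm a))) = C.wedge (C.interior θ α) (C.zeroForm a)

/-- The defining formula of the canonical 2-form: on `θ = ∑ᵢ uᵢ ham(fᵢ)` and `η = ∑ⱼ vⱼ ham(hⱼ)` its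
value is `∑ᵢⱼ uᵢ vⱼ [fᵢ, hⱼ]`. -/
def IsCanonicalForm (ω : C.Cochain 2) : Prop :=
  ∀ (m n : ℕ) (u : Fin m → ℂ × C.center) (f : Fin m → V) (v : Fin n → ℂ × C.center)
    (h : Fin n → V),
    ω ![∑ i, C.hamSMul (u i) (C.hamElt (f i)), ∑ j, C.hamSMul (v j) (C.hamElt (h j))] =
      ∑ i, ∑ j, C.coeff (u i) (C.coeff (v j) (C.bracket (f i) (h j)))

/-- `ω` is a symplectic form on `Ham` (a closed nondegenerate 2-form) for which the vector field of
`f` is `ham f` and whose Poisson bracket is the commutator. -/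
structure IsSymplectic (ω : C.Cochain 2) : Prop where
  form : C.IsForm 2 ω
  closed : C.d ω = 0
  nondegenerate : ∀ θ : C.Ham, (∀ η : C.Ham, ω ![θ, η] = 0) → θ = 0
  vectorField : ∀ (f : V) (θ : C.Ham),
    C.interior θ ω = - C.d (C.zeroForm f) ↔ θ = C.hamElt f
  poisson_d : ∀ f g : V,
    C.zeroForm (C.bracket f g) = C.interior (C.hamElt f) (C.d (C.zeroForm g))
  poisson_form : ∀ f g : V, C.bracket f g = ω ![C.hamElt f, C.hamElt g] ∧
    C.zeroForm (C.bracket f g) = C.interior (C.hamElt g) (C.interior (C.hamElt f) ω)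

/-- The noncommutative symplectic geometry of an associative algebra. -/
structure IsSymplecticGeometry : Prop where
  lie_self : ∀ a, C.bracket a a = 0
  lie_jacobi : ∀ a b c,
    C.bracket a (C.bracket b c) + C.bracket b (C.bracket c a) + C.bracket c (C.bracket a b) = 0
  poisson_leibniz : ∀ a b c,
    C.bracket a (C.mul b c) = C.mul (C.bracket a b) c + C.mul b (C.bracket a c)
  der_lie : ∀ θ ∈ C.der, ∀ η ∈ C.der, θ ∘ₗ η - η ∘ₗ θ ∈ C.der
  ham_le_der : C.Ham ≤ C.der
  dga : C.IsDGA
  interior : C.InteriorIsDerivation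
  symplectic : ∃ ω : C.Cochain 2, C.IsCanonicalForm ω ∧ C.IsSymplectic ω ∧
    ∀ ω' : C.Cochain 2, C.IsCanonicalForm ω' → ω' = ω

end AssocProduct

/-- The linear map `N` satisfies the Nijenhuis relation for the product `m`, the deformed product is
associative and noncommutative, `N` is multiplicative from the deformed product to `m`, the
commutator of the deformed product is the deformed bracket, and the algebra given by the deformed
product carries a noncommutative symplectic geometry. -/
def NijenhuisSymplecticModel {V : Type} [AddCommGroup V] [Module ℂ V] (m : V →ₗ[ℂ] V →ₗ[ℂ] V)
    (N : V →ₗ[ℂ] V) : Prop :=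
  IsNijenhuis m N ∧
  (∀ a b, N (deformedProduct m N a b) = m (N a) (N b)) ∧
  ∃ C : AssocProduct V, C.mul = deformedProduct m N ∧
    (∃ a b, C.mul a b ≠ C.mul b a) ∧
    (∀ a b, C.bracket a b =
      (m (N a) b - m b (N a)) + (m a (N b) - m (N b) a) - N (m a b - m b a)) ∧
    C.IsSymplecticGeometry

/-! ## The regularization algebra and minimal subtraction -/

/-- The algebra of formal Laurent series with finite pole part, with the coefficientwise action of
the scalars. -/
def Laurent : Type := LaurentSeries ℂ

instance : CommRing Laurent := inferInstanceAs (CommRing (HahnSeries ℤ ℂ))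

instance : Algebra ℂ Laurent := (HahnSeries.instAlgebra : Algebra ℂ (HahnSeries ℤ ℂ))

/-- The coefficient of `z ^ n`. -/
def Laurent.coeff (a : Laurent) (n : ℤ) : ℂ := HahnSeries.coeff a n

/-- The projection of a Laurent series onto its pole part. -/
def poleProjection : Laurent →ₗ[ℂ] Laurent := HahnSeries.truncLTLinearMap ℂ (0 : ℤ)

theorem poleProjection_coeff (a : Laurent) (n : ℤ) :
    (poleProjection a).coeff n = if n < 0 then a.coeff n else 0 := by
  have key : ∀ x : HahnSeries ℤ ℂ,
      HahnSeries.coeff (HahnSeries.truncLT 0 x) n = if n < 0 then HahnSeries.coeff x n else 0 := by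
    intro x
    split_ifs with h
    · exact HahnSeries.coeff_truncLT_of_lt h x
    · exact HahnSeries.coeff_truncLT_of_le (not_lt.mp h) x
  exact key a

/-- The series `z⁻¹`. -/
def Laurent.zInv : Laurent := HahnSeries.single (-1 : ℤ) (1 : ℂ)

/-- Algebras of Laurent series with finite pole parts: subalgebras of the algebra of all formal such
series that contain `z⁻¹` and the pole parts of their elements. Instances are the algebra of all
formal series and the algebra of convergent series. -/
structure IsRegularizationAlgebra (A : Subalgebra ℂ Laurent) : Prop where
  zInv_mem : Laurent.zInv ∈ A
  poleProjection_mem : ∀ a ∈ A, poleProjection a ∈ A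

/-- The minimal subtraction map on a regularization algebra. -/
def minimalSubtraction {A : Subalgebra ℂ Laurent} (hA : IsRegularizationAlgebra A) :
    A →ₗ[ℂ] A :=
  { toFun := fun a => ⟨poleProjection a, hA.poleProjection_mem a a.2⟩
    map_add' := fun a b => by ext1; simp
    map_smul' := fun c a => by ext1; simp }

/-- The unit `η ∘ ε` of the convolution product. -/
def convUnit {H B : Type} [Ring H] [Algebra ℂ H] [Ring B] [Algebra ℂ B] (ε : H →ₐ[ℂ] ℂ) :
    H →ₗ[ℂ] B :=
  Algebra.linearMap ℂ B ∘ₗ ε.toLinearMap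

/-- The noncommutative symplectic geometry determined by an idempotent Rota–Baxter map `R` of a
commutative algebra `B` on the linear maps from a Hopf algebra to `B`. -/
def RotaBaxterModel {H B : Type} [Ring H] [Algebra ℂ H] [CommRing B] [Algebra ℂ B]
    (Δ : H →ₐ[ℂ] H ⊗[ℂ] H) (ε : H →ₐ[ℂ] ℂ) (R : B →ₗ[ℂ] B) : Prop :=
  let conv := convolution Δ.toLinearMap (LinearMap.mul ℂ B)
  R ∘ₗ R = R ∧ IsRotaBaxter (LinearMap.mul ℂ B) R ∧
  IsAssoc conv ∧ IsUnitOf conv (convUnit ε) ∧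
  liftMap H R ∘ₗ liftMap H R = liftMap H R ∧ IsRotaBaxter conv (liftMap H R) ∧
  ∀ lam : ℝ,
    NijenhuisSymplecticModel conv (lambdaDeformation (liftMap H R) lam) ∧
    ((∃ e, IsUnitOf (deformedProduct conv (lambdaDeformation (liftMap H R) lam)) e) ↔ lam ≠ 0)

/-! ## The universal Nijenhuis algebra -/

section Nijenhuis

variable (A : Type) [CommRing A] [Algebra ℂ A]

/-- The word with the first letter `f` and the remaining word `U`. -/
def letterCons : A →ₗ[ℂ] TensorAlgebra ℂ A →ₗ[ℂ] TensorAlgebra ℂ A :=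
  (LinearMap.mul ℂ (TensorAlgebra ℂ A)).comp (TensorAlgebra.ι ℂ)

namespace QuasiShuffle

/-- Bilinear expressions in a letter `f` and a linear map `P` on words. -/
abbrev Expr : Type :=
  A →ₗ[ℂ] (TensorAlgebra ℂ A →ₗ[ℂ] TensorAlgebra ℂ A) →ₗ[ℂ] TensorAlgebra ℂ A

variable {A}

/-- For a word `V`, the expression `f (P V)`. -/
def exprFirst : TensorAlgebra ℂ A →ₗ[ℂ] Expr A :=
  LinearMap.mk₂ ℂ (fun V f => letterCons A f ∘ₗ LinearMap.applyₗ V)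
    (fun V W f => by ext P; simp) (fun c V f => by ext P; simp)
    (fun V f g => by ext P; simp) (fun c V f => by ext P; simp)

/-- For a letter `g` and a word `V`, the expression `1 [f g] (P V)`. -/
def exprThird : A →ₗ[ℂ] TensorAlgebra ℂ A →ₗ[ℂ] Expr A :=
  LinearMap.mk₂ ℂ (fun g V =>
      { toFun := fun f => letterCons A 1 ∘ₗ letterCons A (f * g) ∘ₗ LinearMap.applyₗ V
        map_add' := fun f f' => by ext P; simp [add_mul]
        map_smul' := fun c f => by ext P; simp })
    (fun g g' V => by ext f P; simp [mul_add]) (fun c g V => by ext f P; simp)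
    (fun g V W => by ext f P; simp) (fun c g V => by ext f P; simp)

/-- Prepending the letter `g` to the values of an expression. -/
def exprSecond (g : A) : Expr A →ₗ[ℂ] Expr A where
  toFun q := q.compr₂ (letterCons A g)
  map_add' q q' := by ext f P; simp
  map_smul' c q := by ext f P; simp

/-- The passage from a word `V`, with the expression for the product `(f U) ⊚ V` in terms of `f` and
of `P = (U ⊚ ·)`, to the word `g V` with the analogous expression for `(f U) ⊚ (g V)`. -/
def step : A →ₗ[ℂ] Module.End ℂ (TensorAlgebra ℂ A × Expr A) where
  toFun g :=
    { toFun := fun s => (letterCons A g s.1,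
        exprFirst (letterCons A g s.1) + exprSecond g s.2 - exprThird g s.1)
      map_add' := fun s s' => by
        ext1
        · simp
        · simp only [Prod.fst_add, Prod.snd_add, map_add]; abel
      map_smul' := fun c s => by
        ext1
        · simp
        · ext f P
          simp [smul_sub, smul_add] }
  map_add' g g' := by
    refine LinearMap.ext fun s => ?_
    ext1
    · simp
    · ext f P
      simp [exprSecond]
      abel
  map_smul' c g := by
    refine LinearMap.ext fun s => ?_
    ext1
    · simp
    · ext f P
      simp [exprSecond, smul_sub, smul_add]

/-- The linear map taking a word `V` to the expression for `(f U) ⊚ V`. -/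
def row : TensorAlgebra ℂ A →ₗ[ℂ] Expr A :=
  LinearMap.snd ℂ _ _ ∘ₗ
    LinearMap.applyₗ ((1 : TensorAlgebra ℂ A), (exprFirst 1 : Expr A)) ∘ₗ
      (TensorAlgebra.lift ℂ (step (A := A))).toLinearMap

/-- For a letter `f`, the map that takes the operator `U ⊚ ·` to the operator `(f U) ⊚ ·`. -/
def prepend : A →ₗ[ℂ] Module.End ℂ (Module.End ℂ (TensorAlgebra ℂ A)) where
  toFun f :=
    { toFun := fun P =>
        { toFun := fun V => row V f P
          map_add' := fun V W => by simp
          map_smul' := fun c V => by simp }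
      map_add' := fun P Q => by ext1; simp
      map_smul' := fun c P => by ext1; simp }
  map_add' f g := by ext1 P; ext1; simp
  map_smul' c f := by ext1 P; ext1; simp

end QuasiShuffle

open QuasiShuffle

/-- The modified quasi-shuffle product `⊚` on words with letters in `A`, see
`quasiShuffle_cons_cons`. -/
def quasiShuffle : TensorAlgebra ℂ A →ₗ[ℂ] TensorAlgebra ℂ A →ₗ[ℂ] TensorAlgebra ℂ A :=
  (TensorAlgebra.lift ℂ (prepend (A := A))).toLinearMap.flip LinearMap.id

theorem quasiShuffle_one_left (W : TensorAlgebra ℂ A) : quasiShuffle A 1 W = W := by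
  simp [quasiShuffle]

namespace QuasiShuffle

variable {A}

theorem row_one (f : A) (P : Module.End ℂ (TensorAlgebra ℂ A)) :
    row 1 f P = letterCons A f (P 1) := by
  simp [row, exprFirst]

theorem lift_step_fst (V : TensorAlgebra ℂ A) :
    ∀ s, (TensorAlgebra.lift ℂ (step (A := A)) V s).1 = V * s.1 := by
  induction V using TensorAlgebra.induction with
  | algebraMap c => intro s; simp [Algebra.smul_def]
  | ι g => intro s; simp [step, letterCons]
  | mul a b ha hb => intro s; simp [ha, hb, mul_assoc]
  | add a b ha hb => intro s; simp [ha, hb, add_mul]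

theorem row_cons (g f : A) (V : TensorAlgebra ℂ A) (P : Module.End ℂ (TensorAlgebra ℂ A)) :
    row (letterCons A g V) f P = letterCons A f (P (letterCons A g V)) +
      letterCons A g (row V f P) - letterCons A 1 (letterCons A (f * g) (P V)) := by
  have h := lift_step_fst V (1, exprFirst 1)
  rw [mul_one] at h
  have h2 : TensorAlgebra.lift ℂ (step (A := A)) (letterCons A g V) (1, exprFirst 1) =
      step g (TensorAlgebra.lift ℂ (step (A := A)) V (1, exprFirst 1)) := by
    simp [letterCons]
  simp only [row, LinearMap.comp_apply, LinearMap.applyₗ_apply_apply, AlgHom.toLinearMap_apply,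
    LinearMap.snd_apply]
  rw [h2]
  generalize TensorAlgebra.lift ℂ (step (A := A)) V (1, exprFirst 1) = s at h ⊢
  subst h
  simp [step, exprFirst, exprSecond, exprThird]

end QuasiShuffle

theorem quasiShuffle_cons (f : A) (U V : TensorAlgebra ℂ A) :
    quasiShuffle A (letterCons A f U) V = row V f (quasiShuffle A U) := by
  simp [quasiShuffle, letterCons, prepend]

theorem quasiShuffle_cons_one (f : A) (U : TensorAlgebra ℂ A) :
    quasiShuffle A (letterCons A f U) 1 = letterCons A f (quasiShuffle A U 1) := by
  rw [quasiShuffle_cons, row_one]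

/-- `f U ⊚ g V = f (U ⊚ g V) + g (f U ⊚ V) - 1 [f g] (U ⊚ V)`, where the letter `1` is the unit
of `A` and `[f g]` is the product in `A`. -/
theorem quasiShuffle_cons_cons (f g : A) (U V : TensorAlgebra ℂ A) :
    quasiShuffle A (letterCons A f U) (letterCons A g V) =
      letterCons A f (quasiShuffle A U (letterCons A g V)) +
      letterCons A g (quasiShuffle A (letterCons A f U) V) -
      letterCons A 1 (letterCons A (f * g) (quasiShuffle A U V)) := by
  rw [quasiShuffle_cons, row_cons, quasiShuffle_cons]

/-- The space of nonempty words; the word `f U` is `f ⊗ U`. -/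
abbrev NonemptyWords : Type := A ⊗[ℂ] TensorAlgebra ℂ A

/-- The product `f U ⊘ g V = [f g] (U ⊚ V)` on nonempty words. -/
def wordProduct : NonemptyWords A →ₗ[ℂ] NonemptyWords A →ₗ[ℂ] NonemptyWords A :=
  TensorProduct.map₂ (LinearMap.mul ℂ A) (quasiShuffle A)

theorem wordProduct_tmul (f g : A) (U V : TensorAlgebra ℂ A) :
    wordProduct A (f ⊗ₜ U) (g ⊗ₜ V) = (f * g) ⊗ₜ quasiShuffle A U V := by
  simp [wordProduct]

/-- The map that prepends the letter `1` to a nonempty word. -/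
def prependOne : NonemptyWords A →ₗ[ℂ] NonemptyWords A :=
  TensorProduct.mk ℂ A (TensorAlgebra ℂ A) 1 ∘ₗ TensorProduct.lift (letterCons A)

/-- The nonempty words, with `⊘` and the map that prepends `1`, are the universal (free) commutative
unital Nijenhuis algebra generated by the algebra `A`. -/
structure IsUniversalNijenhuisAlgebra : Prop where
  comm : ∀ x y, wordProduct A x y = wordProduct A y x
  assoc : IsAssoc (wordProduct A)
  unit : IsUnitOf (wordProduct A) (1 ⊗ₜ 1)
  nijenhuis : IsNijenhuis (wordProduct A) (prependOne A)
  universal : ∀ (B : Type) [CommRing B] [Algebra ℂ B] (N : B →ₗ[ℂ] B),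
    IsNijenhuis (LinearMap.mul ℂ B) N → ∀ f : A →ₐ[ℂ] B,
      ∃! F : NonemptyWords A →ₗ[ℂ] B,
        (∀ x y, F (wordProduct A x y) = F x * F y) ∧ (∀ x, F (prependOne A x) = N (F x)) ∧
        ∀ a, F (a ⊗ₜ 1) = f a

/-- The noncommutative symplectic geometry determined by the universal Nijenhuis algebra of `A` on
the linear maps from a Hopf algebra to it. -/
def UniversalNijenhuisModel {H : Type} [Ring H] [Algebra ℂ H] (Δ : H →ₐ[ℂ] H ⊗[ℂ] H)
    (ε : H →ₐ[ℂ] ℂ) : Prop :=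
  let conv := convolution Δ.toLinearMap (wordProduct A)
  IsUniversalNijenhuisAlgebra A ∧
  IsAssoc conv ∧
  IsUnitOf conv (LinearMap.toSpanSingleton ℂ (NonemptyWords A) (1 ⊗ₜ 1) ∘ₗ ε.toLinearMap) ∧
  NijenhuisSymplecticModel conv (liftMap H (prependOne A)) ∧
  ¬ ∃ e, IsUnitOf (deformedProduct conv (liftMap H (prependOne A))) e

end Nijenhuis

/-- Both constructions, from minimal subtraction and from dimensional regularization, for a Hopf
algebra and all algebras of Laurent series with finite pole parts. -/
def SymplecticModels {H : Type} [Ring H] [Algebra ℂ H] (Δ : H →ₐ[ℂ] H ⊗[ℂ] H)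
    (ε : H →ₐ[ℂ] ℂ) : Prop :=
  ∀ (A : Subalgebra ℂ Laurent) (hA : IsRegularizationAlgebra A),
    RotaBaxterModel (B := A) Δ ε (minimalSubtraction hA) ∧ UniversalNijenhuisModel A Δ ε

end

-- Three largely independent arguments are combined.
--
-- Symplectic geometry. Nothing about the deformed products is needed here: every associative
-- algebra carries its canonical geometry (`isSymplecticGeometry`). A coefficient u commutes with
-- all multiplications, so u ham(f) = ham(u f). Hence every element of Ham is an inner derivation;
-- it kills the center and is linear over the coefficients. The canonical form is ω(θ, ham g) =
-- θ(g). It is well defined because, for θ = ham f, the value [f, g] = -[g, f] depends on g only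
-- through ham g. It is invariant under Ham and satisfies i_θ ω = -df for θ = ham f, so Cartan's
-- formula i_θ d = L_θ - d i_θ gives i_θ dω = 0. The rules for forms are not checked on alternating
-- sums. A form is turned into a function of lists of arguments, and on such functions the product,
-- the Lie derivative and d are defined recursively by how they commute with contraction.
-- Associativity, the Leibniz rules, [L_θ, L_η] = L_[θ,η] and d² = 0 become inductions on the list.
-- It remains to see that the explicit formulas obey the same recursions: `IsForm.interior_d_eq` for
-- d and `interior_castDeg_wedge_succ_succ`, with its variants in degree zero, for the product.
--
-- Deformed products. The Nijenhuis relation says that N is multiplicative from the deformed product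
-- to the old one, and it also yields associativity of the deformed product. Deformation commutes
-- with convolution (`deformedProduct_convolution`), so statements on L(H, B) reduce to B:
-- convolution has a unit iff B has one, and a non-cocommutative coproduct gives a noncommutative
-- convolution as soon as b b ≠ 0 for one b. For an idempotent Rota–Baxter map R the operator R_λ is
-- 1 on the image of R and -λ on its kernel, hence Nijenhuis, and invertible iff λ ≠ 0 unless the
-- kernel is zero. For λ ≠ 0 the unit is pulled back along R_λ; for λ = 0 a unit would force 1 to be
-- a pole part. On nonempty words the recursion of ⊚ is the Nijenhuis relation for prepending the
-- letter 1. The universal map is f₁f₂⋯ ↦ φ(f₁) N(φ(f₂) N(⋯)). There is no unit, since deformed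
-- products with the unit of ⊘ have no one-letter component.
--
-- Graphons. Weights strictly between 0 and 1 separate the diagonal of the adjacency matrix from the
-- other entries, so the graphon class determines the vertices with decorations and edges, hence the
-- tree up to reordering of branches. The graphon algebra is therefore the Connes–Kreimer algebra of
-- decorated trees. Its grafting operators B satisfy Δ B = B ⊗ 1 + (id ⊗ B) Δ, and algebra maps out
-- of it are constructed and compared through their values on grafts (`exists_algHom_graft`,
-- `algHom_eq_of_graft`). Coassociativity, the counit laws and the antipode follow.

namespace AssocProduct

variable {V : Type} [AddCommGroup V] [Module ℂ V] (C : AssocProduct V)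

/-! ### Hamiltonian derivations -/

theorem bracket_leibniz (a b c : V) :
    C.bracket a (C.mul b c) = C.mul (C.bracket a b) c + C.mul b (C.bracket a c) := by
  simp only [bracket, map_sub, LinearMap.sub_apply, C.assoc _ _ _]
  abel

theorem bracket_jacobi (a b c : V) :
    C.bracket a (C.bracket b c) + C.bracket b (C.bracket c a) + C.bracket c (C.bracket a b) = 0 := by
  simp only [bracket, map_sub, LinearMap.sub_apply, C.assoc _ _ _]
  abel

theorem bracket_antisymm (a b : V) : C.bracket a b = - C.bracket b a := by
  simp [bracket]

theorem Ham_le_der : C.Ham ≤ C.der := by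
  intro θ hθ
  obtain ⟨f, rfl⟩ := C.exists_eq_ham hθ
  intro a b
  simp only [ham_apply, bracket_leibniz]

theorem ham_leibniz (θ : C.Ham) (a b : V) :
    θ.1 (C.mul a b) = C.mul (θ.1 a) b + C.mul a (θ.1 b) := C.Ham_le_der θ.2 a b

theorem der_lie {θ η : V →ₗ[ℂ] V} (hθ : θ ∈ C.der) (hη : η ∈ C.der) :
    θ ∘ₗ η - η ∘ₗ θ ∈ C.der := by
  intro a b
  simp only [LinearMap.sub_apply, LinearMap.comp_apply, hη a b, hθ a b, map_add, hθ _ _, hη _ _,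
    map_sub]
  abel

/-- The elements of Ham are inner. A general derivation only preserves the center; vanishing on it
is what makes the elements of Ham linear over the coefficients, in `ham_coeff`. -/
theorem ham_center (θ : C.Ham) (z : C.center) : θ.1 z.1 = 0 := by
  obtain ⟨f, hf⟩ := C.exists_eq_ham θ.2
  rw [hf, ham_apply, bracket, z.2 f, sub_self]

theorem ham_coeff (θ : C.Ham) (p : ℂ × C.center) (a : V) :
    θ.1 (C.coeff p a) = C.coeff p (θ.1 a) := by
  simp [coeff, ham_leibniz, ham_center]

theorem mul_coeff (p : ℂ × C.center) (a b : V) :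
    C.mul a (C.coeff p b) = C.coeff p (C.mul a b) := by
  have h := p.2.2 a
  simp only [coeff, LinearMap.add_apply, LinearMap.smul_apply, LinearMap.id_apply, map_add,
    map_smul, ← C.assoc _ _ _, h]

theorem coeff_mul (p : ℂ × C.center) (a b : V) :
    C.mul (C.coeff p a) b = C.coeff p (C.mul a b) := by
  simp [coeff, C.assoc _ _ _]

theorem coe_hamLie_apply (θ η : C.Ham) (a : V) :
    (C.hamLie θ η).1 a = θ.1 (η.1 a) - η.1 (θ.1 a) := rfl

theorem coe_hamSMul_apply (p : ℂ × C.center) (θ : C.Ham) (a : V) :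
    (C.hamSMul p θ).1 a = C.coeff p (θ.1 a) := rfl

theorem ham_ext {θ η : C.Ham} (h : ∀ a, θ.1 a = η.1 a) : θ = η :=
  Subtype.ext (LinearMap.ext h)

theorem hamLie_antisymm (θ η : C.Ham) : C.hamLie θ η = - C.hamLie η θ :=
  C.ham_ext fun a => by
    simp [coe_hamLie_apply]

theorem hamLie_add_left (θ θ' η : C.Ham) :
    C.hamLie (θ + θ') η = C.hamLie θ η + C.hamLie θ' η :=
  C.ham_ext fun a => by
    simp only [coe_hamLie_apply, Submodule.coe_add, LinearMap.add_apply, map_add]; abel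

theorem hamLie_add_right (θ η η' : C.Ham) :
    C.hamLie θ (η + η') = C.hamLie θ η + C.hamLie θ η' :=
  C.ham_ext fun a => by
    simp only [coe_hamLie_apply, Submodule.coe_add, LinearMap.add_apply, map_add]; abel

/-- No Leibniz correction appears because the derivations commute with coefficients. This is why Lie
derivatives and d preserve linearity over the coefficients term by term. -/
theorem hamLie_hamSMul_left (p : ℂ × C.center) (θ η : C.Ham) :
    C.hamLie (C.hamSMul p θ) η = C.hamSMul p (C.hamLie θ η) :=
  C.ham_ext fun a => by
    simp only [coe_hamLie_apply, coe_hamSMul_apply, ham_coeff, map_sub]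

theorem hamLie_hamSMul_right (p : ℂ × C.center) (θ η : C.Ham) :
    C.hamLie θ (C.hamSMul p η) = C.hamSMul p (C.hamLie θ η) :=
  C.ham_ext fun a => by
    simp only [coe_hamLie_apply, coe_hamSMul_apply, ham_coeff, map_sub]

theorem hamLie_jacobi (θ η ζ : C.Ham) :
    C.hamLie θ (C.hamLie η ζ) = C.hamLie η (C.hamLie θ ζ) + C.hamLie (C.hamLie θ η) ζ :=
  C.ham_ext fun a => by
    simp only [coe_hamLie_apply, Submodule.coe_add, LinearMap.add_apply, map_sub]; abel

/-! ### Cochains of all degrees as functions of lists -/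

/-- Families of cochains of all degrees, as functions of a list of arguments. -/
abbrev ListCochain : Type := List C.Ham → V

variable {C}

/-- Contraction: insertion of a first argument. -/
def contract (θ : C.Ham) (ω : C.ListCochain) : C.ListCochain := fun L => ω (θ :: L)

/-- Multiplication by `(-1) ^ n` in degree `n`. -/
def parity (ω : C.ListCochain) : C.ListCochain := fun L => (-1 : ℂ) ^ L.length • ω L

/-- The product of list cochains, defined by the super-derivation property of contractions. -/
def listWedge : C.ListCochain → C.ListCochain → List C.Ham → V
  | α, β, [] => C.mul (α []) (β [])
  | α, β, θ :: L => listWedge (contract θ α) β L + listWedge (parity α) (contract θ β) L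

/-- The Lie derivative. -/
def listLie (θ : C.Ham) : C.ListCochain → List C.Ham → V
  | ω, [] => θ.1 (ω [])
  | ω, η :: L => listLie θ (contract η ω) L - ω (C.hamLie θ η :: L)

/-- The differential, defined by Cartan's formula. -/
def listD : C.ListCochain → List C.Ham → V
  | _, [] => 0
  | ω, θ :: L => listLie θ ω L - listD (contract θ ω) L

/-- List cochains that are antisymmetric and multilinear over the coefficients. -/
structure IsListForm (ω : C.ListCochain) : Prop where
  add : ∀ L₀ x y L, ω (L₀ ++ (x + y) :: L) = ω (L₀ ++ x :: L) + ω (L₀ ++ y :: L)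
  smul : ∀ L₀ p x L, ω (L₀ ++ C.hamSMul p x :: L) = C.coeff p (ω (L₀ ++ x :: L))
  swap : ∀ L₀ x y L, ω (L₀ ++ x :: y :: L) = - ω (L₀ ++ y :: x :: L)

/-- Together with the values on the empty list, this and the next two identities determine the
operations. Identities between operations are proved below by contracting both sides and inducting
on the list. -/
theorem contract_listWedge (θ : C.Ham) (α β : C.ListCochain) :
    contract θ (listWedge α β) =
      listWedge (contract θ α) β + listWedge (parity α) (contract θ β) := rfl

theorem contract_listLie (θ η : C.Ham) (ω : C.ListCochain) :
    contract η (listLie θ ω) = listLie θ (contract η ω) - contract (C.hamLie θ η) ω := rfl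

theorem contract_listD (θ : C.Ham) (ω : C.ListCochain) :
    contract θ (listD ω) = listLie θ ω - listD (contract θ ω) := rfl

theorem contract_parity (θ : C.Ham) (ω : C.ListCochain) :
    contract θ (parity ω) = - parity (contract θ ω) := by
  funext L
  simp [contract, parity, pow_succ]

theorem parity_parity (ω : C.ListCochain) : parity (parity ω) = ω := by
  funext L
  simp [parity, smul_smul, ← mul_pow]

theorem contract_add (θ : C.Ham) (α β : C.ListCochain) :
    contract θ (α + β) = contract θ α + contract θ β := rfl

theorem parity_add (α β : C.ListCochain) : parity (α + β) = parity α + parity β := by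
  funext L; simp [parity]

theorem parity_sub (α β : C.ListCochain) : parity (α - β) = parity α - parity β := by
  funext L; simp [parity, smul_sub]

/-! #### Linearity -/

theorem listWedge_add_left (α α' β : C.ListCochain) :
    listWedge (α + α') β = listWedge α β + listWedge α' β := by
  funext L
  induction L generalizing α α' β with
  | nil => simp [listWedge]
  | cons θ L ih =>
    simp only [listWedge, Pi.add_apply, contract_add, parity_add, ih] at ih ⊢
    abel

theorem listWedge_add_right (α β β' : C.ListCochain) :
    listWedge α (β + β') = listWedge α β + listWedge α β' := by
  funext L
  induction L generalizing α β β' with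
  | nil => simp [listWedge]
  | cons θ L ih =>
    simp only [listWedge, Pi.add_apply, contract_add, ih] at ih ⊢
    abel

/-- Stated for any g commuting with the multiplication, so that signs, scalars and coefficients are
all instances. -/
theorem listWedge_comp_left {g : V →ₗ[ℂ] V} (hg : ∀ a b, C.mul (g a) b = g (C.mul a b))
    (α β : C.ListCochain) : listWedge (g ∘ α) β = g ∘ listWedge α β := by
  funext L
  induction L generalizing α β with
  | nil => simp [listWedge, hg]
  | cons θ L ih =>
    have h1 : contract θ (g ∘ α) = g ∘ contract θ α := rfl
    have h2 : parity (g ∘ α) = g ∘ parity α := by funext L; simp [parity]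
    simp only [listWedge, Function.comp_apply, h1, h2, ih, map_add]

theorem listWedge_comp_right {g : V →ₗ[ℂ] V} (hg : ∀ a b, C.mul a (g b) = g (C.mul a b))
    (α β : C.ListCochain) : listWedge α (g ∘ β) = g ∘ listWedge α β := by
  funext L
  induction L generalizing α β with
  | nil => simp [listWedge, hg]
  | cons θ L ih =>
    have h1 : contract θ (g ∘ β) = g ∘ contract θ β := rfl
    simp only [listWedge, Function.comp_apply, h1, ih, map_add]

theorem listWedge_neg_left (α β : C.ListCochain) :
    listWedge (-α) β = - listWedge α β :=
  listWedge_comp_left (g := -LinearMap.id) (by simp) α β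

theorem listWedge_neg_right (α β : C.ListCochain) :
    listWedge α (-β) = - listWedge α β :=
  listWedge_comp_right (g := -LinearMap.id) (by simp) α β

theorem listWedge_sub_left (α α' β : C.ListCochain) :
    listWedge (α - α') β = listWedge α β - listWedge α' β := by
  rw [sub_eq_add_neg, listWedge_add_left, listWedge_neg_left, sub_eq_add_neg]

theorem listWedge_sub_right (α β β' : C.ListCochain) :
    listWedge α (β - β') = listWedge α β - listWedge α β' := by
  rw [sub_eq_add_neg, listWedge_add_right, listWedge_neg_right, sub_eq_add_neg]

theorem listWedge_zero_left (β : C.ListCochain) : listWedge 0 β = 0 := by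
  simpa using listWedge_sub_left 0 0 β

theorem listWedge_zero_right (α : C.ListCochain) : listWedge α 0 = 0 := by
  simpa using listWedge_sub_right α 0 0

/-- The recursion of the product puts a sign on its left factor; in iterated products that factor is
itself a product, and the sign has to be distributed. -/
theorem parity_listWedge (α β : C.ListCochain) :
    parity (listWedge α β) = listWedge (parity α) (parity β) := by
  funext L
  induction L generalizing α β with
  | nil => simp [parity, listWedge]
  | cons θ L ih =>
    have h := fun α β => congrFun (contract_parity θ (listWedge α β)) L
    simp only [contract] at h
    rw [h, contract_listWedge, parity_add]
    simp only [listWedge, contract_parity, listWedge_neg_left, listWedge_neg_right, Pi.neg_apply,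
      Pi.add_apply, ih]
    abel

theorem listLie_add (θ : C.Ham) (α β : C.ListCochain) :
    listLie θ (α + β) = listLie θ α + listLie θ β := by
  funext L
  induction L generalizing α β with
  | nil => simp [listLie]
  | cons η L ih =>
    simp only [listLie, Pi.add_apply, contract_add, ih] at ih ⊢
    abel

theorem listLie_comp (θ : C.Ham) {g : V →ₗ[ℂ] V} (hg : ∀ a, θ.1 (g a) = g (θ.1 a))
    (α : C.ListCochain) : listLie θ (g ∘ α) = g ∘ listLie θ α := by
  funext L
  induction L generalizing α with
  | nil => simp [listLie, hg]
  | cons η L ih =>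
    have h1 : contract η (g ∘ α) = g ∘ contract η α := rfl
    simp only [listLie, Function.comp_apply, h1, ih, map_sub]

theorem listLie_neg (θ : C.Ham) (α : C.ListCochain) : listLie θ (-α) = - listLie θ α :=
  listLie_comp θ (g := -LinearMap.id) (by simp) α

theorem listLie_sub (θ : C.Ham) (α β : C.ListCochain) :
    listLie θ (α - β) = listLie θ α - listLie θ β := by
  rw [sub_eq_add_neg, listLie_add, listLie_neg, sub_eq_add_neg]

theorem listD_add (α β : C.ListCochain) : listD (α + β) = listD α + listD β := by
  funext L
  induction L generalizing α β with
  | nil => simp [listD]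
  | cons η L ih =>
    simp only [listD, Pi.add_apply, contract_add, ih, listLie_add] at ih ⊢
    abel

theorem listD_comp {g : V →ₗ[ℂ] V} (hg : ∀ (θ : C.Ham) a, θ.1 (g a) = g (θ.1 a))
    (α : C.ListCochain) : listD (g ∘ α) = g ∘ listD α := by
  funext L
  induction L generalizing α with
  | nil => simp [listD]
  | cons η L ih =>
    have h1 : contract η (g ∘ α) = g ∘ contract η α := rfl
    simp only [listD, Function.comp_apply, h1, ih, map_sub, listLie_comp η (hg η)]

theorem listD_neg (α : C.ListCochain) : listD (-α) = - listD α :=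
  listD_comp (g := -LinearMap.id) (by simp) α

theorem listD_sub (α β : C.ListCochain) : listD (α - β) = listD α - listD β := by
  rw [sub_eq_add_neg, listD_add, listD_neg, sub_eq_add_neg]

theorem listD_zero : listD (0 : C.ListCochain) = 0 := by
  simpa using listD_sub (0 : C.ListCochain) 0

theorem listLie_parity (θ : C.Ham) (ω : C.ListCochain) :
    listLie θ (parity ω) = parity (listLie θ ω) := by
  funext L
  induction L generalizing ω with
  | nil => simp [listLie, parity]
  | cons η L ih =>
    have h := congrFun (contract_parity η (listLie θ ω)) L
    have h' := congrFun (contract_parity (C.hamLie θ η) ω) L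
    simp only [contract] at h h'
    rw [h]
    simp only [listLie, contract_parity, listLie_neg, Pi.neg_apply, ih, h', contract_listLie,
      parity_sub, Pi.sub_apply]
    simp only [parity, contract]
    abel

theorem listD_parity (ω : C.ListCochain) : listD (parity ω) = - parity (listD ω) := by
  funext L
  induction L generalizing ω with
  | nil => simp [listD, parity]
  | cons η L ih =>
    have h := congrFun (contract_parity η (listD ω)) L
    simp only [contract] at h
    rw [Pi.neg_apply, h, contract_listD]
    simp only [listD, contract_parity, listD_neg, Pi.neg_apply, ih, listLie_parity, parity_sub,
      Pi.sub_apply]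
    abel

/-! #### The differential graded algebra of list cochains -/

/-- Contraction is a super-derivation of both sides, so each contraction is a sum of the same three
triple products, to which the induction applies. Antisymmetry plays no role. -/
theorem listWedge_assoc (α β γ : C.ListCochain) :
    listWedge (listWedge α β) γ = listWedge α (listWedge β γ) := by
  funext L
  induction L generalizing α β γ with
  | nil => simp [listWedge, C.assoc _ _ _]
  | cons θ L ih =>
    simp only [listWedge, contract_listWedge, listWedge_add_left, listWedge_add_right,
      parity_listWedge, Pi.add_apply, ih]
    abel

theorem listLie_listWedge (θ : C.Ham) (α β : C.ListCochain) :
    listLie θ (listWedge α β) = listWedge (listLie θ α) β + listWedge α (listLie θ β) := by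
  funext L
  induction L generalizing α β with
  | nil => simp [listWedge, listLie, C.ham_leibniz]
  | cons η L ih =>
    have h := congrFun (contract_listWedge (C.hamLie θ η) α β) L
    simp only [contract] at h
    simp only [listLie, h, contract_listWedge, listLie_add, Pi.add_apply, ih]
    simp only [listWedge, contract_listLie, listWedge_sub_left, listWedge_sub_right,
      Pi.sub_apply, listLie_parity]
    abel

/-- After contraction with θ, Cartan's formula leaves the Leibniz rule for L_θ and the induction
hypothesis for the two products in the contraction of αβ; the mixed terms cancel because d and
contraction both anticommute with `parity`. -/
theorem listD_listWedge (α β : C.ListCochain) :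
    listD (listWedge α β) = listWedge (listD α) β + listWedge (parity α) (listD β) := by
  funext L
  induction L generalizing α β with
  | nil => simp [listWedge, listD]
  | cons θ L ih =>
    simp only [listD, contract_listWedge, listD_add, Pi.add_apply, ih, listLie_listWedge]
    simp only [listWedge, contract_listD, listWedge_sub_left, listWedge_sub_right, Pi.sub_apply,
      Pi.neg_apply, listD_parity, contract_parity, listWedge_neg_left, parity_parity]
    abel

theorem IsListForm.contract {ω : C.ListCochain} (h : IsListForm ω) (θ : C.Ham) :
    IsListForm (contract θ ω) where
  add L₀ x y L := h.add (θ :: L₀) x y L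
  smul L₀ p x L := h.smul (θ :: L₀) p x L
  swap L₀ x y L := h.swap (θ :: L₀) x y L

theorem IsListForm.contract_add_left {ω : C.ListCochain} (h : IsListForm ω) (x y : C.Ham) :
    AssocProduct.contract (x + y) ω = AssocProduct.contract x ω + AssocProduct.contract y ω :=
  funext fun L => h.add [] x y L

theorem IsListForm.contract_smul {ω : C.ListCochain} (h : IsListForm ω) (p : ℂ × C.center)
    (x : C.Ham) : AssocProduct.contract (C.hamSMul p x) ω = C.coeff p ∘ AssocProduct.contract x ω :=
  funext fun L => h.smul [] p x L

theorem IsListForm.contract_swap {ω : C.ListCochain} (h : IsListForm ω) (x y : C.Ham) :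
    AssocProduct.contract y (AssocProduct.contract x ω) =
      - AssocProduct.contract x (AssocProduct.contract y ω) :=
  funext fun L => h.swap [] x y L

theorem IsListForm.neg {α : C.ListCochain} (hα : IsListForm α) : IsListForm (-α) where
  add L₀ x y L := by simp only [Pi.neg_apply, hα.add]; abel
  smul L₀ p x L := by simp only [Pi.neg_apply, hα.smul, map_neg]
  swap L₀ x y L := by simp only [Pi.neg_apply, hα.swap L₀ x]

theorem IsListForm.parity {α : C.ListCochain} (hα : IsListForm α) : IsListForm (parity α) where
  add L₀ x y L := by simp [AssocProduct.parity, hα.add]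
  smul L₀ p x L := by simp [AssocProduct.parity, hα.smul]
  swap L₀ x y L := by simp [AssocProduct.parity, hα.swap L₀ x]

/-- Induction on the arguments in front of the slot considered: removing the first one replaces (α,
β) by (i_z α, β) and (parity α, i_z β), which are again pairs of forms. -/
theorem IsListForm.listWedge_contract {α β : C.ListCochain} (hα : IsListForm α)
    (hβ : IsListForm β) (L₀ : List C.Ham) :
    (∀ x y L, listWedge α β (L₀ ++ (x + y) :: L) =
      listWedge α β (L₀ ++ x :: L) + listWedge α β (L₀ ++ y :: L)) ∧
    (∀ p x L, listWedge α β (L₀ ++ C.hamSMul p x :: L) =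
      C.coeff p (listWedge α β (L₀ ++ x :: L))) ∧
    ∀ x y L, listWedge α β (L₀ ++ x :: y :: L) = - listWedge α β (L₀ ++ y :: x :: L) := by
  induction L₀ generalizing α β with
  | nil =>
    refine ⟨fun x y L => ?_, fun p x L => ?_, fun x y L => ?_⟩
    · simp only [List.nil_append, listWedge, hα.contract_add_left, hβ.contract_add_left,
        listWedge_add_left, listWedge_add_right, Pi.add_apply]
      abel
    · simp only [List.nil_append, listWedge, hα.contract_smul, hβ.contract_smul,
        listWedge_comp_left (C.coeff_mul p), listWedge_comp_right (C.mul_coeff p),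
        Function.comp_apply, map_add]
    · simp only [List.nil_append, listWedge, contract_parity, parity_parity, listWedge_neg_left,
        Pi.neg_apply, hα.contract_swap x y, hβ.contract_swap x y, listWedge_neg_right]
      abel
  | cons z L₀ ih =>
    obtain ⟨h1, h2, h3⟩ := ih (hα.contract z) hβ
    obtain ⟨h1', h2', h3'⟩ := ih hα.parity (hβ.contract z)
    refine ⟨fun x y L => ?_, fun p x L => ?_, fun x y L => ?_⟩
    · simp only [List.cons_append, listWedge, h1, h1']; abel
    · simp only [List.cons_append, listWedge, h2, h2', map_add]
    · simp only [List.cons_append, listWedge, h3 x y, h3' x y]; abel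

theorem IsListForm.listWedge {α β : C.ListCochain} (hα : IsListForm α) (hβ : IsListForm β) :
    IsListForm (listWedge α β) where
  add L₀ := (hα.listWedge_contract hβ L₀).1
  smul L₀ := (hα.listWedge_contract hβ L₀).2.1
  swap L₀ := (hα.listWedge_contract hβ L₀).2.2

theorem IsListForm.contract_sub_left {ω : C.ListCochain} (h : IsListForm ω) (x y : C.Ham) :
    AssocProduct.contract (x - y) ω = AssocProduct.contract x ω - AssocProduct.contract y ω := by
  have := h.contract_add_left (x - y) y
  rw [sub_add_cancel] at this
  rw [this, add_sub_cancel_right]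

theorem IsListForm.contract_neg_left {ω : C.ListCochain} (h : IsListForm ω) (x : C.Ham) :
    AssocProduct.contract (-x) ω = - AssocProduct.contract x ω := by
  have := h.contract_sub_left 0 x
  have h0 := h.contract_sub_left 0 0
  rw [sub_zero, sub_self] at h0
  rwa [zero_sub, h0, zero_sub] at this

theorem IsListForm.listLie {ω : C.ListCochain} (h : IsListForm ω) (θ : C.Ham) :
    IsListForm (listLie θ ω) := by
  refine ⟨fun L₀ => ?_, fun L₀ => ?_, fun L₀ => ?_⟩
  · intro x y L
    induction L₀ generalizing ω with
    | nil =>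
      have h1 := h.add [] (C.hamLie θ x) (C.hamLie θ y) L
      simp only [List.nil_append] at h1
      simp only [List.nil_append, AssocProduct.listLie, h.contract_add_left, listLie_add,
        Pi.add_apply, C.hamLie_add_right, h1]
      abel
    | cons z L₀ ih =>
      have h1 := h.add (C.hamLie θ z :: L₀) x y L
      simp only [List.cons_append] at h1
      simp only [List.cons_append, AssocProduct.listLie, ih (h.contract z), h1]
      abel
  · intro p x L
    induction L₀ generalizing ω with
    | nil =>
      have h1 := h.smul [] p (C.hamLie θ x) L
      simp only [List.nil_append] at h1
      simp only [List.nil_append, AssocProduct.listLie, h.contract_smul,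
        listLie_comp θ (C.ham_coeff θ p), Function.comp_apply, C.hamLie_hamSMul_right, h1, map_sub]
    | cons z L₀ ih =>
      have h1 := h.smul (C.hamLie θ z :: L₀) p x L
      simp only [List.cons_append] at h1
      simp only [List.cons_append, AssocProduct.listLie, ih (h.contract z), h1, map_sub]
  · intro x y L
    induction L₀ generalizing ω with
    | nil =>
      have h1 := fun x y => h.swap [] x y L
      simp only [List.nil_append] at h1
      simp only [List.nil_append, AssocProduct.listLie, h.contract_swap x y, listLie_neg,
        Pi.neg_apply, AssocProduct.contract]
      rw [h1 (C.hamLie θ x), h1 x]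
      abel
    | cons z L₀ ih =>
      have h1 := h.swap (C.hamLie θ z :: L₀) x y L
      simp only [List.cons_append] at h1
      simp only [List.cons_append, AssocProduct.listLie, ih (h.contract z), h1]
      abel

/-- The vector field enters ω through the brackets in its arguments, so additivity of ω itself is
needed. -/
theorem IsListForm.listLie_add_left {ω : C.ListCochain} (h : IsListForm ω) (θ η : C.Ham) :
    AssocProduct.listLie (θ + η) ω = AssocProduct.listLie θ ω + AssocProduct.listLie η ω := by
  funext L
  induction L generalizing ω with
  | nil => simp [AssocProduct.listLie]
  | cons ζ L ih =>
    have h1 := h.add [] (C.hamLie θ ζ) (C.hamLie η ζ) L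
    simp only [List.nil_append] at h1
    simp only [AssocProduct.listLie, ih (h.contract ζ), Pi.add_apply, C.hamLie_add_left, h1]
    abel

theorem IsListForm.listLie_smul_left {ω : C.ListCochain} (h : IsListForm ω) (p : ℂ × C.center)
    (θ : C.Ham) :
    AssocProduct.listLie (C.hamSMul p θ) ω = C.coeff p ∘ AssocProduct.listLie θ ω := by
  funext L
  induction L generalizing ω with
  | nil => simp [AssocProduct.listLie, C.coe_hamSMul_apply]
  | cons ζ L ih =>
    have h1 := h.smul [] p (C.hamLie θ ζ) L
    simp only [List.nil_append] at h1
    simp only [AssocProduct.listLie, ih (h.contract ζ), Function.comp_apply,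
      C.hamLie_hamSMul_left, h1, map_sub]

/-- On the empty list this is the definition of the commutator; contraction adds the Jacobi identity
in the first slot of ω. -/
theorem IsListForm.listLie_listLie {ω : C.ListCochain} (h : IsListForm ω) (θ η : C.Ham) :
    AssocProduct.listLie θ (AssocProduct.listLie η ω) =
      AssocProduct.listLie η (AssocProduct.listLie θ ω) +
        AssocProduct.listLie (C.hamLie θ η) ω := by
  funext L
  induction L generalizing ω with
  | nil => simp [AssocProduct.listLie, C.coe_hamLie_apply]
  | cons ζ L ih =>
    have h1 := h.add [] (C.hamLie η (C.hamLie θ ζ)) (C.hamLie (C.hamLie θ η) ζ) L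
    simp only [List.nil_append] at h1
    simp only [AssocProduct.listLie, contract_listLie, listLie_sub, Pi.sub_apply, Pi.add_apply,
      ih (h.contract ζ), C.hamLie_jacobi θ η ζ, h1]
    abel

theorem IsListForm.listLie_listD {ω : C.ListCochain} (h : IsListForm ω) (θ : C.Ham) :
    AssocProduct.listLie θ (listD ω) = listD (AssocProduct.listLie θ ω) := by
  funext L
  induction L generalizing ω with
  | nil => simp [AssocProduct.listLie, listD]
  | cons η L ih =>
    simp only [AssocProduct.listLie, listD, contract_listD, contract_listLie, listLie_sub,
      listD_sub, Pi.sub_apply, ih (h.contract η), h.listLie_listLie θ η, Pi.add_apply]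
    abel

/-- By Cartan's formula twice, i_θ d² = L_θ d - d L_θ + d² i_θ; the first two terms cancel and the
last vanishes by induction. -/
theorem IsListForm.listD_listD {ω : C.ListCochain} (h : IsListForm ω) :
    listD (listD ω) = 0 := by
  funext L
  induction L generalizing ω with
  | nil => rfl
  | cons θ L ih =>
    simp only [listD, contract_listD, listD_sub, Pi.sub_apply, ih (h.contract θ),
      h.listLie_listD θ]
    simp

theorem IsListForm.listD {ω : C.ListCochain} (h : IsListForm ω) : IsListForm (listD ω) := by
  refine ⟨fun L₀ => ?_, fun L₀ => ?_, fun L₀ => ?_⟩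
  · intro x y L
    induction L₀ generalizing ω with
    | nil =>
      simp only [List.nil_append, AssocProduct.listD, h.contract_add_left, listD_add,
        h.listLie_add_left, Pi.add_apply]
      abel
    | cons z L₀ ih =>
      simp only [List.cons_append, AssocProduct.listD, ih (h.contract z), (h.listLie z).add]
      abel
  · intro p x L
    induction L₀ generalizing ω with
    | nil =>
      simp only [List.nil_append, AssocProduct.listD, h.contract_smul, h.listLie_smul_left,
        listD_comp (fun θ => C.ham_coeff θ p), Function.comp_apply, map_sub]
    | cons z L₀ ih =>
      simp only [List.cons_append, AssocProduct.listD, ih (h.contract z), (h.listLie z).smul,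
        map_sub]
  · intro x y L
    induction L₀ generalizing ω with
    | nil =>
      -- In dω(x, y, …) the terms with L_x and L_y are exchanged by swapping x and y, and the double
      -- contraction is antisymmetric. What remains is ω([x, y], …), antisymmetric because the
      -- bracket is.
      have h1 := congrFun (h.contract_neg_left (C.hamLie y x)) L
      rw [← C.hamLie_antisymm] at h1
      simp only [AssocProduct.contract, Pi.neg_apply] at h1
      simp only [List.nil_append, AssocProduct.listD, AssocProduct.listLie, h.contract_swap x y,
        listD_neg, Pi.neg_apply, h1]
      abel
    | cons z L₀ ih =>
      simp only [List.cons_append, AssocProduct.listD, ih (h.contract z), (h.listLie z).swap L₀ x y]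
      abel

end AssocProduct

-- Comparison of forms of a fixed degree with functions of lists.

namespace AssocProduct

variable {V : Type} [AddCommGroup V] [Module ℂ V] {C : AssocProduct V}

/-! ### Cochains of a fixed degree as list cochains -/

/-- A cochain of degree `n`, as a list cochain that vanishes on lists of a different length. -/
noncomputable def ofCochain {n : ℕ} (ω : C.Cochain n) : C.ListCochain := fun L =>
  if h : L.length = n then ω (fun i => L.get (i.cast h.symm)) else 0

theorem ofCochain_of_length_ne {n : ℕ} (ω : C.Cochain n) {L : List C.Ham} (h : L.length ≠ n) :
    ofCochain ω L = 0 := dif_neg h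

theorem ofCochain_ofFn {n : ℕ} (ω : C.Cochain n) (θ : Fin n → C.Ham) :
    ofCochain ω (List.ofFn θ) = ω θ := by
  rw [ofCochain, dif_pos (by simp)]
  congr 1
  funext i
  simp

/-- This carries identities proved on lists back to forms. -/
theorem ofCochain_injective {n : ℕ} {α β : C.Cochain n} (h : ofCochain α = ofCochain β) :
    α = β := by
  funext θ
  rw [← ofCochain_ofFn α, h, ofCochain_ofFn]

theorem ofCochain_castDeg {m n : ℕ} (h : m = n) (ω : C.Cochain m) :
    ofCochain (C.castDeg h ω) = ofCochain ω := by
  subst h; rfl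

theorem contract_ofCochain {n : ℕ} (θ : C.Ham) (ω : C.Cochain (n + 1)) :
    contract θ (ofCochain ω) = ofCochain (C.interior θ ω) := by
  funext L
  simp only [contract, ofCochain, List.length_cons, Nat.add_right_cancel_iff]
  split_ifs with h
  · rw [interior]
    congr 1
    funext i
    refine Fin.cases ?_ (fun j => ?_) i <;> rfl
  · rfl

theorem contract_ofCochain_zero (θ : C.Ham) (ω : C.Cochain 0) :
    contract θ (ofCochain ω) = 0 := by
  funext L
  exact ofCochain_of_length_ne ω (by simp)

theorem ofCochain_add {n : ℕ} (α β : C.Cochain n) :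
    ofCochain (α + β) = ofCochain α + ofCochain β := by
  funext L
  simp only [ofCochain, Pi.add_apply]
  split_ifs <;> simp

theorem ofCochain_neg {n : ℕ} (α : C.Cochain n) : ofCochain (-α) = - ofCochain α := by
  funext L
  simp only [ofCochain, Pi.neg_apply]
  split_ifs <;> simp

theorem ofCochain_sub {n : ℕ} (α β : C.Cochain n) :
    ofCochain (α - β) = ofCochain α - ofCochain β := by
  rw [sub_eq_add_neg, ofCochain_add, ofCochain_neg, sub_eq_add_neg]

theorem ofCochain_smul {n : ℕ} (c : ℂ) (α : C.Cochain n) :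
    ofCochain (c • α) = c • ofCochain α := by
  funext L
  simp only [ofCochain, Pi.smul_apply]
  split_ifs <;> simp

theorem ofCochain_zero {n : ℕ} : ofCochain (0 : C.Cochain n) = 0 := by
  simpa using ofCochain_sub (0 : C.Cochain n) 0

theorem parity_ofCochain {n : ℕ} (α : C.Cochain n) :
    parity (ofCochain α) = (-1 : ℂ) ^ n • ofCochain α := by
  funext L
  by_cases h : L.length = n
  · simp [parity, h]
  · simp [parity, ofCochain_of_length_ne α h]

theorem IsForm.interior {n : ℕ} {ω : C.Cochain (n + 1)} (h : C.IsForm (n + 1) ω) (θ : C.Ham) :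
    C.IsForm n (C.interior θ ω) where
  map_add m i x y := by
    simp only [AssocProduct.interior, Fin.cons_update, h.map_add]
  map_coeff m i p x := by
    simp only [AssocProduct.interior, Fin.cons_update, h.map_coeff]
  map_swap m i j hij := by
    have hs : (Fin.cons θ (m ∘ Equiv.swap i j) : Fin (n + 1) → C.Ham) =
        Fin.cons θ m ∘ Equiv.swap i.succ j.succ := by
      funext k
      refine Fin.cases ?_ (fun k => ?_) k
      · simp [Equiv.swap_apply_of_ne_of_ne (Fin.succ_ne_zero i).symm (Fin.succ_ne_zero j).symm]
      · simp only [Fin.cons_succ, Function.comp_apply, Equiv.swap_apply_def, Fin.succ_inj]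
        split_ifs <;> simp
    rw [AssocProduct.interior, hs, h.map_swap _ _ _ (by simpa using hij)]
    rfl

theorem IsForm.isListForm {n : ℕ} {ω : C.Cochain n} (h : C.IsForm n ω) :
    IsListForm (ofCochain ω) := by
  refine ⟨fun L₀ => ?_, fun L₀ => ?_, fun L₀ => ?_⟩
  · intro x y L
    induction L₀ generalizing n ω with
    | nil =>
      change contract (x + y) (ofCochain ω) L =
        contract x (ofCochain ω) L + contract y (ofCochain ω) L
      cases n with
      | zero => simp [contract_ofCochain_zero]
      | succ n =>
        rw [contract_ofCochain, contract_ofCochain, contract_ofCochain, ← Pi.add_apply,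
          ← ofCochain_add]
        congr 2
        funext v
        have := h.map_add (Fin.cons 0 v) 0 x y
        simp only [Fin.update_cons_zero] at this
        exact this
    | cons z L₀ ih =>
      change contract z (ofCochain ω) (L₀ ++ (x + y) :: L) =
        contract z (ofCochain ω) (L₀ ++ x :: L) + contract z (ofCochain ω) (L₀ ++ y :: L)
      cases n with
      | zero => simp [contract_ofCochain_zero]
      | succ n => rw [contract_ofCochain]; exact ih (h.interior z)
  · intro p x L
    induction L₀ generalizing n ω with
    | nil =>
      change contract (C.hamSMul p x) (ofCochain ω) L = C.coeff p (contract x (ofCochain ω) L)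
      cases n with
      | zero => simp [contract_ofCochain_zero]
      | succ n =>
        rw [contract_ofCochain, contract_ofCochain]
        by_cases hL : L.length = n
        · simp only [ofCochain, dif_pos hL]
          have := h.map_coeff (Fin.cons 0 (fun i => L.get (i.cast hL.symm))) 0 p x
          simp only [Fin.update_cons_zero] at this
          exact this
        · rw [ofCochain_of_length_ne _ hL, ofCochain_of_length_ne _ hL, map_zero]
    | cons z L₀ ih =>
      change contract z (ofCochain ω) (L₀ ++ C.hamSMul p x :: L) =
        C.coeff p (contract z (ofCochain ω) (L₀ ++ x :: L))
      cases n with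
      | zero => simp [contract_ofCochain_zero]
      | succ n => rw [contract_ofCochain]; exact ih (h.interior z)
  · intro x y L
    induction L₀ generalizing n ω with
    | nil =>
      change contract y (contract x (ofCochain ω)) L = - contract x (contract y (ofCochain ω)) L
      match n, ω, h with
      | 0, ω, _ => simp [contract, ofCochain]
      | 1, ω, _ => simp [contract_ofCochain, contract_ofCochain_zero]
      | n + 2, ω, h =>
        rw [contract_ofCochain, contract_ofCochain, contract_ofCochain, contract_ofCochain,
          ← Pi.neg_apply, ← ofCochain_neg]
        congr 2
        funext v
        have := h.map_swap (Fin.cons y (Fin.cons x v)) 0 1 (by simp)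
        have hs : (Fin.cons x (Fin.cons y v) : Fin (n + 2) → C.Ham) =
            Fin.cons y (Fin.cons x v) ∘ Equiv.swap 0 1 := by
          funext k
          refine Fin.cases (by simp) (fun k => ?_) k
          refine Fin.cases (by simp) (fun k => ?_) k
          have h1 : (k.succ.succ : Fin (n + 2)) ≠ 1 := by
            simp [Fin.ext_iff]
          simp [Equiv.swap_apply_of_ne_of_ne (Fin.succ_ne_zero _) h1]
        rw [AssocProduct.interior, AssocProduct.interior, hs, this]
        rfl
    | cons z L₀ ih =>
      change contract z (ofCochain ω) (L₀ ++ x :: y :: L) =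
        - contract z (ofCochain ω) (L₀ ++ y :: x :: L)
      cases n with
      | zero => simp [contract_ofCochain_zero]
      | succ n => rw [contract_ofCochain]; exact ih (h.interior z)

/-- Lists give the sign only for neighbouring arguments, forms require it for every transposition.
Transpositions avoiding position 0 are handled by contracting the first argument, (0 1) is the list
rule, and (0 j) is a conjugate of (1 j) by (0 1). -/
theorem isForm_of_isListForm {n : ℕ} {ω : C.Cochain n} (h : IsListForm (ofCochain ω)) :
    C.IsForm n ω := by
  have hcons : ∀ {n : ℕ} (ω : C.Cochain (n + 1)) (m : Fin (n + 1) → C.Ham),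
      ω m = C.interior (m 0) ω (Fin.tail m) := fun ω m => by
    rw [interior, Fin.cons_self_tail]
  refine ⟨?_, ?_, ?_⟩
  · intro m i x y
    induction n with
    | zero => exact i.elim0
    | succ n ih =>
      refine Fin.cases ?_ (fun i => ?_) i
      · have := congrArg (fun α => α (List.ofFn (Fin.tail m))) (h.contract_add_left x y)
        simp only [Pi.add_apply, contract_ofCochain, ofCochain_ofFn] at this
        rw [hcons ω, hcons ω, hcons ω]
        simpa using this
      · rw [hcons ω, hcons ω, hcons ω]
        have h' := h.contract (m 0)
        rw [contract_ofCochain] at h'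
        simpa [Function.update_of_ne (Fin.succ_ne_zero i).symm] using ih h' (Fin.tail m) i
  · intro m i p x
    induction n with
    | zero => exact i.elim0
    | succ n ih =>
      refine Fin.cases ?_ (fun i => ?_) i
      · have := congrArg (fun α => α (List.ofFn (Fin.tail m))) (h.contract_smul p x)
        simp only [Function.comp_apply, contract_ofCochain, ofCochain_ofFn] at this
        rw [hcons ω, hcons ω]
        simpa using this
      · rw [hcons ω, hcons ω]
        have h' := h.contract (m 0)
        rw [contract_ofCochain] at h'
        simpa [Function.update_of_ne (Fin.succ_ne_zero i).symm] using ih h' (Fin.tail m) i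
  · intro m i j hij
    induction n with
    | zero => exact i.elim0
    | succ n ih =>
      have hsucc : ∀ (m : Fin (n + 1) → C.Ham) (i j : Fin n), i ≠ j →
          ω (m ∘ Equiv.swap i.succ j.succ) = - ω m := by
        intro m i j hij
        have h' := h.contract (m 0)
        rw [contract_ofCochain] at h'
        rw [hcons ω, hcons ω m, ← ih h' (Fin.tail m) i j hij]
        have h0 : (m ∘ Equiv.swap i.succ j.succ) 0 = m 0 := by
          simp [Equiv.swap_apply_of_ne_of_ne (Fin.succ_ne_zero i).symm (Fin.succ_ne_zero j).symm]
        rw [h0]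
        congr 1
        funext k
        simp only [Fin.tail, Function.comp_apply, Equiv.swap_apply_def, Fin.succ_inj]
        split_ifs <;> simp
      have hzero : ∀ (m : Fin (n + 1) → C.Ham) (j : Fin n),
          ω (m ∘ Equiv.swap 0 j.succ) = - ω m := by
        intro m j
        obtain ⟨k, rfl⟩ : ∃ k, n = k + 1 := ⟨n - 1, by have := j.2; omega⟩
        have h01 : ∀ m : Fin (k + 2) → C.Ham, ω (m ∘ Equiv.swap 0 1) = - ω m := by
          intro m
          have := congrArg (fun α => α (List.ofFn (Fin.tail (Fin.tail m))))
            (h.contract_swap (m 1) (m 0))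
          simp only [contract_ofCochain, Pi.neg_apply, ofCochain_ofFn] at this
          have h1 : m = Fin.cons (m 0) (Fin.cons (m 1) (Fin.tail (Fin.tail m))) := by
            funext l
            refine Fin.cases rfl (fun l => ?_) l
            refine Fin.cases rfl (fun l => rfl) l
          have h2 : m ∘ Equiv.swap 0 1 = Fin.cons (m 1) (Fin.cons (m 0) (Fin.tail (Fin.tail m))) := by
            funext l
            refine Fin.cases (by simp) (fun l => ?_) l
            refine Fin.cases (by simp) (fun l => ?_) l
            have h1 : (l.succ.succ : Fin (k + 2)) ≠ 1 := by
              simp [Fin.ext_iff]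
            simp [Equiv.swap_apply_of_ne_of_ne (Fin.succ_ne_zero _) h1, Fin.tail]
          rw [h2]
          conv_rhs => rw [h1]
          exact this
        by_cases hj : j = 0
        · subst hj; exact h01 m
        · have h1 : (1 : Fin (k + 2)) ≠ j.succ := by
            intro h; exact hj (Fin.succ_injective (k + 1) (h.symm.trans Fin.succ_zero_eq_one.symm))
          -- The transposition (0 j+1) equals (0 1)(1 j+1)(0 1), which changes the sign three times.
          have := Equiv.swap_mul_swap_mul_swap (x := j.succ) (y := (1 : Fin (k + 2))) (z := 0)
            h1.symm (Fin.succ_ne_zero j)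
          rw [← this, Equiv.swap_comm j.succ 1, Equiv.swap_comm 1 0]
          simp only [Equiv.Perm.coe_mul, ← Function.comp_assoc]
          rw [h01]
          have h2 := hsucc (m ∘ Equiv.swap 0 1) 0 j (Ne.symm hj)
          rw [show (Fin.succ 0 : Fin (k + 2)) = 1 from rfl] at h2
          rw [h2, h01, neg_neg]
      revert hij
      refine Fin.cases ?_ (fun i => ?_) i
      · refine Fin.cases (by simp) (fun j _ => hzero m j) j
      · refine Fin.cases (fun _ => ?_) (fun j hij => hsucc m i j (by simpa using hij)) j
        rw [Equiv.swap_comm]; exact hzero m i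

theorem IsForm.map_perm {n : ℕ} {ω : C.Cochain n} (h : C.IsForm n ω) (m : Fin n → C.Ham)
    (σ : Equiv.Perm (Fin n)) : ω (m ∘ σ) = ((Equiv.Perm.sign σ : ℤ) : ℂ) • ω m := by
  induction σ using Equiv.Perm.swap_induction_on generalizing m with
  | one => simp
  | swap_mul σ i j hij ih =>
    rw [Equiv.Perm.coe_mul, ← Function.comp_assoc, ih, h.map_swap _ _ _ hij]
    simp [Equiv.Perm.sign_swap hij]

end AssocProduct

namespace AssocProduct

variable {V : Type} [AddCommGroup V] [Module ℂ V] {C : AssocProduct V}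

/-! ### The differential -/

/-- The Lie derivative of a cochain of degree `n`. -/
def lieDeriv {n : ℕ} (θ : C.Ham) (ω : C.Cochain n) : C.Cochain n := fun v =>
  θ.1 (ω v) - ∑ s, ω (Function.update v s (C.hamLie θ (v s)))

theorem ofCochain_lieDeriv {n : ℕ} (θ : C.Ham) (ω : C.Cochain n) :
    ofCochain (lieDeriv θ ω) = listLie θ (ofCochain ω) := by
  funext L
  induction L generalizing n ω with
  | nil =>
    cases n with
    | zero => simp [ofCochain, lieDeriv, listLie]
    | succ n => simp [ofCochain, listLie]
  | cons η L ih =>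
    change contract η (ofCochain (lieDeriv θ ω)) L =
      listLie θ (contract η (ofCochain ω)) L - contract (C.hamLie θ η) (ofCochain ω) L
    cases n with
    | zero =>
      simp only [contract_ofCochain_zero]
      have := listLie_sub θ (0 : C.ListCochain) 0
      rw [sub_self, sub_self] at this
      rw [this]; simp
    | succ n =>
      simp only [contract_ofCochain, ← ih]
      rw [← Pi.sub_apply, ← ofCochain_sub]
      congr 2
      funext v
      simp only [interior, lieDeriv, Fin.sum_univ_succ, Fin.cons_zero, Fin.update_cons_zero,
        Fin.cons_succ, ← Fin.cons_update, Pi.sub_apply]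
      abel

/-- Moving the argument at position s to the front is a cycle of length s + 1, of sign (-1)^s. -/
theorem IsForm.map_update {n : ℕ} {ω : C.Cochain (n + 1)} (h : C.IsForm (n + 1) ω)
    (v : Fin (n + 1) → C.Ham) (s : Fin (n + 1)) (x : C.Ham) :
    ω (Function.update v s x) = (-1 : ℂ) ^ (s : ℕ) • ω (Fin.cons x (fun i => v (s.succAbove i))) := by
  have h1 : Function.update v s x = Fin.cons x (fun i => v (s.succAbove i)) ∘ s.cycleRange := by
    rw [Fin.cons_comp_cycleRange]
    funext j
    refine Fin.succAboveCases s ?_ (fun j => ?_) j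
    · simp
    · simp
  rw [h1, h.map_perm, Fin.sign_cycleRange]
  simp

theorem d_succ {n : ℕ} (ω : C.Cochain (n + 1)) (θ : Fin (n + 2) → C.Ham) :
    C.d ω θ = (∑ k : Fin (n + 2), (-1 : ℂ) ^ (k : ℕ) • (θ k).1 (ω (fun i => θ (k.succAbove i)))) +
      ∑ s : Fin (n + 2), ∑ r : Fin (n + 1),
        if r.castSucc < s then
          (-1 : ℂ) ^ ((r : ℕ) + (s : ℕ)) •
            ω (Fin.cons (C.hamLie (θ r.castSucc) (θ s))
              (fun i : Fin n => θ (s.succAbove (r.succAbove i))))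
        else 0 := rfl

theorem IsForm.map_cons_swap {n : ℕ} {ω : C.Cochain (n + 2)} (h : C.IsForm (n + 2) ω)
    (x y : C.Ham) (v : Fin n → C.Ham) :
    ω (Fin.cons x (Fin.cons y v)) = - ω (Fin.cons y (Fin.cons x v)) := by
  have := congrArg (fun α => α (List.ofFn v)) (h.isListForm.contract_swap x y)
  simp only [contract_ofCochain, Pi.neg_apply, ofCochain_ofFn] at this
  exact this

/-- Cartan's formula. -/
theorem IsForm.interior_d_eq {n : ℕ} {ω : C.Cochain (n + 1)} (h : C.IsForm (n + 1) ω) (θ : C.Ham) :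
    C.interior θ (C.d ω) = lieDeriv θ ω - C.d (C.interior θ ω) := by
  funext v
  -- These are the bracket terms of dω that involve θ. Moving [θ, v s] back to its slot turns them
  -- into the terms subtracted in `lieDeriv`.
  have hsum : ∀ s : Fin (n + 1), (-1 : ℂ) ^ (0 + (s.succ : ℕ)) •
      ω (Fin.cons (C.hamLie θ (v s)) (fun i : Fin n => v (s.succAbove i))) =
      - ω (Function.update v s (C.hamLie θ (v s))) := by
    intro s
    rw [h.map_update, Fin.val_succ, zero_add, pow_succ]
    simp
  have hfirst : ∀ k : Fin (n + 1),
      (fun i => (Fin.cons θ v : Fin (n + 2) → C.Ham) (k.succ.succAbove i)) =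
        Fin.cons θ (fun i => v (k.succAbove i)) := by
    intro k
    funext i
    refine Fin.cases ?_ (fun i => ?_) i <;> simp
  rw [AssocProduct.interior, d_succ, Fin.sum_univ_succ, Fin.sum_univ_succ (n := n + 1)]
  simp only [Fin.not_lt_zero, if_false, Finset.sum_const_zero, zero_add, Fin.cons_zero,
    Fin.cons_succ, Fin.zero_succAbove, Fin.val_zero, pow_zero, one_smul, hfirst]
  rw [Pi.sub_apply, lieDeriv]
  -- For a 1-form the contraction has degree zero, where `d` is given by a separate clause.
  cases n with
  | zero =>
    have hs := hsum 0
    simp only [Fin.val_succ, Fin.val_zero, zero_add, pow_one] at hs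
    simp only [Fin.sum_univ_succ, Fin.sum_univ_zero, Fin.castSucc_zero, Fin.succ_pos, if_true,
      Fin.cons_zero, Fin.val_zero, add_zero, Fin.val_succ, zero_add, pow_one]
    have hx : (fun i : Fin 0 => (Fin.cons θ v : Fin 2 → C.Ham)
        ((Fin.succ 0).succAbove ((0 : Fin 1).succAbove i))) =
        fun i : Fin 0 => v ((0 : Fin 1).succAbove i) := funext fun i => i.elim0
    rw [hx, hs]
    have hy : C.d (C.interior θ ω) v = (v 0).1 (ω (Fin.cons θ (fun i => v ((0 : Fin 1).succAbove i)))) := by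
      change (v 0).1 (ω (Fin.cons θ Fin.elim0)) = _
      congr 3
      funext i; exact i.elim0
    rw [hy]
    simp only [neg_smul, one_smul]
    abel
  | succ n =>
    -- The term r = 0 is the bracket with θ. In the others θ stands behind a bracket; exchanging the
    -- two gives the sign in front of d i_θ.
    have hsecond : ∀ s : Fin (n + 2),
        (∑ r : Fin (n + 2), if r.castSucc < s.succ then
          (-1 : ℂ) ^ ((r : ℕ) + (s.succ : ℕ)) •
            ω (Fin.cons (C.hamLie ((Fin.cons θ v : Fin (n + 3) → C.Ham) r.castSucc) (v s))
              (fun i : Fin (n + 1) => (Fin.cons θ v : Fin (n + 3) → C.Ham)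
                (s.succ.succAbove (r.succAbove i))))
        else 0) = - ω (Function.update v s (C.hamLie θ (v s))) -
          ∑ r : Fin (n + 1), if r.castSucc < s then
            (-1 : ℂ) ^ ((r : ℕ) + (s : ℕ)) •
              ω (Fin.cons θ (Fin.cons (C.hamLie (v r.castSucc) (v s))
                (fun i : Fin n => v (s.succAbove (r.succAbove i)))))
          else 0 := by
      intro s
      rw [Fin.sum_univ_succ, ← hsum s, sub_eq_add_neg, ← Finset.sum_neg_distrib]
      congr 1
      · simp
      · refine Finset.sum_congr rfl fun r _ => ?_
        simp only [Fin.castSucc_succ, Fin.succ_lt_succ_iff, Fin.cons_succ]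
        split_ifs with hr
        · have hv : (fun i : Fin (n + 1) => (Fin.cons θ v : Fin (n + 3) → C.Ham)
              (s.succ.succAbove (r.succ.succAbove i))) =
              Fin.cons θ (fun i : Fin n => v (s.succAbove (r.succAbove i))) := by
            funext i
            refine Fin.cases ?_ (fun i => ?_) i <;> simp
          rw [hv, h.map_cons_swap, smul_neg, Fin.val_succ, Fin.val_succ]
          congr 2
          ring
        · simp
    rw [Finset.sum_congr rfl fun s _ => hsecond s, Finset.sum_sub_distrib, Finset.sum_neg_distrib,
      d_succ]
    have hk : ∀ k : Fin (n + 2), (-1 : ℂ) ^ (k.succ : ℕ) •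
        (v k).1 (ω (Fin.cons θ fun i => v (k.succAbove i))) =
        - ((-1 : ℂ) ^ (k : ℕ) • (v k).1 (C.interior θ ω fun i => v (k.succAbove i))) := by
      intro k
      simp [AssocProduct.interior, pow_succ]
    rw [Finset.sum_congr rfl fun k _ => hk k, Finset.sum_neg_distrib]
    simp only [AssocProduct.interior]
    abel

theorem IsForm.ofCochain_d {n : ℕ} {ω : C.Cochain n} (h : C.IsForm n ω) :
    ofCochain (C.d ω) = listD (ofCochain ω) := by
  funext L
  induction L generalizing n ω with
  | nil => simp [ofCochain, listD]
  | cons θ L ih =>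
    change contract θ (ofCochain (C.d ω)) L =
      listLie θ (ofCochain ω) L - listD (contract θ (ofCochain ω)) L
    rw [contract_ofCochain]
    cases n with
    | zero =>
      rw [contract_ofCochain_zero, listD_zero, ← ofCochain_lieDeriv]
      simp only [Pi.zero_apply, sub_zero]
      congr 2
      funext v
      simp only [lieDeriv, Finset.univ_eq_empty, Finset.sum_empty, sub_zero]
      change θ.1 (ω _) = θ.1 (ω _)
      congr 2
      funext i; exact i.elim0
    | succ n =>
      rw [h.interior_d_eq, ofCochain_sub, ofCochain_lieDeriv, Pi.sub_apply, ih (h.interior θ),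
        contract_ofCochain]

/-! ### The product of forms -/

/-- With the total degree as a free variable N, the permutations can be split in the form Fin (N +
1), which m + 1 + n does not have syntactically. -/
theorem castDeg_wedge_apply {m n N : ℕ} (h : m + n = N) (α : C.Cochain m) (β : C.Cochain n)
    (θ : Fin N → C.Ham) :
    C.castDeg h (C.wedge α β) θ = ((m.factorial * n.factorial : ℕ) : ℂ)⁻¹ •
      ∑ σ : Equiv.Perm (Fin N), ((Equiv.Perm.sign σ : ℤ) : ℂ) •
        C.mul (α (fun i => θ (σ ((Fin.castAdd n i).cast h))))
          (β (fun j => θ (σ ((Fin.natAdd m j).cast h)))) := by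
  subst h; rfl

/-- A sum over permutations, decomposed according to the preimage of `0`. -/
theorem sum_perm_succ {M : Type*} [AddCommMonoid M] {N : ℕ} (F : Equiv.Perm (Fin (N + 1)) → M) :
    ∑ σ, F σ = ∑ p : Fin (N + 1), ∑ τ : Equiv.Perm (Fin N),
      F (Equiv.Perm.decomposeFin.symm (0, τ) * p.cycleRange) := by
  rw [← Fintype.sum_prod_type' (fun (p : Fin (N + 1)) (τ : Equiv.Perm (Fin N)) =>
      F (Equiv.Perm.decomposeFin.symm (0, τ) * p.cycleRange))]
  -- The index p is recovered as the preimage of 0 and τ by cancellation; surjectivity is the count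
  -- (N + 1)! = (N + 1) · N!.
  have hbij : Function.Bijective (fun x : Fin (N + 1) × Equiv.Perm (Fin N) =>
      Equiv.Perm.decomposeFin.symm (0, x.2) * x.1.cycleRange) := by
    rw [Fintype.bijective_iff_injective_and_card]
    constructor
    · rintro ⟨p, τ⟩ ⟨q, ρ⟩ h
      have hp : ∀ (p : Fin (N + 1)) (τ : Equiv.Perm (Fin N)),
          (Equiv.Perm.decomposeFin.symm (0, τ) * p.cycleRange)⁻¹ 0 = p := by
        intro p τ
        rw [Equiv.Perm.inv_eq_iff_eq]
        simp
      have hpq : p = q := by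
        rw [← hp p τ, ← hp q ρ]
        exact congrArg (fun σ : Equiv.Perm (Fin (N + 1)) => σ⁻¹ 0) h
      subst hpq
      have := mul_right_cancel (a := Equiv.Perm.decomposeFin.symm (0, τ)) h
      simpa using this
    · simp [Fintype.card_perm, Nat.factorial_succ]
  exact (Function.Bijective.sum_comp hbij F).symm

theorem sign_decomposeFin_mul_cycleRange {N : ℕ} (τ : Equiv.Perm (Fin N)) (p : Fin (N + 1)) :
    ((Equiv.Perm.sign (Equiv.Perm.decomposeFin.symm (0, τ) * p.cycleRange) : ℤ) : ℂ) =
      (-1 : ℂ) ^ (p : ℕ) * ((Equiv.Perm.sign τ : ℤ) : ℂ) := by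
  rw [Equiv.Perm.sign_mul, Equiv.Perm.decomposeFin.symm_sign, Fin.sign_cycleRange]
  simp [mul_comm]

theorem cons_decomposeFin {N : ℕ} {X : Type*} (θ : X) (v : Fin N → X) (τ : Equiv.Perm (Fin N)) :
    (fun i => (Fin.cons θ v : Fin (N + 1) → X) (Equiv.Perm.decomposeFin.symm (0, τ) i)) =
      Fin.cons θ (fun i => v (τ i)) := by
  funext i
  refine Fin.cases ?_ (fun i => ?_) i <;> simp

-- The permutation sum of a product, sorted by the slot that receives the contracted argument.

section Shuffle

variable {m n N : ℕ} (θ : C.Ham) (v : Fin N → C.Ham)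

/-- Here θ lands in slot i of α. The sign (-1)^i of the cycle cancels the sign of moving θ to the
front of α, so the sum does not depend on i. -/
theorem sum_wedge_left {α : C.Cochain (m + 1)} (hα : C.IsForm (m + 1) α) (β : C.Cochain n)
    (h : m + 1 + n = N + 1) (i : Fin (m + 1)) :
    ∑ τ : Equiv.Perm (Fin N),
      ((Equiv.Perm.sign (Equiv.Perm.decomposeFin.symm (0, τ) *
        Fin.cycleRange ((Fin.castAdd n i).cast h)) : ℤ) : ℂ) •
        C.mul (α (fun k => (Fin.cons θ v : Fin (N + 1) → C.Ham)
            ((Equiv.Perm.decomposeFin.symm (0, τ) * Fin.cycleRange ((Fin.castAdd n i).cast h))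
              ((Fin.castAdd n k).cast h))))
          (β (fun j => (Fin.cons θ v : Fin (N + 1) → C.Ham)
            ((Equiv.Perm.decomposeFin.symm (0, τ) * Fin.cycleRange ((Fin.castAdd n i).cast h))
              ((Fin.natAdd (m + 1) j).cast h)))) =
    ((m.factorial * n.factorial : ℕ) : ℂ) •
      C.castDeg (show m + n = N by omega) (C.wedge (C.interior θ α) β) v := by
  rw [castDeg_wedge_apply, smul_smul, mul_inv_cancel₀ (Nat.cast_ne_zero.mpr
    (Nat.mul_ne_zero (Nat.factorial_ne_zero _) (Nat.factorial_ne_zero _))), one_smul]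
  refine Finset.sum_congr rfl fun τ _ => ?_
  rw [sign_decomposeFin_mul_cycleRange]
  have h1 : ∀ k : Fin (m + 1), Fin.cycleRange ((Fin.castAdd n i).cast h) ((Fin.castAdd n k).cast h) =
      (Fin.castAdd n (i.cycleRange k)).cast h := by
    intro k
    rcases lt_trichotomy k i with hk | hk | hk
    · ext
      rw [Fin.coe_cycleRange_of_lt (by
        simp only [Fin.lt_def, Fin.val_cast, Fin.val_castAdd] at hk ⊢; omega)]
      simp [Fin.coe_cycleRange_of_lt hk]
    · subst hk
      rw [Fin.cycleRange_self, Fin.cycleRange_self]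
      ext; simp
    · rw [Fin.cycleRange_of_gt (by
        simp only [Fin.lt_def, Fin.val_cast, Fin.val_castAdd] at hk ⊢; omega), Fin.cycleRange_of_gt hk]
  have h2 : ∀ j : Fin n, Fin.cycleRange ((Fin.castAdd n i).cast h) ((Fin.natAdd (m + 1) j).cast h) =
      (Fin.natAdd (m + 1) j).cast h := by
    intro j
    refine Fin.cycleRange_of_gt ?_
    simp only [Fin.lt_def, Fin.val_cast, Fin.val_castAdd, Fin.val_natAdd]
    omega
  simp only [Equiv.Perm.mul_apply, h1, h2]
  have h3 := hα.map_perm (fun k => (Fin.cons θ v : Fin (N + 1) → C.Ham)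
    (Equiv.Perm.decomposeFin.symm (0, τ) ((Fin.castAdd n k).cast h))) i.cycleRange
  rw [Fin.sign_cycleRange] at h3
  simp only [Function.comp_def] at h3
  rw [h3]
  have h4 : (fun k => (Fin.cons θ v : Fin (N + 1) → C.Ham)
      (Equiv.Perm.decomposeFin.symm (0, τ) ((Fin.castAdd n k).cast h))) =
      Fin.cons θ (fun k => v (τ ((Fin.castAdd n k).cast (by omega)))) := by
    funext k
    rw [congrFun (cons_decomposeFin θ v τ)]
    refine Fin.cases ?_ (fun k => ?_) k
    · rfl
    · rw [show (Fin.castAdd n k.succ).cast h = ((Fin.castAdd n k).cast (by omega)).succ from rfl]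
      simp
  have h5 : (fun j => (Fin.cons θ v : Fin (N + 1) → C.Ham)
      (Equiv.Perm.decomposeFin.symm (0, τ) ((Fin.natAdd (m + 1) j).cast h))) =
      fun j => v (τ ((Fin.natAdd m j).cast (by omega))) := by
    funext j
    rw [congrFun (cons_decomposeFin θ v τ)]
    rw [show (Fin.natAdd (m + 1) j).cast h = ((Fin.natAdd m j).cast (by omega)).succ from by
      ext; simp; omega]
    simp
  rw [h4, h5]
  simp only [Units.val_pow_eq_pow_val, Units.val_neg, Units.val_one, Int.cast_pow, Int.cast_neg,
    Int.cast_one, map_smul, LinearMap.smul_apply, smul_smul, Fin.val_cast, Fin.val_castAdd]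
  rw [mul_right_comm, ← mul_pow, neg_mul_neg, one_mul, one_pow, one_mul]
  rfl

/-- Here θ lands in slot j of β, that is, at position m + j. The antisymmetry of β accounts for
(-1)^j, and the sign (-1)^m of passing α is left. -/
theorem sum_wedge_right (α : C.Cochain m) {β : C.Cochain (n + 1)} (hβ : C.IsForm (n + 1) β)
    (h : m + (n + 1) = N + 1) (j : Fin (n + 1)) :
    ∑ τ : Equiv.Perm (Fin N),
      ((Equiv.Perm.sign (Equiv.Perm.decomposeFin.symm (0, τ) *
        Fin.cycleRange ((Fin.natAdd m j).cast h)) : ℤ) : ℂ) •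
        C.mul (α (fun k => (Fin.cons θ v : Fin (N + 1) → C.Ham)
            ((Equiv.Perm.decomposeFin.symm (0, τ) * Fin.cycleRange ((Fin.natAdd m j).cast h))
              ((Fin.castAdd (n + 1) k).cast h))))
          (β (fun k => (Fin.cons θ v : Fin (N + 1) → C.Ham)
            ((Equiv.Perm.decomposeFin.symm (0, τ) * Fin.cycleRange ((Fin.natAdd m j).cast h))
              ((Fin.natAdd m k).cast h)))) =
    ((m.factorial * n.factorial : ℕ) : ℂ) • (-1 : ℂ) ^ m •
      C.castDeg (show m + n = N by omega) (C.wedge α (C.interior θ β)) v := by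
  rw [castDeg_wedge_apply, smul_comm, smul_smul (_ : ℂ) (_ : ℂ) (∑ _, _),
    mul_inv_cancel₀ (Nat.cast_ne_zero.mpr
    (Nat.mul_ne_zero (Nat.factorial_ne_zero _) (Nat.factorial_ne_zero _))), one_smul, Finset.smul_sum]
  refine Finset.sum_congr rfl fun τ _ => ?_
  rw [sign_decomposeFin_mul_cycleRange]
  have h1 : ∀ k : Fin m, Fin.cycleRange ((Fin.natAdd m j).cast h) ((Fin.castAdd (n + 1) k).cast h) =
      ((Fin.castAdd n k).cast (show m + n = N by omega)).succ := by
    intro k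
    ext
    rw [Fin.coe_cycleRange_of_lt (by
      simp only [Fin.lt_def, Fin.val_cast, Fin.val_castAdd, Fin.val_natAdd]; omega)]
    simp
  have h2 : ∀ k : Fin (n + 1), (Fin.cons θ v : Fin (N + 1) → C.Ham)
        (Equiv.Perm.decomposeFin.symm (0, τ)
          (Fin.cycleRange ((Fin.natAdd m j).cast h) ((Fin.natAdd m k).cast h))) =
      (Fin.cons θ (fun k => v (τ ((Fin.natAdd m k).cast (by omega)))) : Fin (n + 1) → C.Ham)
        (j.cycleRange k) := by
    intro k
    rw [congrFun (cons_decomposeFin θ v τ)]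
    rcases lt_trichotomy k j with hk | hk | hk
    · have e1 : Fin.cycleRange ((Fin.natAdd m j).cast h) ((Fin.natAdd m k).cast h) =
          ((Fin.natAdd m (k.castLT (by omega) : Fin n)).cast (show m + n = N by omega)).succ := by
        ext
        rw [Fin.coe_cycleRange_of_lt (by
        simp only [Fin.lt_def, Fin.val_cast, Fin.val_natAdd] at hk ⊢; omega)]
        simp
      have e2 : j.cycleRange k = (k.castLT (by omega) : Fin n).succ := by
        ext
        rw [Fin.coe_cycleRange_of_lt hk]
        simp
      rw [e1, e2, Fin.cons_succ, Fin.cons_succ]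
    · subst hk
      rw [Fin.cycleRange_self, Fin.cycleRange_self, Fin.cons_zero, Fin.cons_zero]
    · rw [Fin.cycleRange_of_gt (by
        simp only [Fin.lt_def, Fin.val_cast, Fin.val_natAdd] at hk ⊢; omega), Fin.cycleRange_of_gt hk]
      obtain ⟨l, rfl⟩ := Fin.exists_succ_eq_of_ne_zero (x := k)
        (by rintro rfl; exact absurd hk (Fin.not_lt_zero _))
      rw [show (Fin.natAdd m l.succ).cast h = ((Fin.natAdd m l).cast (show m + n = N by omega)).succ
        from rfl, Fin.cons_succ, Fin.cons_succ]
  have h3 := hβ.map_perm (Fin.cons θ (fun k => v (τ ((Fin.natAdd m k).cast (by omega)))))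
    j.cycleRange
  rw [Fin.sign_cycleRange] at h3
  simp only [Function.comp_def] at h3
  simp only [Equiv.Perm.mul_apply, h1, h2, h3, Equiv.Perm.decomposeFin_symm_apply_succ,
    Equiv.swap_self, Equiv.refl_apply, Fin.cons_succ]
  simp only [Units.val_pow_eq_pow_val, Units.val_neg, Units.val_one, Int.cast_pow, Int.cast_neg,
    Int.cast_one, map_smul, smul_smul, Fin.val_cast, Fin.val_natAdd]
  rw [mul_right_comm, pow_add, mul_assoc ((-1 : ℂ) ^ m), ← mul_pow, neg_mul_neg, one_mul, one_pow,
    mul_one]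
  rfl

end Shuffle

end AssocProduct

namespace AssocProduct

variable {V : Type} [AddCommGroup V] [Module ℂ V] {C : AssocProduct V}

theorem sum_fin_eq_add {M : Type*} [AddCommMonoid M] {m n N : ℕ} (h : m + n = N)
    (G : Fin N → M) :
    ∑ p, G p = ∑ i : Fin m, G ((Fin.castAdd n i).cast h) + ∑ j : Fin n, G ((Fin.natAdd m j).cast h) := by
  subst h
  exact Fin.sum_univ_add G

/-- There are m + 1 equal sums from α and n + 1 from β; these multiplicities absorb the change of
the normalizing factorials. -/
theorem interior_castDeg_wedge_succ_succ {m n N : ℕ} (θ : C.Ham) {α : C.Cochain (m + 1)}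
    {β : C.Cochain (n + 1)} (hα : C.IsForm (m + 1) α) (hβ : C.IsForm (n + 1) β)
    (h : m + 1 + (n + 1) = N + 1) :
    C.interior θ (C.castDeg h (C.wedge α β)) =
      C.castDeg (show m + (n + 1) = N by omega) (C.wedge (C.interior θ α) β) +
        (-1 : ℂ) ^ (m + 1) •
          C.castDeg (show m + 1 + n = N by omega) (C.wedge α (C.interior θ β)) := by
  funext v
  rw [interior, castDeg_wedge_apply, sum_perm_succ, sum_fin_eq_add h,
    Finset.sum_congr rfl fun i _ => sum_wedge_left θ v hα β h i,
    Finset.sum_congr rfl fun j _ => sum_wedge_right θ v α hβ h j]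
  simp only [Finset.sum_const, Finset.card_univ, Fintype.card_fin, ← Nat.cast_smul_eq_nsmul ℂ,
    smul_add, smul_smul, Pi.add_apply, Pi.smul_apply]
  have hm : ((m.factorial : ℕ) : ℂ) ≠ 0 := Nat.cast_ne_zero.mpr (Nat.factorial_ne_zero _)
  have hn : ((n.factorial : ℕ) : ℂ) ≠ 0 := Nat.cast_ne_zero.mpr (Nat.factorial_ne_zero _)
  have hm' : ((m : ℂ) + 1) ≠ 0 := Nat.cast_add_one_ne_zero m
  have hn' : ((n : ℂ) + 1) ≠ 0 := Nat.cast_add_one_ne_zero n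
  congr 1
  · convert one_smul ℂ _ using 2
    push_cast [Nat.factorial_succ]
    field_simp
  · congr 1
    push_cast [Nat.factorial_succ]
    field_simp

theorem interior_castDeg_wedge_succ_zero {m N : ℕ} (θ : C.Ham) {α : C.Cochain (m + 1)}
    (β : C.Cochain 0) (hα : C.IsForm (m + 1) α) (h : m + 1 + 0 = N + 1) :
    C.interior θ (C.castDeg h (C.wedge α β)) =
      C.castDeg (show m + 0 = N by omega) (C.wedge (C.interior θ α) β) := by
  funext v
  rw [interior, castDeg_wedge_apply, sum_perm_succ, sum_fin_eq_add h,
    Finset.sum_congr rfl fun i _ => sum_wedge_left θ v hα β h i]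
  simp only [Finset.sum_const, Finset.card_univ, Fintype.card_fin, ← Nat.cast_smul_eq_nsmul ℂ,
    Finset.univ_eq_empty, Finset.sum_empty, add_zero, smul_smul]
  have hm : ((m.factorial : ℕ) : ℂ) ≠ 0 := Nat.cast_ne_zero.mpr (Nat.factorial_ne_zero _)
  have hm' : ((m : ℂ) + 1) ≠ 0 := Nat.cast_add_one_ne_zero m
  convert one_smul ℂ _ using 2
  push_cast [Nat.factorial_succ]
  field_simp

theorem interior_castDeg_wedge_zero_succ {n N : ℕ} (θ : C.Ham) (α : C.Cochain 0)
    {β : C.Cochain (n + 1)} (hβ : C.IsForm (n + 1) β) (h : 0 + (n + 1) = N + 1) :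
    C.interior θ (C.castDeg h (C.wedge α β)) =
      C.castDeg (show 0 + n = N by omega) (C.wedge α (C.interior θ β)) := by
  funext v
  rw [interior, castDeg_wedge_apply, sum_perm_succ, sum_fin_eq_add h,
    Finset.sum_congr rfl fun j _ => sum_wedge_right θ v α hβ h j]
  simp only [Finset.sum_const, Finset.card_univ, Fintype.card_fin, ← Nat.cast_smul_eq_nsmul ℂ,
    Finset.univ_eq_empty, Finset.sum_empty, zero_add, smul_smul, pow_zero, mul_one]
  have hn : ((n.factorial : ℕ) : ℂ) ≠ 0 := Nat.cast_ne_zero.mpr (Nat.factorial_ne_zero _)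
  have hn' : ((n : ℂ) + 1) ≠ 0 := Nat.cast_add_one_ne_zero n
  convert one_smul ℂ _ using 2
  push_cast [Nat.factorial_succ]
  field_simp

theorem wedge_zero_zero (α β : C.Cochain 0) :
    C.wedge α β = fun _ => C.mul (α Fin.elim0) (β Fin.elim0) := by
  funext θ
  have : ∀ f : Fin 0 → C.Ham, f = Fin.elim0 := fun f => funext fun i => i.elim0
  simp only [wedge]
  have hsub : Subsingleton (Equiv.Perm (Fin (0 + 0))) :=
    inferInstanceAs (Subsingleton (Equiv.Perm (Fin 0)))
  rw [Fintype.sum_eq_single (1 : Equiv.Perm (Fin (0 + 0)))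
    (fun σ hσ => absurd (Subsingleton.elim σ 1) hσ)]
  simp only [Nat.factorial_zero, this]
  simp

theorem listWedge_smul_left (c : ℂ) (α β : C.ListCochain) :
    listWedge (c • α) β = c • listWedge α β :=
  listWedge_comp_left (g := c • (LinearMap.id : V →ₗ[ℂ] V)) (fun a b => by simp) α β

/-- The permutation formula obeys the recursion defining `listWedge`. The cases reflect that
contraction annihilates degree zero. -/
theorem ofCochain_wedge {m n : ℕ} {α : C.Cochain m} {β : C.Cochain n} (hα : C.IsForm m α)
    (hβ : C.IsForm n β) :
    ofCochain (C.wedge α β) = listWedge (ofCochain α) (ofCochain β) := by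
  funext L
  induction L generalizing m n α β with
  | nil =>
    simp only [listWedge]
    match m, n, α, β with
    | 0, 0, α, β =>
      rw [wedge_zero_zero]
      have : (fun i : Fin 0 => ([] : List C.Ham).get (i.cast rfl)) = Fin.elim0 :=
        funext fun i => i.elim0
      simp only [ofCochain, List.length_nil, dif_pos, this]
    | m + 1, n, α, β =>
      rw [ofCochain_of_length_ne (C.wedge α β) (L := []) (by rw [List.length_nil]; omega),
        ofCochain_of_length_ne α (L := []) (by simp)]
      simp
    | 0, n + 1, α, β =>
      rw [ofCochain_of_length_ne (C.wedge α β) (L := []) (by rw [List.length_nil]; omega),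
        ofCochain_of_length_ne β (L := []) (by simp)]
      simp
  | cons θ L ih =>
    change contract θ (ofCochain (C.wedge α β)) L = listWedge (contract θ (ofCochain α))
      (ofCochain β) L + listWedge (parity (ofCochain α)) (contract θ (ofCochain β)) L
    have hpar : ∀ {m n : ℕ} (α : C.Cochain m) (β : C.Cochain n),
        listWedge (parity (ofCochain α)) (ofCochain β) =
        (-1 : ℂ) ^ m • listWedge (ofCochain α) (ofCochain β) := by
      intro m n α β
      rw [parity_ofCochain, listWedge_smul_left]
    match m, n, α, β, hα, hβ with
    | 0, 0, α, β, hα, hβ =>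
      rw [contract_ofCochain_zero θ α, contract_ofCochain_zero θ β, listWedge_zero_left,
        listWedge_zero_right]
      exact (congrFun (contract_ofCochain_zero θ (C.wedge α β)) L).trans (by simp)
    | m + 1, 0, α, β, hα, hβ =>
      rw [contract_ofCochain_zero θ β, listWedge_zero_right, contract_ofCochain θ α,
        ← ih (hα.interior θ) hβ]
      have h := interior_castDeg_wedge_succ_zero (N := m) θ β hα rfl
      have h2 := contract_ofCochain θ (C.castDeg (show m + 1 + 0 = m + 1 from rfl) (C.wedge α β))
      rw [h, ofCochain_castDeg, ofCochain_castDeg] at h2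
      rw [h2]; simp
    | 0, n + 1, α, β, hα, hβ =>
      rw [contract_ofCochain_zero θ α, listWedge_zero_left, contract_ofCochain θ β, hpar,
        Pi.smul_apply,
        ← ih hα (hβ.interior θ)]
      have h := interior_castDeg_wedge_zero_succ (N := n) θ α hβ (by omega)
      have h2 := contract_ofCochain θ (C.castDeg (show 0 + (n + 1) = n + 1 by omega) (C.wedge α β))
      rw [h, ofCochain_castDeg, ofCochain_castDeg] at h2
      rw [h2]; simp
    | m + 1, n + 1, α, β, hα, hβ =>
      rw [contract_ofCochain θ α, contract_ofCochain θ β, hpar, Pi.smul_apply, ← ih hα (hβ.interior θ),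
        ← ih (hα.interior θ) hβ]
      have h := interior_castDeg_wedge_succ_succ (N := m + n + 1) θ hα hβ (by omega)
      have h2 := contract_ofCochain θ
        (C.castDeg (show m + 1 + (n + 1) = m + n + 1 + 1 by omega) (C.wedge α β))
      rw [h, ofCochain_castDeg, ofCochain_add, ofCochain_smul, ofCochain_castDeg,
        ofCochain_castDeg] at h2
      rw [h2]; rfl

/-! ### The differential graded algebra of forms -/

theorem isForm_zero (C : AssocProduct V) (ω : C.Cochain 0) : C.IsForm 0 ω where
  map_add _ i := i.elim0
  map_coeff _ i := i.elim0
  map_swap _ i := i.elim0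

theorem IsForm.wedge {m n : ℕ} {α : C.Cochain m} {β : C.Cochain n} (hα : C.IsForm m α)
    (hβ : C.IsForm n β) : C.IsForm (m + n) (C.wedge α β) := by
  apply isForm_of_isListForm
  rw [ofCochain_wedge hα hβ]
  exact hα.isListForm.listWedge hβ.isListForm

theorem IsForm.d {n : ℕ} {α : C.Cochain n} (hα : C.IsForm n α) : C.IsForm (n + 1) (C.d α) := by
  apply isForm_of_isListForm
  rw [hα.ofCochain_d]
  exact hα.isListForm.listD

theorem listWedge_unit_left {e : V} (he : IsUnitOf C.mul e) (α : C.ListCochain) :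
    listWedge (ofCochain (C.zeroForm e)) α = α := by
  funext L
  induction L generalizing α with
  | nil => simpa [listWedge, ofCochain, zeroForm] using (he _).1
  | cons θ L ih =>
    simp only [listWedge, contract_ofCochain_zero, listWedge_zero_left, Pi.zero_apply, zero_add,
      parity_ofCochain, pow_zero, one_smul, ih]
    rfl

theorem listWedge_unit_right {e : V} (he : IsUnitOf C.mul e) (α : C.ListCochain) :
    listWedge α (ofCochain (C.zeroForm e)) = α := by
  funext L
  induction L generalizing α with
  | nil => simpa [listWedge, ofCochain, zeroForm] using (he _).2
  | cons θ L ih =>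
    simp only [listWedge, contract_ofCochain_zero, listWedge_zero_right, Pi.zero_apply, add_zero,
      ih]
    rfl

theorem isDGA (C : AssocProduct V) : C.IsDGA where
  wedge_form hα hβ := hα.wedge hβ
  wedge_zero a b := wedge_zero_zero _ _
  wedge_assoc hα hβ hγ := by
    apply ofCochain_injective
    rw [ofCochain_castDeg, ofCochain_wedge (hα.wedge hβ) hγ, ofCochain_wedge hα (hβ.wedge hγ),
      ofCochain_wedge hα hβ, ofCochain_wedge hβ hγ, listWedge_assoc]
  unit_wedge e he n α hα := by
    constructor <;> apply ofCochain_injective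
    · exact (ofCochain_castDeg _ _).trans
        ((ofCochain_wedge (C.isForm_zero _) hα).trans (listWedge_unit_left he _))
    · exact (ofCochain_wedge hα (C.isForm_zero _)).trans (listWedge_unit_right he _)
  d_form hα := hα.d
  d_d hα := by
    apply ofCochain_injective
    rw [hα.d.ofCochain_d, hα.ofCochain_d, hα.isListForm.listD_listD, ofCochain_zero]
  d_wedge {m n α β} hα hβ := by
    apply ofCochain_injective
    rw [(hα.wedge hβ).ofCochain_d, ofCochain_wedge hα hβ, listD_listWedge, ofCochain_add,
      ofCochain_castDeg, ofCochain_wedge hα.d hβ, hα.ofCochain_d, ofCochain_smul]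
    congr 1
    rw [parity_ofCochain, listWedge_smul_left, ← hβ.ofCochain_d, ← ofCochain_wedge hα hβ.d]

theorem interiorIsDerivation (C : AssocProduct V) : C.InteriorIsDerivation where
  interior_form θ _ hα := hα.interior θ
  interior_d _ _ := rfl
  interior_wedge θ _ _ hα hβ := interior_castDeg_wedge_succ_succ θ hα hβ (by omega)
  interior_wedge_zero_left θ a _ hβ :=
    interior_castDeg_wedge_zero_succ θ (C.zeroForm a) hβ (by omega)
  interior_wedge_zero_right θ _ a hα :=
    interior_castDeg_wedge_succ_zero θ (C.zeroForm a) hα (by omega)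

/-! ### The symplectic form -/

/-- A Hamiltonian of an element of `Ham`. -/
noncomputable def hamiltonian (θ : C.Ham) : V := (C.exists_eq_ham θ.2).choose

theorem hamElt_hamiltonian (θ : C.Ham) : C.hamElt (hamiltonian θ) = θ :=
  Subtype.ext (C.exists_eq_ham θ.2).choose_spec.symm

theorem hamElt_apply (f a : V) : (C.hamElt f).1 a = C.bracket f a := rfl

/-- The value of an element of `Ham` at a Hamiltonian `g` depends only on `ham g`. -/
theorem ham_apply_congr (θ : C.Ham) {g g' : V} (h : C.hamElt g = C.hamElt g') :
    θ.1 g = θ.1 g' := by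
  -- With θ = ham f, the value θ(g) = [f, g] = -ham(g)(f) involves only ham g.
  rw [← hamElt_hamiltonian θ, hamElt_apply, hamElt_apply, C.bracket_antisymm, ← hamElt_apply, h,
    hamElt_apply, ← C.bracket_antisymm]

/-- The canonical form `ω(θ, ham g) = θ g`. -/
noncomputable def canonicalForm (C : AssocProduct V) : C.Cochain 2 := fun m =>
  (m 0).1 (hamiltonian (m 1))

theorem canonicalForm_apply (θ : C.Ham) (g : V) :
    C.canonicalForm ![θ, C.hamElt g] = θ.1 g :=
  ham_apply_congr θ (hamElt_hamiltonian _)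

theorem canonicalForm_apply' (m : Fin 2 → C.Ham) (g : V) (hg : C.hamElt g = m 1) :
    C.canonicalForm m = (m 0).1 g :=
  ham_apply_congr (m 0) ((hamElt_hamiltonian _).trans hg.symm)

theorem hamSMul_hamElt (p : ℂ × C.center) (f : V) :
    C.hamSMul p (C.hamElt f) = C.hamElt (C.coeff p f) :=
  Subtype.ext (C.coeff_comp_ham p f)

theorem hamElt_add (f g : V) : C.hamElt (f + g) = C.hamElt f + C.hamElt g :=
  C.ham_ext fun a => by simp [hamElt, ham]; abel

theorem hamElt_zero : C.hamElt 0 = 0 :=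
  C.ham_ext fun a => by simp [hamElt, ham]

theorem hamElt_sum {n : ℕ} (f : Fin n → V) : C.hamElt (∑ i, f i) = ∑ i, C.hamElt (f i) := by
  let φ : V →+ C.Ham := ⟨⟨C.hamElt, hamElt_zero⟩, hamElt_add⟩
  exact map_sum φ f Finset.univ

theorem isCanonicalForm_canonicalForm (C : AssocProduct V) : C.IsCanonicalForm C.canonicalForm := by
  intro m n u f v h
  have h1 : ∑ j, C.hamSMul (v j) (C.hamElt (h j)) = C.hamElt (∑ j, C.coeff (v j) (h j)) := by
    rw [hamElt_sum]
    exact Finset.sum_congr rfl fun j _ => hamSMul_hamElt _ _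
  rw [h1, canonicalForm_apply, Submodule.coe_sum, LinearMap.sum_apply]
  refine Finset.sum_congr rfl fun i _ => ?_
  rw [map_sum]
  refine Finset.sum_congr rfl fun j _ => ?_
  rw [C.coe_hamSMul_apply, ham_coeff, hamElt_apply]

/-- Every element of Ham is 1 · ham(f), so sums with a single term already determine the form. -/
theorem IsCanonicalForm.eq {ω : C.Cochain 2} (h : C.IsCanonicalForm ω) : ω = C.canonicalForm := by
  funext m
  have h1 : ∀ x : C.Ham, ∑ i : Fin 1, C.hamSMul ((fun _ => ((1 : ℂ), 0)) i)
      (C.hamElt ((fun _ => hamiltonian x) i)) = x := by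
    intro x
    simp only [Finset.univ_unique, Finset.sum_const, Finset.card_singleton, one_smul]
    rw [hamElt_hamiltonian]
    exact C.ham_ext fun a => by simp [coe_hamSMul_apply, coeff]
  have hm : m = ![m 0, m 1] := by
    funext i
    refine Fin.cases rfl (fun i => ?_) i
    rw [Subsingleton.elim i 0]; rfl
  have e1 := h 1 1 (fun _ => (1, 0)) (fun _ => hamiltonian (m 0)) (fun _ => (1, 0))
    (fun _ => hamiltonian (m 1))
  have e2 := C.isCanonicalForm_canonicalForm 1 1 (fun _ => (1, 0)) (fun _ => hamiltonian (m 0))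
    (fun _ => (1, 0)) (fun _ => hamiltonian (m 1))
  rw [h1, h1] at e1 e2
  rw [hm, e1, e2]

/-- Linearity is visible only in the first slot, the second involving a choice of Hamiltonian;
antisymmetry transfers it. -/
theorem isForm_canonicalForm (C : AssocProduct V) : C.IsForm 2 C.canonicalForm := by
  have happ : ∀ x y : C.Ham, C.canonicalForm ![x, y] = x.1 (hamiltonian y) := fun x y => rfl
  have hanti : ∀ x y : C.Ham, C.canonicalForm ![x, y] = - C.canonicalForm ![y, x] := by
    intro x y
    have hb : ∀ x y : C.Ham, x.1 (hamiltonian y) = C.bracket (hamiltonian x) (hamiltonian y) :=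
      fun x y => by rw [← hamElt_apply, hamElt_hamiltonian]
    rw [happ, happ, hb, hb]
    exact C.bracket_antisymm _ _
  have hadd : ∀ x x' y : C.Ham, C.canonicalForm ![x + x', y] =
      C.canonicalForm ![x, y] + C.canonicalForm ![x', y] := fun x x' y => by
    simp [happ]
  have hsmul : ∀ p (x y : C.Ham), C.canonicalForm ![C.hamSMul p x, y] =
      C.coeff p (C.canonicalForm ![x, y]) := fun p x y => by
    simp [happ, coe_hamSMul_apply]
  have hm : ∀ m : Fin 2 → C.Ham, m = ![m 0, m 1] := by
    intro m
    funext i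
    refine Fin.cases rfl (fun i => ?_) i
    rw [Subsingleton.elim i 0]; rfl
  have h0 : ∀ (m : Fin 2 → C.Ham) x, Function.update m 0 x = ![x, m 1] := fun m x => by
    rw [hm (Function.update m 0 x)]; simp
  have h1 : ∀ (m : Fin 2 → C.Ham) x, Function.update m 1 x = ![m 0, x] := fun m x => by
    rw [hm (Function.update m 1 x)]; simp
  refine ⟨fun m i x y => ?_, fun m i p x => ?_, fun m i j hij => ?_⟩
  · fin_cases i
    · simp only [Fin.zero_eta, h0, hadd]
    · simp only [Fin.mk_one, h1]
      rw [hanti, hadd, neg_add, ← hanti, ← hanti]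
  · fin_cases i
    · simp only [Fin.zero_eta, h0, hsmul]
    · simp only [Fin.mk_one, h1]
      rw [hanti, hsmul, ← map_neg, ← hanti]
  · have hs : ∀ i j : Fin 2, i ≠ j → m ∘ Equiv.swap i j = ![m 1, m 0] := by
      intro i j hij
      rw [hm (m ∘ _)]
      fin_cases i <;> fin_cases j <;> simp at hij ⊢
    rw [hs i j hij, hanti]
    conv_rhs => rw [hm m]

theorem interior_canonicalForm_eq_iff (f : V) (θ : C.Ham) :
    C.interior θ C.canonicalForm = - C.d (C.zeroForm f) ↔ θ = C.hamElt f := by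
  have hi : ∀ (θ : C.Ham) (m : Fin 1 → C.Ham), C.interior θ C.canonicalForm m =
      θ.1 (hamiltonian (m 0)) := fun _ _ => rfl
  have hd : ∀ m : Fin 1 → C.Ham, (- C.d (C.zeroForm f)) m = C.bracket f (hamiltonian (m 0)) := by
    intro m
    change - (m 0).1 f = _
    conv_lhs => rw [← hamElt_hamiltonian (m 0)]
    rw [hamElt_apply, ← C.bracket_antisymm]
  constructor
  · intro h
    refine C.ham_ext fun a => ?_
    have := congrFun h (fun _ => C.hamElt a)
    rw [hi, hd] at this
    rw [hamElt_apply, ham_apply_congr θ (hamElt_hamiltonian (C.hamElt a)).symm, this,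
      ← hamElt_apply, ← hamElt_apply]
    exact ham_apply_congr _ (hamElt_hamiltonian _)
  · rintro rfl
    funext m
    rw [hi, hd]; rfl

theorem hamLie_hamElt (θ : C.Ham) (g : V) : C.hamLie θ (C.hamElt g) = C.hamElt (θ.1 g) :=
  C.ham_ext fun a => by
    simp only [coe_hamLie_apply, hamElt_apply, bracket, map_sub, ham_leibniz]
    abel

/-- Hamiltonian derivations preserve the canonical form. -/
theorem lieDeriv_canonicalForm (θ : C.Ham) : lieDeriv θ C.canonicalForm = 0 := by
  funext m
  have hm := hamElt_hamiltonian (m 1)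
  simp only [lieDeriv, Fin.sum_univ_two]
  -- With m 1 = ham g, the bracket [θ, ham g] is ham(θ g), and the three terms are θ(m₀ g), [θ, m₀]
  -- g and m₀(θ g), where m₀ = m 0.
  rw [canonicalForm_apply' m _ hm,
    canonicalForm_apply' (Function.update m 0 _) (hamiltonian (m 1)) (by simpa using hm),
    canonicalForm_apply' (Function.update m 1 _) (θ.1 (hamiltonian (m 1)))
      (by rw [← hamLie_hamElt, hm]; simp)]
  simp [coe_hamLie_apply]

/-- By Cartan's formula i_θ dω = L_θ ω - d i_θ ω. The first term vanishes by invariance, the second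
since i_θ ω = -df is exact for a Hamiltonian f of θ. -/
theorem d_canonicalForm (C : AssocProduct V) : C.d C.canonicalForm = 0 := by
  funext m
  have h := C.isForm_canonicalForm.interior_d_eq (m 0)
  rw [lieDeriv_canonicalForm, (interior_canonicalForm_eq_iff (hamiltonian (m 0)) (m 0)).mpr
    (hamElt_hamiltonian _).symm] at h
  have hd : C.d (- C.d (C.zeroForm (hamiltonian (m 0)))) = 0 := by
    apply ofCochain_injective
    have hz := C.isForm_zero (C.zeroForm (hamiltonian (m 0)))
    have hf : C.IsForm 1 (- C.d (C.zeroForm (hamiltonian (m 0)))) := by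
      apply isForm_of_isListForm
      rw [ofCochain_neg]
      exact hz.d.isListForm.neg
    rw [hf.ofCochain_d, ofCochain_neg, listD_neg, hz.ofCochain_d, hz.isListForm.listD_listD,
      ofCochain_zero, neg_zero]
  rw [hd, sub_zero] at h
  have := congrFun h (Fin.tail m)
  rwa [interior, Fin.cons_self_tail] at this

theorem isSymplectic_canonicalForm (C : AssocProduct V) : C.IsSymplectic C.canonicalForm where
  form := C.isForm_canonicalForm
  closed := C.d_canonicalForm
  nondegenerate θ h := C.ham_ext fun a => by
    have := h (C.hamElt a)
    rwa [canonicalForm_apply] at this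
  vectorField := interior_canonicalForm_eq_iff
  poisson_d _ _ := rfl
  poisson_form f g := by
    have h : C.bracket f g = C.canonicalForm ![C.hamElt f, C.hamElt g] := by
      rw [canonicalForm_apply]; rfl
    refine ⟨h, ?_⟩
    funext m
    rw [zeroForm, h, interior, interior]
    congr 1
    funext i
    fin_cases i <;> rfl

theorem isSymplecticGeometry (C : AssocProduct V) : C.IsSymplecticGeometry where
  lie_self _ := sub_self _
  lie_jacobi := C.bracket_jacobi
  poisson_leibniz := C.bracket_leibniz
  der_lie _ hθ _ hη := C.der_lie hθ hη
  ham_le_der := C.Ham_le_der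
  dga := C.isDGA
  interior := C.interiorIsDerivation
  symplectic := ⟨C.canonicalForm, C.isCanonicalForm_canonicalForm, C.isSymplectic_canonicalForm,
    fun _ h => h.eq⟩

end AssocProduct

/-! ### Nijenhuis maps and deformed products -/

section Deformation

variable {V : Type} [AddCommGroup V] [Module ℂ V] {m : V →ₗ[ℂ] V →ₗ[ℂ] V} {N : V →ₗ[ℂ] V}

theorem deformedProduct_apply (m : V →ₗ[ℂ] V →ₗ[ℂ] V) (N : V →ₗ[ℂ] V) (a b : V) :
    deformedProduct m N a b = m (N a) b + m a (N b) - N (m a b) := rfl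

theorem IsNijenhuis.map_deformedProduct (h : IsNijenhuis m N) (a b : V) :
    N (deformedProduct m N a b) = m (N a) (N b) := (h a b).symm

/-- Multiplicativity of N removes the nested deformation inside N. The terms still unmatched are
N(ab) N(c) and N(a) N(bc), which the Nijenhuis relation expands for the pairs (ab, c) and (a, bc).
-/
theorem IsNijenhuis.isAssoc_deformedProduct (hm : IsAssoc m) (h : IsNijenhuis m N) :
    IsAssoc (deformedProduct m N) := by
  intro a b c
  rw [deformedProduct_apply m N (deformedProduct m N a b) c,
    deformedProduct_apply m N a (deformedProduct m N b c), h.map_deformedProduct,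
    h.map_deformedProduct]
  have h1 := h (m a b) c
  have h2 := h a (m b c)
  simp only [deformedProduct_apply, map_add, map_sub, LinearMap.add_apply, LinearMap.sub_apply,
    hm _ _ _] at h1 h2 ⊢
  rw [h1, h2]
  abel

theorem nijenhuisSymplecticModel_of_isNijenhuis (hm : IsAssoc m) (h : IsNijenhuis m N)
    (hnc : ∃ a b, deformedProduct m N a b ≠ deformedProduct m N b a) :
    NijenhuisSymplecticModel m N := by
  refine ⟨h, h.map_deformedProduct, ⟨deformedProduct m N, h.isAssoc_deformedProduct hm⟩, rfl, hnc,
    fun a b => ?_, AssocProduct.isSymplecticGeometry _⟩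
  simp only [AssocProduct.bracket, deformedProduct_apply, map_sub]
  abel

/-- A bijective N is an isomorphism from the deformed product to m, and the unit is pulled back. -/
theorem IsNijenhuis.exists_isUnitOf_deformedProduct (h : IsNijenhuis m N)
    (hN : Function.Bijective N) {u : V} (hu : IsUnitOf m u) :
    ∃ e, IsUnitOf (deformedProduct m N) e := by
  obtain ⟨e, he⟩ := hN.2 u
  refine ⟨e, fun a => ⟨hN.1 ?_, hN.1 ?_⟩⟩
  · rw [h.map_deformedProduct, he, (hu _).1]
  · rw [h.map_deformedProduct, he, (hu _).2]

theorem lambdaDeformation_apply (R : V →ₗ[ℂ] V) (lam : ℝ) (a : V) :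
    lambdaDeformation R lam a = R a - (lam : ℂ) • (a - R a) := rfl

/-- The operator is 1 on the image of R and -λ on its kernel; the inverse has the same form with λ⁻¹
in place of λ. -/
theorem lambdaDeformation_bijective {R : V →ₗ[ℂ] V} (hR : R ∘ₗ R = R) {lam : ℝ} (hl : lam ≠ 0) :
    Function.Bijective (lambdaDeformation R lam) := by
  have hR' : ∀ a, R (R a) = R a := fun a => LinearMap.congr_fun hR a
  have hl' : (lam : ℂ) ≠ 0 := by exact_mod_cast hl
  refine Function.bijective_iff_has_inverse.mpr
    ⟨fun a => R a - (lam : ℂ)⁻¹ • (a - R a), fun a => ?_, fun a => ?_⟩ <;>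
  simp only [lambdaDeformation_apply, map_sub, map_smul, hR', sub_self, smul_zero, sub_zero,
    sub_sub_cancel_left, smul_neg, smul_smul, inv_mul_cancel₀ hl', one_smul,
    sub_neg_eq_add, add_sub_cancel]

/-- Image and kernel of R are complementary subalgebras, on which N = R_λ is the scalar 1 or -λ.
Within one of them the relation is immediate; for mixed factors it is the quadratic equation (N -
1)(N + λ) = 0. The computation does all cases at once by substituting the Rota–Baxter relation. -/
theorem IsRotaBaxter.isNijenhuis_lambdaDeformation {R : V →ₗ[ℂ] V} (hR : R ∘ₗ R = R)
    (h : IsRotaBaxter m R) (lam : ℝ) : IsNijenhuis m (lambdaDeformation R lam) := by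
  intro a b
  have hR' : ∀ a, R (R a) = R a := fun a => LinearMap.congr_fun hR a
  have h1 := h a b
  simp only [lambdaDeformation_apply, map_add, map_sub, map_smul,
    LinearMap.sub_apply, LinearMap.smul_apply, hR'] at h1 ⊢
  rw [h1]
  module

end Deformation

/-! ### Convolution -/

section Convolution

variable {H B : Type} [Ring H] [Algebra ℂ H] [AddCommGroup B] [Module ℂ B]

theorem convolution_apply (Δ : H →ₗ[ℂ] H ⊗[ℂ] H) (m : B →ₗ[ℂ] B →ₗ[ℂ] B) (φ ψ : H →ₗ[ℂ] B) (x : H) :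
    convolution Δ m φ ψ x = TensorProduct.lift (m.compl₁₂ φ ψ) (Δ x) := rfl

theorem liftMap_apply (R : B →ₗ[ℂ] B) (φ : H →ₗ[ℂ] B) (x : H) : liftMap H R φ x = R (φ x) := rfl

/-- This reduces noncommutativity and the existence of a unit for the deformed convolution to the
algebra of values. -/
theorem deformedProduct_convolution (Δ : H →ₗ[ℂ] H ⊗[ℂ] H) (m : B →ₗ[ℂ] B →ₗ[ℂ] B)
    (N : B →ₗ[ℂ] B) :
    deformedProduct (convolution Δ m) (liftMap H N) = convolution Δ (deformedProduct m N) := by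
  ext φ ψ x
  rw [deformedProduct_apply]
  simp only [LinearMap.sub_apply, LinearMap.add_apply, convolution_apply, liftMap_apply]
  generalize Δ x = t
  induction t using TensorProduct.induction_on with
  | zero => simp
  | tmul a b => simp [deformedProduct_apply, liftMap_apply]
  | add s t hs ht =>
    simp only [map_add] at hs ht ⊢
    rw [← hs, ← ht]
    abel

theorem liftMap_lambdaDeformation (R : B →ₗ[ℂ] B) (lam : ℝ) :
    liftMap H (lambdaDeformation R lam) = lambdaDeformation (liftMap H R) lam := by
  ext φ x
  simp [liftMap_apply, lambdaDeformation_apply]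

theorem isAssoc_convolution {Δ : H →ₗ[ℂ] H ⊗[ℂ] H}
    (hΔ : ∀ x, TensorProduct.assoc ℂ H H H (TensorProduct.map Δ LinearMap.id (Δ x)) =
      TensorProduct.map LinearMap.id Δ (Δ x)) {m : B →ₗ[ℂ] B →ₗ[ℂ] B} (hm : IsAssoc m) :
    IsAssoc (convolution Δ m) := by
  intro φ ψ χ
  ext x
  have h1 : ∀ t : H ⊗[ℂ] H, TensorProduct.lift (m.compl₁₂ (convolution Δ m φ ψ) χ) t =
      TensorProduct.lift (m.compl₁₂ (TensorProduct.lift (m.compl₁₂ φ ψ)) χ)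
        (TensorProduct.map Δ LinearMap.id t) := by
    intro t
    induction t using TensorProduct.induction_on with
    | zero => simp
    | tmul a b => simp [convolution_apply]
    | add s t hs ht => simp only [map_add, hs, ht]
  have h2 : ∀ t : H ⊗[ℂ] H, TensorProduct.lift (m.compl₁₂ φ (convolution Δ m ψ χ)) t =
      TensorProduct.lift (m.compl₁₂ φ (TensorProduct.lift (m.compl₁₂ ψ χ)))
        (TensorProduct.map LinearMap.id Δ t) := by
    intro t
    induction t using TensorProduct.induction_on with
    | zero => simp
    | tmul a b => simp [convolution_apply]
    | add s t hs ht => simp only [map_add, hs, ht]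
  rw [convolution_apply, h1, convolution_apply, h2, ← hΔ]
  generalize TensorProduct.map Δ LinearMap.id (Δ x) = t
  have h3 : TensorProduct.lift (m.compl₁₂ (TensorProduct.lift (m.compl₁₂ φ ψ)) χ) =
      TensorProduct.lift (m.compl₁₂ φ (TensorProduct.lift (m.compl₁₂ ψ χ))) ∘ₗ
        (TensorProduct.assoc ℂ H H H).toLinearMap := by
    ext a b c
    simp [hm _ _ _]
  exact LinearMap.congr_fun h3 t

theorem isUnitOf_convolution {Δ : H →ₗ[ℂ] H ⊗[ℂ] H} {ε : H →ₗ[ℂ] ℂ}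
    (hl : ∀ x, TensorProduct.lid ℂ H (TensorProduct.map ε LinearMap.id (Δ x)) = x)
    (hr : ∀ x, TensorProduct.rid ℂ H (TensorProduct.map LinearMap.id ε (Δ x)) = x)
    {m : B →ₗ[ℂ] B →ₗ[ℂ] B} {e : B} (he : IsUnitOf m e) :
    IsUnitOf (convolution Δ m) (LinearMap.toSpanSingleton ℂ B e ∘ₗ ε) := by
  intro φ
  constructor <;> ext x <;> rw [convolution_apply]
  · conv_rhs => rw [← hl x]
    generalize Δ x = t
    induction t using TensorProduct.induction_on with
    | zero => simp
    | tmul a b => simp [(he _).1]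
    | add s t hs ht => simp only [map_add, hs, ht]
  · conv_rhs => rw [← hr x]
    generalize Δ x = t
    induction t using TensorProduct.induction_on with
    | zero => simp
    | tmul a b => simp [(he _).2]
    | add s t hs ht => simp only [map_add, hs, ht]

theorem exists_isUnitOf_convolution_iff {Δ : H →ₐ[ℂ] H ⊗[ℂ] H} {ε : H →ₐ[ℂ] ℂ}
    (hH : IsHopfAlgebra Δ ε) {m : B →ₗ[ℂ] B →ₗ[ℂ] B} :
    (∃ E, IsUnitOf (convolution Δ.toLinearMap m) E) ↔ ∃ e, IsUnitOf m e := by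
  constructor
  · rintro ⟨E, hE⟩
    refine ⟨E 1, fun b => ?_⟩
    -- Since Δ(1) = 1 ⊗ 1, evaluating at 1 the unit law for the functional b ε gives the unit law
    -- for E(1) and b.
    obtain ⟨h1, h2⟩ := hE (LinearMap.toSpanSingleton ℂ B b ∘ₗ ε.toLinearMap)
    have h1 := LinearMap.congr_fun h1 1
    have h2 := LinearMap.congr_fun h2 1
    rw [convolution_apply] at h1 h2
    simpa [Algebra.TensorProduct.one_def] using And.intro h1 h2
  · rintro ⟨e, he⟩
    exact ⟨_, isUnitOf_convolution (Δ := Δ.toLinearMap) (ε := ε.toLinearMap)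
      hH.counit_left hH.counit_right he⟩

theorem IsRotaBaxter.convolution (Δ : H →ₗ[ℂ] H ⊗[ℂ] H) {m : B →ₗ[ℂ] B →ₗ[ℂ] B}
    {R : B →ₗ[ℂ] B} (h : IsRotaBaxter m R) :
    IsRotaBaxter (convolution Δ m) (liftMap H R) := by
  intro φ ψ
  ext x
  simp only [liftMap_apply, LinearMap.sub_apply, LinearMap.add_apply, convolution_apply]
  generalize Δ x = t
  induction t using TensorProduct.induction_on with
  | zero => simp
  | tmul a b => simpa [liftMap_apply] using h (φ a) (ψ b)
  | add s t hs ht =>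
    simp only [map_add, map_sub] at hs ht ⊢
    rw [hs, ht]
    abel

theorem IsNijenhuis.convolution (Δ : H →ₗ[ℂ] H ⊗[ℂ] H) {m : B →ₗ[ℂ] B →ₗ[ℂ] B}
    {N : B →ₗ[ℂ] B} (h : IsNijenhuis m N) :
    IsNijenhuis (convolution Δ m) (liftMap H N) := by
  intro φ ψ
  ext x
  simp only [liftMap_apply, LinearMap.sub_apply, LinearMap.add_apply, convolution_apply]
  generalize Δ x = t
  induction t using TensorProduct.induction_on with
  | zero => simp
  | tmul a b => simpa [liftMap_apply] using h (φ a) (ψ b)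
  | add s t hs ht =>
    simp only [map_add, map_sub] at hs ht ⊢
    rw [hs, ht]
    abel

/-- Products of linear functionals separate the points of a tensor product. -/
theorem tensorProduct_eq_zero_of_functionals {t : H ⊗[ℂ] H}
    (h : ∀ f g : H →ₗ[ℂ] ℂ, TensorProduct.lift ((LinearMap.mul ℂ ℂ).compl₁₂ f g) t = 0) :
    t = 0 := by
  let b := Module.Basis.ofVectorSpace ℂ H
  refine (b.tensorProduct b).ext_elem fun ⟨i, j⟩ => ?_
  have h1 : ∀ t : H ⊗[ℂ] H, (b.tensorProduct b).repr t (i, j) =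
      TensorProduct.lift ((LinearMap.mul ℂ ℂ).compl₁₂ (b.coord i) (b.coord j)) t := by
    intro t
    induction t using TensorProduct.induction_on with
    | zero => simp
    | tmul x y => simp [Module.Basis.tensorProduct_repr_tmul_apply, mul_comm]
    | add s t hs ht => simp only [map_add, Finsupp.add_apply, hs, ht]
  rw [h1, h]
  simp

/-- For scalar functionals f and g, the convolution of b f and b g is the scalar convolution of f
and g times b b ≠ 0. If all of these commuted, then scalar functionals could not distinguish Δ from
its flip. -/
theorem NonCocommutative.exists_convolution_ne {Δ : H →ₐ[ℂ] H ⊗[ℂ] H} (h : NonCocommutative Δ)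
    {m : B →ₗ[ℂ] B →ₗ[ℂ] B} {b : B} (hb : m b b ≠ 0) :
    ∃ φ ψ, convolution Δ.toLinearMap m φ ψ ≠ convolution Δ.toLinearMap m ψ φ := by
  obtain ⟨x, hx⟩ := h
  by_contra! hcomm
  refine hx (sub_eq_zero.mp (tensorProduct_eq_zero_of_functionals fun f g => ?_))
  have h1 : ∀ (f g : H →ₗ[ℂ] ℂ) (t : H ⊗[ℂ] H),
      TensorProduct.lift (m.compl₁₂ (LinearMap.toSpanSingleton ℂ B b ∘ₗ f)
        (LinearMap.toSpanSingleton ℂ B b ∘ₗ g)) t =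
      TensorProduct.lift ((LinearMap.mul ℂ ℂ).compl₁₂ f g) t • m b b := by
    intro f g t
    induction t using TensorProduct.induction_on with
    | zero => simp
    | tmul x y => simp [smul_smul, mul_comm]
    | add s t hs ht => simp only [map_add, add_smul, hs, ht]
  have h2 : ∀ t : H ⊗[ℂ] H,
      TensorProduct.lift ((LinearMap.mul ℂ ℂ).compl₁₂ f g) (TensorProduct.comm ℂ H H t) =
      TensorProduct.lift ((LinearMap.mul ℂ ℂ).compl₁₂ g f) t := by
    intro t
    induction t using TensorProduct.induction_on with
    | zero => simp
    | tmul x y => simp [mul_comm]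
    | add s t hs ht => simp only [map_add, hs, ht]
  have h3 := LinearMap.congr_fun (hcomm (LinearMap.toSpanSingleton ℂ B b ∘ₗ g)
    (LinearMap.toSpanSingleton ℂ B b ∘ₗ f)) x
  rw [convolution_apply, convolution_apply, h1, h1, ← sub_eq_zero, ← sub_smul,
    smul_eq_zero_iff_left hb] at h3
  rw [map_sub, h2]
  exact h3

theorem nijenhuisSymplecticModel_convolution {Δ : H →ₐ[ℂ] H ⊗[ℂ] H} {ε : H →ₐ[ℂ] ℂ}
    (hH : IsHopfAlgebra Δ ε) (hnc : NonCocommutative Δ) {m : B →ₗ[ℂ] B →ₗ[ℂ] B} (hm : IsAssoc m)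
    {N : B →ₗ[ℂ] B} (hN : IsNijenhuis m N) {b : B} (hb : deformedProduct m N b b ≠ 0) :
    NijenhuisSymplecticModel (convolution Δ.toLinearMap m) (liftMap H N) := by
  refine nijenhuisSymplecticModel_of_isNijenhuis (isAssoc_convolution hH.coassoc hm)
    (hN.convolution _) ?_
  rw [deformedProduct_convolution]
  exact hnc.exists_convolution_ne hb

end Convolution

/-! ### Minimal subtraction -/

theorem Laurent.ext {a b : Laurent} (h : ∀ n, a.coeff n = b.coeff n) : a = b :=
  HahnSeries.ext (funext h)

theorem Laurent.coeff_add (a b : Laurent) (n : ℤ) :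
    (a + b).coeff n = a.coeff n + b.coeff n := rfl

theorem Laurent.coeff_mul_eq_zero {a b : Laurent} {n : ℤ}
    (h : ∀ i j, i + j = n → a.coeff i = 0 ∨ b.coeff j = 0) : (a * b).coeff n = 0 := by
  change HahnSeries.coeff ((show HahnSeries ℤ ℂ from a) * (show HahnSeries ℤ ℂ from b)) n = 0
  rw [HahnSeries.coeff_mul]
  refine Finset.sum_eq_zero fun ij hij => ?_
  rw [Finset.mem_antidiagonal] at hij
  exact mul_eq_zero.mpr (h _ _ hij.2.2)

theorem poleProjection_eq_self {a : Laurent} (h : ∀ n, 0 ≤ n → a.coeff n = 0) :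
    poleProjection a = a :=
  Laurent.ext fun n => by
    rw [poleProjection_coeff]
    split_ifs with hn
    · rfl
    · exact (h n (not_lt.mp hn)).symm

theorem poleProjection_eq_zero {a : Laurent} (h : ∀ n, n < 0 → a.coeff n = 0) :
    poleProjection a = 0 :=
  Laurent.ext fun n => by
    rw [poleProjection_coeff]
    split_ifs with hn
    · exact h n hn
    · rfl

theorem poleProjection_poleProjection (a : Laurent) :
    poleProjection (poleProjection a) = poleProjection a :=
  poleProjection_eq_self fun n hn => by rw [poleProjection_coeff, if_neg (not_lt.mpr hn)]

theorem poleProjection_mul_poleProjection (a b : Laurent) :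
    poleProjection (poleProjection a * poleProjection b) = poleProjection a * poleProjection b := by
  refine poleProjection_eq_self fun n hn => Laurent.coeff_mul_eq_zero fun i j hij => ?_
  rw [poleProjection_coeff, poleProjection_coeff]
  rcases lt_or_ge i 0 with hi | hi
  · right; rw [if_neg (by omega)]
  · left; rw [if_neg (by omega)]

theorem coeff_sub_poleProjection (a : Laurent) {n : ℤ} (hn : n < 0) :
    (a - poleProjection a).coeff n = 0 := by
  have h : a.coeff n = (a - poleProjection a).coeff n + (poleProjection a).coeff n := by
    rw [← Laurent.coeff_add, sub_add_cancel]
  rw [poleProjection_coeff, if_pos hn] at h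
  exact add_eq_right.mp h.symm

/-- The argument of R equals R(a)R(b) - (a - Ra)(b - Rb). Pole parts are closed under products, and
so are series without poles, so R keeps the first term and kills the second. -/
theorem poleProjection_rotaBaxter (a b : Laurent) :
    poleProjection a * poleProjection b =
      poleProjection (poleProjection a * b + a * poleProjection b - a * b) := by
  have h1 : poleProjection a * b + a * poleProjection b - a * b =
      poleProjection a * poleProjection b - (a - poleProjection a) * (b - poleProjection b) := by
    ring
  rw [h1, map_sub, poleProjection_mul_poleProjection, eq_comm, sub_eq_self]
  refine poleProjection_eq_zero fun n hn => Laurent.coeff_mul_eq_zero fun i j hij => ?_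
  rcases lt_or_ge i 0 with hi | hi
  · exact Or.inl (coeff_sub_poleProjection a hi)
  · exact Or.inr (coeff_sub_poleProjection b (by omega))

theorem Laurent.coeff_zInv (n : ℤ) : Laurent.zInv.coeff n = if n = -1 then 1 else 0 := by
  change HahnSeries.coeff (HahnSeries.single (-1 : ℤ) (1 : ℂ)) n = _
  rw [HahnSeries.coeff_single]
  congr

theorem poleProjection_zInv : poleProjection Laurent.zInv = Laurent.zInv :=
  poleProjection_eq_self fun n hn => by rw [Laurent.coeff_zInv, if_neg (by omega)]

theorem Laurent.zInv_ne_zero : Laurent.zInv ≠ 0 := by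
  intro h
  have := congrArg (fun a => Laurent.coeff a (-1)) h
  simp only [Laurent.coeff_zInv, if_true] at this
  exact one_ne_zero this

instance : IsDomain Laurent := inferInstanceAs (IsDomain (HahnSeries ℤ ℂ))

-- Minimal subtraction on a regularization algebra and the resulting model.

section RotaBaxterModel

variable {A : Subalgebra ℂ Laurent} (hA : IsRegularizationAlgebra A)

theorem coe_minimalSubtraction (a : A) :
    (minimalSubtraction hA a : Laurent) = poleProjection a := rfl

theorem minimalSubtraction_comp_self :
    minimalSubtraction hA ∘ₗ minimalSubtraction hA = minimalSubtraction hA :=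
  LinearMap.ext fun a => Subtype.ext (poleProjection_poleProjection a)

theorem isRotaBaxter_minimalSubtraction :
    IsRotaBaxter (LinearMap.mul ℂ A) (minimalSubtraction hA) :=
  fun a b => Subtype.ext (poleProjection_rotaBaxter a b)

/-- The product deformed by `R` itself has no unit: `R e` would be `1`, which is no pole part. -/
theorem not_exists_isUnitOf_minimalSubtraction :
    ¬ ∃ e, IsUnitOf (deformedProduct (LinearMap.mul ℂ A) (minimalSubtraction hA)) e := by
  rintro ⟨e, he⟩
  have hN : IsNijenhuis (LinearMap.mul ℂ A) (minimalSubtraction hA) := by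
    have := (isRotaBaxter_minimalSubtraction hA).isNijenhuis_lambdaDeformation
      (minimalSubtraction_comp_self hA) 0
    simpa [lambdaDeformation] using this
  -- Since R fixes z⁻¹, multiplicativity of R and the unit law give R(e) z⁻¹ = z⁻¹, whence R(e) = 1
  -- because there are no zero divisors.
  have h1 := hN.map_deformedProduct e ⟨Laurent.zInv, hA.zInv_mem⟩
  rw [(he _).1] at h1
  have h2 := congrArg (fun a : A => (a : Laurent)) h1
  simp only [LinearMap.mul_apply', MulMemClass.coe_mul, coe_minimalSubtraction,
    poleProjection_zInv] at h2
  have h3 : poleProjection (e : Laurent) = 1 := by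
    refine mul_right_cancel₀ Laurent.zInv_ne_zero ?_
    rw [← h2, one_mul]
  have h4 := congrArg (fun a => Laurent.coeff a 0) h3
  simp only [poleProjection_coeff, lt_irrefl, if_false] at h4
  have h5 : Laurent.coeff 1 0 = 1 := by
    change HahnSeries.coeff (1 : HahnSeries ℤ ℂ) 0 = 1
    simp
  rw [h5] at h4
  exact zero_ne_one h4

theorem rotaBaxterModel {H : Type} [Ring H] [Algebra ℂ H] {Δ : H →ₐ[ℂ] H ⊗[ℂ] H} {ε : H →ₐ[ℂ] ℂ}
    (hH : IsHopfAlgebra Δ ε) (hnc : NonCocommutative Δ) :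
    RotaBaxterModel (B := A) Δ ε (minimalSubtraction hA) := by
  have hR := minimalSubtraction_comp_self hA
  have hRB := isRotaBaxter_minimalSubtraction hA
  have hm : IsAssoc (LinearMap.mul ℂ A) := fun a b c => mul_assoc a b c
  have hu : IsUnitOf (LinearMap.mul ℂ A) 1 := fun a => ⟨one_mul a, mul_one a⟩
  refine ⟨hR, hRB, isAssoc_convolution hH.coassoc hm, ?_, ?_, hRB.convolution _, fun lam => ?_⟩
  · convert isUnitOf_convolution (Δ := Δ.toLinearMap) (ε := ε.toLinearMap) hH.counit_left
      hH.counit_right hu using 1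
    ext x
    simp [convUnit, Algebra.algebraMap_eq_smul_one]
  · ext φ x
    exact LinearMap.congr_fun hR (φ x) ▸ rfl
  · have hN := hRB.isNijenhuis_lambdaDeformation hR lam
    rw [← liftMap_lambdaDeformation]
    constructor
    · refine nijenhuisSymplecticModel_convolution hH hnc hm hN
        (b := ⟨Laurent.zInv, hA.zInv_mem⟩) ?_
      -- Both z⁻¹ and its square are pole parts, hence fixed by R_λ for every λ; the deformed square
      -- of z⁻¹ is thus the ordinary one, which is nonzero.
      set b : A := ⟨Laurent.zInv, hA.zInv_mem⟩
      have h1 : minimalSubtraction hA b = b := Subtype.ext poleProjection_zInv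
      have h2 : minimalSubtraction hA (b * b) = b * b := by
        have := hRB b b
        simp only [h1, add_sub_cancel_right] at this
        exact this.symm
      have h3 : deformedProduct (LinearMap.mul ℂ A)
          (lambdaDeformation (minimalSubtraction hA) lam) b b = b * b := by
        simp [deformedProduct_apply, lambdaDeformation_apply, h1, h2]
      rw [h3]
      intro h0
      have := congrArg (fun a : A => (a : Laurent)) h0
      simp only [MulMemClass.coe_mul, ZeroMemClass.coe_zero, mul_self_eq_zero] at this
      exact Laurent.zInv_ne_zero this
    · rw [deformedProduct_convolution, exists_isUnitOf_convolution_iff hH]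
      constructor
      · rintro he rfl
        refine not_exists_isUnitOf_minimalSubtraction hA ?_
        simpa [lambdaDeformation] using he
      · intro hl
        exact hN.exists_isUnitOf_deformedProduct (lambdaDeformation_bijective hR hl) hu

end RotaBaxterModel

/-! ### The universal Nijenhuis algebra -/

section Words

variable {A : Type} [CommRing A] [Algebra ℂ A]

theorem letterCons_apply (f : A) (U : TensorAlgebra ℂ A) :
    letterCons A f U = TensorAlgebra.ι ℂ f * U := rfl

/-- Induction on words for subspaces of the tensor algebra. -/
theorem mem_of_letterCons_mem {M : Submodule ℂ (TensorAlgebra ℂ A)} (h1 : 1 ∈ M)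
    (hc : ∀ f, ∀ U ∈ M, letterCons A f U ∈ M) (U : TensorAlgebra ℂ A) : U ∈ M := by
  -- Stability under left multiplication, unlike membership, passes to products of the U's.
  suffices ∀ V ∈ M, U * V ∈ M by simpa using this 1 h1
  induction U using TensorAlgebra.induction with
  | algebraMap c => intro V hV; rw [← Algebra.smul_def]; exact M.smul_mem c hV
  | ι f => exact hc f
  | mul a b ha hb => intro V hV; rw [mul_assoc]; exact ha _ (hb _ hV)
  | add a b ha hb => intro V hV; rw [add_mul]; exact M.add_mem (ha _ hV) (hb _ hV)

/-- The word with the given letters. -/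
noncomputable def word (l : List A) : TensorAlgebra ℂ A :=
  l.foldr (fun f U => letterCons A f U) 1

theorem word_cons (f : A) (l : List A) : word (f :: l) = letterCons A f (word l) := rfl

/-- Linear maps on the tensor algebra that agree on words are equal. -/
theorem linearMap_ext_word {W : Type} [AddCommGroup W] [Module ℂ W]
    {φ ψ : TensorAlgebra ℂ A →ₗ[ℂ] W} (h : ∀ l, φ (word l) = ψ (word l)) : φ = ψ := by
  ext U
  suffices U ∈ Submodule.span ℂ (Set.range (word (A := A))) by
    induction this using Submodule.span_induction with
    | mem x hx => obtain ⟨l, rfl⟩ := hx; exact h l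
    | zero => simp
    | add x y _ _ hx hy => simp [hx, hy]
    | smul c x _ hx => simp [hx]
  refine mem_of_letterCons_mem (Submodule.subset_span (Set.mem_range_self [])) (fun f U hU => ?_) U
  induction hU using Submodule.span_induction with
  | mem x hx => obtain ⟨l, rfl⟩ := hx; exact Submodule.subset_span (Set.mem_range_self (f :: l))
  | zero => simp
  | add x y _ _ hx hy => rw [map_add]; exact Submodule.add_mem _ hx hy
  | smul c x _ hx => rw [map_smul]; exact Submodule.smul_mem _ c hx

theorem quasiShuffle_word_one (l : List A) : quasiShuffle A (word l) 1 = word l := by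
  induction l with
  | nil => exact quasiShuffle_one_left A 1
  | cons f l ih => rw [word_cons, quasiShuffle_cons_one, ih]

theorem quasiShuffle_one_right (U : TensorAlgebra ℂ A) : quasiShuffle A U 1 = U := by
  have : (quasiShuffle A).flip 1 = LinearMap.id := linearMap_ext_word quasiShuffle_word_one
  exact LinearMap.congr_fun this U

theorem quasiShuffle_word_comm (k l : List A) :
    quasiShuffle A (word k) (word l) = quasiShuffle A (word l) (word k) := by
  induction k generalizing l with
  | nil => exact (quasiShuffle_one_left A _).trans (quasiShuffle_one_right _).symm
  | cons f k ihk =>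
    induction l with
    | nil => exact (quasiShuffle_one_right _).trans (quasiShuffle_one_left A _).symm
    | cons g l ihl =>
      have h := ihk (g :: l)
      rw [word_cons] at h ihl
      rw [word_cons, word_cons, quasiShuffle_cons_cons, quasiShuffle_cons_cons, ihk l, ihl, h,
        mul_comm g f]
      abel

theorem quasiShuffle_comm (U V : TensorAlgebra ℂ A) :
    quasiShuffle A U V = quasiShuffle A V U := by
  have : quasiShuffle A = (quasiShuffle A).flip :=
    linearMap_ext_word fun k => linearMap_ext_word fun l => quasiShuffle_word_comm k l
  exact LinearMap.congr_fun₂ this U V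

/-- The triple product of nonempty words, in a form that is symmetric in the factors. -/
theorem quasiShuffle_cons_cons_cons (f g h : A) (U V W : TensorAlgebra ℂ A) :
    quasiShuffle A (quasiShuffle A (letterCons A f U) (letterCons A g V)) (letterCons A h W) =
      letterCons A f (quasiShuffle A (quasiShuffle A U (letterCons A g V)) (letterCons A h W)) +
      letterCons A g (quasiShuffle A (quasiShuffle A (letterCons A f U) V) (letterCons A h W)) +
      letterCons A h (quasiShuffle A (quasiShuffle A (letterCons A f U) (letterCons A g V)) W) -
      letterCons A 1 (letterCons A (f * h)
        (quasiShuffle A (quasiShuffle A U (letterCons A g V)) W)) -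
      letterCons A 1 (letterCons A (g * h)
        (quasiShuffle A (quasiShuffle A (letterCons A f U) V) W)) -
      letterCons A 1 (letterCons A (f * g)
        (quasiShuffle A (quasiShuffle A U V) (letterCons A h W))) +
      letterCons A 1 (letterCons A 1 (letterCons A (f * g * h)
        (quasiShuffle A (quasiShuffle A U V) W))) := by
  simp only [quasiShuffle_cons_cons A f g, map_add, map_sub, LinearMap.add_apply,
    LinearMap.sub_apply, quasiShuffle_cons_cons A _ h, one_mul]
  abel

/-- Given commutativity this is associativity. In the rotated form both sides are left-bracketed
triple products, expanded by the same formula; its seven terms are permuted and matched by the seven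
induction hypotheses. -/
theorem quasiShuffle_word_rotate (k l m : List A) :
    quasiShuffle A (quasiShuffle A (word k) (word l)) (word m) =
      quasiShuffle A (quasiShuffle A (word l) (word m)) (word k) := by
  have hnil : word ([] : List A) = 1 := rfl
  induction k generalizing l m with
  | nil => rw [hnil, quasiShuffle_one_left, quasiShuffle_one_right]
  | cons f k ihk =>
    induction l generalizing m with
    | nil => rw [hnil, quasiShuffle_one_left, quasiShuffle_one_right, quasiShuffle_comm]
    | cons g l ihl =>
      induction m with
      | nil => rw [hnil, quasiShuffle_one_right, quasiShuffle_one_right, quasiShuffle_comm]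
      | cons h m ihm =>
        have h1 := ihk (g :: l) (h :: m)
        have h2 := ihk (g :: l) m
        have h3 := ihk l (h :: m)
        have h4 := ihl (h :: m)
        have h5 := ihl m
        have h6 := ihk l m
        simp only [word_cons] at h1 h2 h3 h4 h5 h6 ihm ⊢
        rw [quasiShuffle_cons_cons_cons f g h, quasiShuffle_cons_cons_cons g h f, h1, h2, h3, h4,
          h5, h6, ihm, mul_comm h f, mul_comm g f, mul_comm (g * h) f, mul_assoc f g h]
        abel

theorem quasiShuffle_assoc : IsAssoc (quasiShuffle A) := by
  intro U V W
  rw [quasiShuffle_comm U (quasiShuffle A V W)]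
  -- The identity is extended from words to arbitrary elements in one variable at a time.
  have h : ∀ l m : List A, (quasiShuffle A).flip (word m) ∘ₗ (quasiShuffle A).flip (word l) =
      quasiShuffle A (quasiShuffle A (word l) (word m)) := fun l m =>
    linearMap_ext_word fun k => quasiShuffle_word_rotate k l m
  have h3 : ∀ m : List A, (quasiShuffle A).flip (word m) ∘ₗ quasiShuffle A U =
      (quasiShuffle A).flip U ∘ₗ (quasiShuffle A).flip (word m) := fun m =>
    linearMap_ext_word fun l => LinearMap.congr_fun (h l m) U
  have h4 : quasiShuffle A (quasiShuffle A U V) =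
      (quasiShuffle A).flip U ∘ₗ quasiShuffle A V :=
    linearMap_ext_word fun m => LinearMap.congr_fun (h3 m) V
  exact LinearMap.congr_fun h4 W

/-! #### The Nijenhuis algebra of nonempty words -/

theorem prependOne_tmul (f : A) (U : TensorAlgebra ℂ A) :
    prependOne A (f ⊗ₜ U) = 1 ⊗ₜ letterCons A f U := by
  simp [prependOne]

theorem wordProduct_comm (x y : NonemptyWords A) : wordProduct A x y = wordProduct A y x := by
  have : wordProduct A = (wordProduct A).flip := by
    ext f U g V
    simp [wordProduct_tmul, mul_comm, quasiShuffle_comm]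
  exact LinearMap.congr_fun₂ this x y

theorem wordProduct_assoc : IsAssoc (wordProduct A) := by
  intro x y z
  induction x using TensorProduct.induction_on with
  | zero => simp
  | add x x' hx hx' => simp only [map_add, LinearMap.add_apply, hx, hx']
  | tmul f U =>
    induction y using TensorProduct.induction_on with
    | zero => simp
    | add x x' hx hx' => simp only [map_add, LinearMap.add_apply, hx, hx']
    | tmul g V =>
      induction z using TensorProduct.induction_on with
      | zero => simp
      | add x x' hx hx' => simp only [map_add, hx, hx']
      | tmul h W => simp only [wordProduct_tmul, mul_assoc, quasiShuffle_assoc U V W]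

theorem wordProduct_unit : IsUnitOf (wordProduct A) (1 ⊗ₜ 1) := by
  have h : ∀ x, wordProduct A (1 ⊗ₜ 1) x = x := by
    intro x
    induction x using TensorProduct.induction_on with
    | zero => simp
    | add x x' hx hx' => simp only [map_add, hx, hx']
    | tmul f U => rw [wordProduct_tmul, one_mul, quasiShuffle_one_left]
  exact fun x => ⟨h x, (wordProduct_comm _ _).trans (h x)⟩

/-- On words x = fU and y = gV the left side is the letter 1 followed by fU ⊚ gV, and the three
terms of the recursion of ⊚ are the three terms of the Nijenhuis relation. -/
theorem isNijenhuis_prependOne : IsNijenhuis (wordProduct A) (prependOne A) := by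
  intro x y
  induction x using TensorProduct.induction_on with
  | zero => simp
  | add x x' hx hx' =>
    simp only [map_add, map_sub, LinearMap.add_apply] at hx hx' ⊢
    rw [hx, hx']; abel
  | tmul f U =>
    induction y using TensorProduct.induction_on with
    | zero => simp
    | add x x' hx hx' =>
      simp only [map_add, map_sub] at hx hx' ⊢
      rw [hx, hx']; abel
    | tmul g V =>
      simp only [prependOne_tmul, wordProduct_tmul, map_add, map_sub, one_mul, mul_one,
        quasiShuffle_cons_cons, TensorProduct.tmul_add, TensorProduct.tmul_sub]
      abel

-- The homomorphism to another Nijenhuis algebra.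

section Universal

variable {B : Type} [CommRing B] [Algebra ℂ B] (N : B →ₗ[ℂ] B) (φ : A →ₐ[ℂ] B)

/-- The map `f₁ ⋯ fₖ ↦ N (φ f₁ * N (φ f₂ * ⋯))` on words. -/
noncomputable def iteratedNijenhuis : TensorAlgebra ℂ A →ₗ[ℂ] B :=
  LinearMap.applyₗ (1 : B) ∘ₗ (TensorAlgebra.lift ℂ
    ((LinearMap.llcomp ℂ B B B N) ∘ₗ LinearMap.mul ℂ B ∘ₗ φ.toLinearMap)).toLinearMap

theorem iteratedNijenhuis_one : iteratedNijenhuis N φ 1 = 1 := by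
  simp [iteratedNijenhuis]

theorem iteratedNijenhuis_cons (f : A) (U : TensorAlgebra ℂ A) :
    iteratedNijenhuis N φ (letterCons A f U) = N (φ f * iteratedNijenhuis N φ U) := by
  simp [iteratedNijenhuis, letterCons]

variable {N} in
-- Induction on both words: the recursion of ⊚ is carried to the Nijenhuis relation for N. The term
-- with the extra letter 1 becomes N applied twice because φ(1) = 1.
theorem iteratedNijenhuis_quasiShuffle (hN : IsNijenhuis (LinearMap.mul ℂ B) N)
    (U V : TensorAlgebra ℂ A) :
    iteratedNijenhuis N φ (quasiShuffle A U V) =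
      iteratedNijenhuis N φ U * iteratedNijenhuis N φ V := by
  have key : ∀ k l : List A, iteratedNijenhuis N φ (quasiShuffle A (word k) (word l)) =
      iteratedNijenhuis N φ (word k) * iteratedNijenhuis N φ (word l) := by
    intro k l
    have hnil : word ([] : List A) = 1 := rfl
    induction k generalizing l with
    | nil => rw [hnil, quasiShuffle_one_left, iteratedNijenhuis_one, one_mul]
    | cons f k ihk =>
      induction l with
      | nil => rw [hnil, quasiShuffle_one_right, iteratedNijenhuis_one, mul_one]
      | cons g l ihl =>
        have h1 := ihk (g :: l)
        have h2 := ihk l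
        have h3 := hN (φ f * iteratedNijenhuis N φ (word k)) (φ g * iteratedNijenhuis N φ (word l))
        simp only [word_cons, LinearMap.mul_apply'] at h1 h3 ihl ⊢
        rw [quasiShuffle_cons_cons]
        simp only [map_add, map_sub, iteratedNijenhuis_cons, h1, ihl, h2, h3, map_mul, map_one,
          one_mul]
        rw [add_comm]
        simp only [mul_assoc, mul_left_comm (φ g)]
  have h1 : ∀ k, iteratedNijenhuis N φ ∘ₗ quasiShuffle A (word k) =
      LinearMap.mul ℂ B (iteratedNijenhuis N φ (word k)) ∘ₗ iteratedNijenhuis N φ := fun k =>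
    linearMap_ext_word fun l => key k l
  have h2 : iteratedNijenhuis N φ ∘ₗ (quasiShuffle A).flip V =
      (LinearMap.mul ℂ B).flip (iteratedNijenhuis N φ V) ∘ₗ iteratedNijenhuis N φ :=
    linearMap_ext_word fun k => LinearMap.congr_fun (h1 k) V
  exact LinearMap.congr_fun h2 U

end Universal

/-- The map is forced by two identities: f ⊗ U is the product of f ⊗ 1 and 1 ⊗ U, and 1 ⊗ fU is
obtained from f ⊗ U by prepending 1. Existence is multiplicativity of φ and of `iteratedNijenhuis`
on the two tensor factors. -/
theorem isUniversalNijenhuisAlgebra (A : Type) [CommRing A] [Algebra ℂ A] :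
    IsUniversalNijenhuisAlgebra A where
  comm := wordProduct_comm
  assoc := wordProduct_assoc
  unit := wordProduct_unit
  nijenhuis := isNijenhuis_prependOne
  universal B _ _ N hN φ := by
    have hF : ∀ f U, TensorProduct.lift ((LinearMap.mul ℂ B).compl₁₂ φ.toLinearMap
        (iteratedNijenhuis N φ)) (f ⊗ₜ U) = φ f * iteratedNijenhuis N φ U := fun f U => by simp
    refine ⟨TensorProduct.lift ((LinearMap.mul ℂ B).compl₁₂ φ.toLinearMap
      (iteratedNijenhuis N φ)), ⟨fun x y => ?_, fun x => ?_, fun a => ?_⟩, fun G hG => ?_⟩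
    · induction x using TensorProduct.induction_on with
      | zero => simp
      | add x x' hx hx' => simp only [map_add, LinearMap.add_apply, hx, hx', add_mul]
      | tmul f U =>
        induction y using TensorProduct.induction_on with
        | zero => simp
        | add x x' hx hx' => simp only [map_add, hx, hx', mul_add]
        | tmul g V =>
          rw [wordProduct_tmul, hF, hF, hF, iteratedNijenhuis_quasiShuffle φ hN, map_mul]
          ring
    · induction x using TensorProduct.induction_on with
      | zero => simp
      | add x x' hx hx' => simp only [map_add, hx, hx']
      | tmul f U => rw [prependOne_tmul, hF, hF, map_one, one_mul, iteratedNijenhuis_cons]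
    · rw [hF, iteratedNijenhuis_one, mul_one]
    · obtain ⟨hmul, hpre, hone⟩ := hG
      have h1 : G ∘ₗ TensorProduct.mk ℂ A (TensorAlgebra ℂ A) 1 = iteratedNijenhuis N φ := by
        refine linearMap_ext_word fun l => ?_
        induction l with
        | nil => exact (hone 1).trans ((map_one φ).trans (iteratedNijenhuis_one N φ).symm)
        | cons f l ih =>
          have h2 : f ⊗ₜ[ℂ] word l = wordProduct A (f ⊗ₜ 1) (1 ⊗ₜ word l) := by
            rw [wordProduct_tmul, mul_one, quasiShuffle_one_left]
          simp only [LinearMap.comp_apply, TensorProduct.mk_apply] at ih ⊢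
          rw [word_cons, ← prependOne_tmul, hpre, iteratedNijenhuis_cons, h2, hmul, hone, ih]
      refine TensorProduct.ext' fun f U => ?_
      rw [hF, ← h1]
      have h2 : f ⊗ₜ[ℂ] U = wordProduct A (f ⊗ₜ 1) (1 ⊗ₜ U) := by
        rw [wordProduct_tmul, mul_one, quasiShuffle_one_left]
      rw [h2, hmul, hone]
      rfl

theorem algebraMapInv_letterCons (f : A) (U : TensorAlgebra ℂ A) :
    TensorAlgebra.algebraMapInv (letterCons A f U) = 0 := by
  simp [letterCons_apply, TensorAlgebra.algebraMapInv]

/-- Every term of a quasi-shuffle with a nonempty word begins with a letter, so the empty word does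
not occur. -/
theorem algebraMapInv_quasiShuffle_letter (U : TensorAlgebra ℂ A) (f : A) :
    TensorAlgebra.algebraMapInv (quasiShuffle A U (letterCons A f 1)) = 0 := by
  have : TensorAlgebra.algebraMapInv.toLinearMap ∘ₗ (quasiShuffle A).flip (letterCons A f 1) = 0 := by
    refine linearMap_ext_word fun l => ?_
    cases l with
    | nil =>
      change TensorAlgebra.algebraMapInv (quasiShuffle A 1 _) = 0
      rw [quasiShuffle_one_left, algebraMapInv_letterCons]
    | cons g l =>
      change TensorAlgebra.algebraMapInv (quasiShuffle A (letterCons A g (word l)) _) = 0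
      rw [quasiShuffle_cons_cons, map_sub, map_add, algebraMapInv_letterCons,
        algebraMapInv_letterCons, algebraMapInv_letterCons]
      simp
  exact LinearMap.congr_fun this U

/-- The product deformed by `prependOne` has no unit, since the words in a deformed product with
the unit of `⊘` have at least two letters. -/
theorem not_exists_isUnitOf_prependOne [Nontrivial A] :
    ¬ ∃ e, IsUnitOf (deformedProduct (wordProduct A) (prependOne A)) e := by
  rintro ⟨e, he⟩
  -- Tested on the unit of ⊘, the deformed product collapses to e ⊘ B(1), where B prepends the
  -- letter 1.
  have h1 := (he (1 ⊗ₜ 1)).1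
  rw [deformedProduct_apply, (wordProduct_unit (A := A) _).2, (wordProduct_unit (A := A) _).2,
    add_sub_cancel_left, prependOne_tmul] at h1
  -- The one-letter component: it is 1 on the unit of ⊘ and 0 on every product with B(1).
  let aug : NonemptyWords A →ₗ[ℂ] A := (TensorProduct.rid ℂ A).toLinearMap ∘ₗ
    TensorProduct.map LinearMap.id TensorAlgebra.algebraMapInv.toLinearMap
  have h2 : ∀ x : NonemptyWords A, aug (wordProduct A x (1 ⊗ₜ letterCons A 1 1)) = 0 := by
    intro x
    induction x using TensorProduct.induction_on with
    | zero => simp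
    | add x x' hx hx' => simp only [map_add, LinearMap.add_apply, hx, hx', add_zero]
    | tmul f U =>
      rw [wordProduct_tmul]
      simp [aug, algebraMapInv_quasiShuffle_letter]
  have h3 := h2 e
  rw [h1] at h3
  simp [aug] at h3

theorem prependOne_one_ne_zero [Nontrivial A] :
    prependOne A (1 ⊗ₜ[ℂ] (1 : TensorAlgebra ℂ A)) ≠ 0 := by
  intro h
  rw [prependOne_tmul] at h
  have h1 := congrArg (TensorProduct.lift ((LinearMap.mul ℂ A).compl₂ TensorAlgebra.ιInv)) h
  rw [letterCons_apply, mul_one] at h1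
  simp [TensorAlgebra.ι_leftInverse (1 : A)] at h1

theorem universalNijenhuisModel {H : Type} [Ring H] [Algebra ℂ H] {Δ : H →ₐ[ℂ] H ⊗[ℂ] H}
    {ε : H →ₐ[ℂ] ℂ} (hH : IsHopfAlgebra Δ ε) (hnc : NonCocommutative Δ) [Nontrivial A] :
    UniversalNijenhuisModel A Δ ε := by
  refine ⟨isUniversalNijenhuisAlgebra A, isAssoc_convolution hH.coassoc wordProduct_assoc,
    isUnitOf_convolution (Δ := Δ.toLinearMap) (ε := ε.toLinearMap) hH.counit_left hH.counit_right
      wordProduct_unit,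
    nijenhuisSymplecticModel_convolution hH hnc wordProduct_assoc isNijenhuis_prependOne
      (b := 1 ⊗ₜ 1) ?_, ?_⟩
  · rw [deformedProduct_apply, (wordProduct_unit (A := A) _).1, (wordProduct_unit (A := A) _).1,
      (wordProduct_unit (A := A) _).2, add_sub_cancel_right]
    exact prependOne_one_ne_zero
  · rw [deformedProduct_convolution, exists_isUnitOf_convolution_iff hH]
    exact not_exists_isUnitOf_prependOne

end Words

theorem symplecticModels {H : Type} [Ring H] [Algebra ℂ H] {Δ : H →ₐ[ℂ] H ⊗[ℂ] H}
    {ε : H →ₐ[ℂ] ℂ} (hH : IsHopfAlgebra Δ ε) (hnc : NonCocommutative Δ) :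
    SymplecticModels Δ ε :=
  fun _ hA => ⟨rotaBaxterModel hA hH hnc, universalNijenhuisModel hH hnc⟩

/-! ### Isomorphisms of decorated trees -/

namespace DTree

variable {D : Type}

theorem induction_on {P : DTree D → Prop} (h : ∀ d F, (∀ t ∈ F, P t) → P (node d F))
    (t : DTree D) : P t :=
  DTree.rec (motive_1 := P) (motive_2 := fun F => ∀ t ∈ F, P t) h (by simp)
    (fun _ _ h1 h2 s hs => by
      rcases List.mem_cons.mp hs with rfl | hs
      · exact h1
      · exact h2 s hs) t

/-- Equality of forests up to the order of the trees and of the branches at all vertices. -/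
inductive ForestEquiv : List (DTree D) → List (DTree D) → Prop
  | nil : ForestEquiv [] []
  | cons (d : D) {F F' G G' : List (DTree D)} : ForestEquiv F F' → ForestEquiv G G' →
      ForestEquiv (node d F :: G) (node d F' :: G')
  | swap (s t : DTree D) (F : List (DTree D)) : ForestEquiv (s :: t :: F) (t :: s :: F)
  | trans {F G K : List (DTree D)} : ForestEquiv F G → ForestEquiv G K → ForestEquiv F K

namespace ForestEquiv

theorem refl (F : List (DTree D)) : ForestEquiv F F := by
  have h : ∀ t : DTree D, ∀ G, ForestEquiv G G → ForestEquiv (t :: G) (t :: G) := by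
    intro t
    induction t using DTree.induction_on with
    | h d F ih =>
      intro G hG
      refine ForestEquiv.cons d ?_ hG
      clear hG
      induction F with
      | nil => exact ForestEquiv.nil
      | cons s F ihF =>
        exact ih s List.mem_cons_self F (ihF fun t ht => ih t (List.mem_cons_of_mem _ ht))
  induction F with
  | nil => exact ForestEquiv.nil
  | cons t F ih => exact h t F ih

theorem symm {F G : List (DTree D)} (h : ForestEquiv F G) : ForestEquiv G F := by
  induction h with
  | nil => exact ForestEquiv.nil
  | cons d _ _ h1 h2 => exact ForestEquiv.cons d h1 h2
  | swap s t F => exact ForestEquiv.swap t s F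
  | trans _ _ h1 h2 => exact h2.trans h1

theorem cons_same (t : DTree D) {F G : List (DTree D)} (h : ForestEquiv F G) :
    ForestEquiv (t :: F) (t :: G) := by
  cases t with
  | node d K => exact ForestEquiv.cons d (refl K) h

theorem append_right {F F' : List (DTree D)} (h : ForestEquiv F F') (G : List (DTree D)) :
    ForestEquiv (F ++ G) (F' ++ G) := by
  induction h with
  | nil => exact refl G
  | cons d h1 _ _ h2 => exact ForestEquiv.cons d h1 h2
  | swap s t F => exact ForestEquiv.swap s t (F ++ G)
  | trans _ _ h1 h2 => exact h1.trans h2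

theorem cons_of_singleton {s t : DTree D} (h : ForestEquiv [s] [t]) {F G : List (DTree D)}
    (hFG : ForestEquiv F G) : ForestEquiv (s :: F) (t :: G) :=
  (h.append_right F).trans (cons_same t hFG)

theorem of_perm {F G : List (DTree D)} (h : F.Perm G) : ForestEquiv F G := by
  induction h with
  | nil => exact ForestEquiv.nil
  | cons t _ ih => exact cons_same t ih
  | swap s t F => exact ForestEquiv.swap t s F
  | trans _ _ h1 h2 => exact h1.trans h2

theorem ofFn {n : ℕ} {s t : Fin n → DTree D} (h : ∀ i, ForestEquiv [s i] [t i]) :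
    ForestEquiv (List.ofFn s) (List.ofFn t) := by
  induction n with
  | zero => simpa using ForestEquiv.nil
  | succ n ih =>
    rw [List.ofFn_succ, List.ofFn_succ]
    exact cons_of_singleton (h 0) (ih fun i => h i.succ)

end ForestEquiv

/-! #### Vertices by address -/

/-- The decoration of the vertex with a given address, if there is one. -/
def lookup : List ℕ → DTree D → Option D
  | [], node d _ => some d
  | i :: a, node _ F => F[i]?.bind (fun t => lookup a t)

theorem lookup_nil (d : D) (F : List (DTree D)) : lookup [] (node d F) = some d := rfl

theorem lookup_cons (i : ℕ) (a : List ℕ) (d : D) (F : List (DTree D)) :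
    lookup (i :: a) (node d F) = F[i]?.bind (fun t => lookup a t) := rfl

/-- The hypothesis on the branches lets this serve inside the induction that proves `mem_vertices`;
afterwards that theorem discharges it. -/
theorem mem_forestVertices {F : List (DTree D)}
    (h : ∀ t ∈ F, ∀ a d, (a, d) ∈ vertices t ↔ lookup a t = some d) (k : ℕ) (a : List ℕ) (d : D) :
    (a, d) ∈ forestVertices k F ↔
      ∃ i b, a = (k + i) :: b ∧ F[i]?.bind (fun t => lookup b t) = some d := by
  induction F generalizing k with
  | nil => simp [forestVertices]
  | cons t F ih =>
    rw [forestVertices, List.mem_append, ih fun t ht => h t (List.mem_cons_of_mem _ ht)]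
    constructor
    · rintro (h1 | ⟨i, b, rfl, hb⟩)
      · obtain ⟨⟨b, d'⟩, hb, hbd⟩ := List.mem_map.mp h1
        simp only [Prod.mk.injEq] at hbd
        obtain ⟨rfl, rfl⟩ := hbd
        exact ⟨0, b, by simp, by simpa using (h t List.mem_cons_self b d').mp hb⟩
      · exact ⟨i + 1, b, by rw [add_assoc, add_comm 1], by simpa using hb⟩
    · rintro ⟨i, b, rfl, hb⟩
      cases i with
      | zero =>
        refine Or.inl (List.mem_map.mpr ⟨(b, d), ?_, rfl⟩)
        exact (h t List.mem_cons_self b d).mpr (by simpa using hb)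
      | succ i => exact Or.inr ⟨i, b, by rw [add_assoc, add_comm 1], by simpa using hb⟩

theorem mem_vertices (t : DTree D) (a : List ℕ) (d : D) :
    (a, d) ∈ vertices t ↔ lookup a t = some d := by
  induction t using DTree.induction_on generalizing a d with
  | h e F ih =>
    rw [vertices, List.mem_cons, mem_forestVertices ih]
    cases a with
    | nil => simp [lookup_nil, eq_comm]
    | cons i a => simp [lookup_cons]

theorem nodup_forestVertices {F : List (DTree D)}
    (h : ∀ t ∈ F, ((vertices t).map Prod.fst).Nodup) (k : ℕ) :
    ((forestVertices k F).map Prod.fst).Nodup := by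
  induction F generalizing k with
  | nil => simp [forestVertices]
  | cons t F ih =>
    rw [forestVertices, List.map_append, List.nodup_append]
    refine ⟨?_, ih (fun t ht => h t (List.mem_cons_of_mem _ ht)) _, ?_⟩
    · have := (h t List.mem_cons_self).map (f := fun a => k :: a) (fun a b hab => by simpa using hab)
      simpa [List.map_map, Function.comp_def] using this
    · intro a ha b hb hab
      subst hab
      obtain ⟨⟨b, d⟩, hbd, rfl⟩ := List.mem_map.mp hb
      rw [mem_forestVertices fun t _ => mem_vertices t] at hbd
      obtain ⟨i, c, rfl, -⟩ := hbd
      simp at ha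
      omega

theorem nodup_vertices (t : DTree D) : ((vertices t).map Prod.fst).Nodup := by
  induction t using DTree.induction_on with
  | h d F ih =>
    rw [vertices, List.map_cons, List.nodup_cons]
    refine ⟨fun h => ?_, nodup_forestVertices ih 0⟩
    obtain ⟨⟨b, e⟩, hb, hb'⟩ := List.mem_map.mp h
    rw [mem_forestVertices fun t _ => mem_vertices t] at hb
    obtain ⟨i, c, rfl, -⟩ := hb
    simp at hb'

theorem lookup_of_append (t : DTree D) {a b : List ℕ} {d : D} (h : lookup (a ++ b) t = some d) :
    ∃ e, lookup a t = some e := by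
  induction a generalizing t with
  | nil => cases t with | node e F => exact ⟨e, rfl⟩
  | cons i a ih =>
    cases t with
    | node e F =>
      rw [List.cons_append, lookup_cons, Option.bind_eq_some_iff] at h
      obtain ⟨s, hs, h⟩ := h
      obtain ⟨e, he⟩ := ih s h
      exact ⟨e, by rw [lookup_cons, hs]; exact he⟩

/-- The number of vertices. -/
abbrev size (t : DTree D) : ℕ := t.vertices.length

/-- The address of a vertex. -/
def addr (t : DTree D) (i : Fin t.size) : List ℕ := (t.vertices.get i).1

/-- The decoration of a vertex. -/
def dec (t : DTree D) (i : Fin t.size) : D := (t.vertices.get i).2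

theorem addr_injective (t : DTree D) : Function.Injective t.addr := by
  intro i j h
  have h1 := (List.nodup_iff_injective_get.mp t.nodup_vertices)
    (a₁ := i.cast (List.length_map _).symm) (a₂ := j.cast (List.length_map _).symm)
    (by simpa [addr] using h)
  exact Fin.ext (by simpa [Fin.ext_iff] using h1)

theorem lookup_eq_some_iff (t : DTree D) (a : List ℕ) (d : D) :
    lookup a t = some d ↔ ∃ i, t.addr i = a ∧ t.dec i = d := by
  rw [← mem_vertices, List.mem_iff_get]
  simp only [Prod.ext_iff]
  rfl

/-- The relation between a vertex and its children. -/
def Edge (t : DTree D) (i j : Fin t.size) : Prop := ∃ k : ℕ, t.addr j = t.addr i ++ [k]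

/-- Isomorphisms of the vertex sets of trees. -/
structure IsVertexIso (s t : DTree D) (σ : Fin s.size ≃ Fin t.size) : Prop where
  dec : ∀ i, t.dec (σ i) = s.dec i
  edge : ∀ i j, t.Edge (σ i) (σ j) ↔ s.Edge i j

/-! #### Equivalent forests have isomorphic vertex sets -/

/-- The decoration of the vertex of a forest with a given nonempty address. -/
def forestLookup (F : List (DTree D)) : List ℕ → Option D
  | [] => none
  | i :: a => F[i]?.bind (fun t => lookup a t)

/-- Embeddings of the tree of all addresses into itself. -/
structure IsAddressEmbedding (e : List ℕ → List ℕ) : Prop where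
  injective : Function.Injective e
  nil : e [] = []
  append : ∀ a k, ∃ k', e (a ++ [k]) = e a ++ [k']

/-- An embedding preserves the parent of every nonempty address; injectivity makes the converse hold
as well. -/
theorem IsAddressEmbedding.edge_iff {e : List ℕ → List ℕ} (he : IsAddressEmbedding e)
    (a b : List ℕ) : (∃ k, e b = e a ++ [k]) ↔ ∃ k, b = a ++ [k] := by
  constructor
  · rintro ⟨k, hk⟩
    rcases List.eq_nil_or_concat b with rfl | ⟨b', l, rfl⟩
    · rw [he.nil] at hk
      simp at hk
    · obtain ⟨l', hl⟩ := he.append b' l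
      rw [List.concat_eq_append, hl] at hk
      have := he.injective (List.append_inj' hk rfl).1
      exact ⟨l, by rw [this, List.concat_eq_append]⟩
  · rintro ⟨k, rfl⟩
    exact he.append a k

theorem IsAddressEmbedding.comp {e e' : List ℕ → List ℕ} (he : IsAddressEmbedding e)
    (he' : IsAddressEmbedding e') : IsAddressEmbedding (e' ∘ e) where
  injective := he'.injective.comp he.injective
  nil := by simp [he.nil, he'.nil]
  append a k := by
    obtain ⟨k', h⟩ := he.append a k
    obtain ⟨k'', h'⟩ := he'.append (e a) k'
    exact ⟨k'', by simp [h, h']⟩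

/-- Addition of `1` to the first entry of an address. -/
def shift : List ℕ → List ℕ
  | [] => []
  | i :: a => (i + 1) :: a

/-- The embedding that acts by `e` on the addresses in the first tree of a forest, and by `e'` on
the addresses in the remaining trees. -/
def consEmbedding (e e' : List ℕ → List ℕ) : List ℕ → List ℕ
  | [] => []
  | 0 :: a => 0 :: e a
  | (i + 1) :: a => shift (e' (i :: a))

theorem IsAddressEmbedding.exists_cons {e : List ℕ → List ℕ} (he : IsAddressEmbedding e)
    (i : ℕ) (a : List ℕ) : ∃ j b, e (i :: a) = j :: b := by
  cases h : e (i :: a) with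
  | nil => simpa using he.injective (h.trans he.nil.symm)
  | cons j b => exact ⟨j, b, rfl⟩

theorem isAddressEmbedding_consEmbedding {e e' : List ℕ → List ℕ} (he : IsAddressEmbedding e)
    (he' : IsAddressEmbedding e') : IsAddressEmbedding (consEmbedding e e') where
  injective := by
    intro a b h
    match a, b, h with
    | [], [], _ => rfl
    | [], 0 :: b, h => simp [consEmbedding] at h
    | 0 :: a, [], h => simp [consEmbedding] at h
    | [], (i + 1) :: b, h =>
      obtain ⟨j, c, hc⟩ := he'.exists_cons i b
      simp [consEmbedding, hc, shift] at h
    | (i + 1) :: b, [], h =>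
      obtain ⟨j, c, hc⟩ := he'.exists_cons i b
      simp [consEmbedding, hc, shift] at h
    | 0 :: a, 0 :: b, h =>
      simp only [consEmbedding, List.cons.injEq, true_and] at h
      rw [he.injective h]
    | 0 :: a, (i + 1) :: b, h =>
      obtain ⟨j, c, hc⟩ := he'.exists_cons i b
      simp [consEmbedding, hc, shift] at h
    | (i + 1) :: b, 0 :: a, h =>
      obtain ⟨j, c, hc⟩ := he'.exists_cons i b
      simp [consEmbedding, hc, shift] at h
    | (i + 1) :: a, (j + 1) :: b, h =>
      obtain ⟨k, c, hc⟩ := he'.exists_cons i a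
      obtain ⟨l, c', hc'⟩ := he'.exists_cons j b
      simp only [consEmbedding, hc, hc', shift, List.cons.injEq, Nat.add_right_cancel_iff] at h
      have := he'.injective (hc.trans ((congrArg₂ List.cons h.1 h.2).trans hc'.symm))
      simpa using this
  nil := rfl
  append := by
    intro a k
    match a with
    | [] =>
      cases k with
      | zero => exact ⟨0, by simp [consEmbedding, he.nil]⟩
      | succ k =>
        obtain ⟨l, hl⟩ := he'.append [] k
        rw [he'.nil] at hl
        exact ⟨l + 1, by simpa [consEmbedding, shift] using congrArg shift hl⟩
    | 0 :: a =>
      obtain ⟨l, hl⟩ := he.append a k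
      exact ⟨l, by simp [consEmbedding, hl]⟩
    | (i + 1) :: a =>
      obtain ⟨l, hl⟩ := he'.append (i :: a) k
      obtain ⟨j, b, hb⟩ := he'.exists_cons i a
      refine ⟨l, ?_⟩
      rw [List.cons_append] at hl ⊢
      simp [consEmbedding, hl, hb, shift]

/-- The exchange of the first two trees of a forest. -/
def swapEmbedding : List ℕ → List ℕ
  | [] => []
  | i :: a => Equiv.swap 0 1 i :: a

theorem isAddressEmbedding_swapEmbedding : IsAddressEmbedding swapEmbedding where
  injective a b h := by
    match a, b, h with
    | [], [], _ => rfl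
    | [], j :: b, h => simp [swapEmbedding] at h
    | i :: a, [], h => simp [swapEmbedding] at h
    | i :: a, j :: b, h =>
      simp only [swapEmbedding, List.cons.injEq, EmbeddingLike.apply_eq_iff_eq] at h
      rw [h.1, h.2]
  nil := rfl
  append a k := by
    cases a with
    | nil => exact ⟨Equiv.swap 0 1 k, rfl⟩
    | cons i a => exact ⟨k, rfl⟩

/-- Each rule of the equivalence acts on addresses. Embeddings of the tree of all addresses, rather
than bijections of vertex sets, compose under transitivity without reference to the forest in
between. -/
theorem ForestEquiv.exists_embedding {F G : List (DTree D)} (h : ForestEquiv F G) :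
    ∃ e, IsAddressEmbedding e ∧ ∀ a, forestLookup G (e a) = forestLookup F a := by
  induction h with
  | nil => exact ⟨id, ⟨Function.injective_id, rfl, fun a k => ⟨k, rfl⟩⟩, fun a => rfl⟩
  | @cons d F F' G G' _ _ h1 h2 =>
    obtain ⟨e, he, hl⟩ := h1
    obtain ⟨e', he', hl'⟩ := h2
    refine ⟨consEmbedding e e', isAddressEmbedding_consEmbedding he he', fun a => ?_⟩
    match a with
    | [] => rfl
    | 0 :: a =>
      cases a with
      | nil => simp [consEmbedding, forestLookup, he.nil, lookup_nil]
      | cons j a =>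
        obtain ⟨k, b, hb⟩ := he.exists_cons j a
        have := hl (j :: a)
        rw [hb] at this
        simpa [consEmbedding, forestLookup, hb, lookup_cons] using this
    | (i + 1) :: a =>
      obtain ⟨k, b, hb⟩ := he'.exists_cons i a
      have := hl' (i :: a)
      rw [hb] at this
      simpa [consEmbedding, forestLookup, hb, shift] using this
  | swap s t F =>
    refine ⟨swapEmbedding, isAddressEmbedding_swapEmbedding, fun a => ?_⟩
    match a with
    | [] => rfl
    | 0 :: a => simp [swapEmbedding, forestLookup]
    | 1 :: a => simp [swapEmbedding, forestLookup]
    | (i + 2) :: a =>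
      rw [swapEmbedding, Equiv.swap_apply_of_ne_of_ne (by omega) (by omega)]
      simp [forestLookup]
  | trans _ _ h1 h2 =>
    obtain ⟨e, he, hl⟩ := h1
    obtain ⟨e', he', hl'⟩ := h2
    exact ⟨e' ∘ e, he.comp he', fun a => by simp [hl, hl']⟩

theorem ForestEquiv.exists_injection {F G : List (DTree D)} (h : ForestEquiv F G) (d : D) :
    ∃ f : Fin (node d F).size → Fin (node d G).size, Function.Injective f ∧
      (∀ i, (node d G).dec (f i) = (node d F).dec i) ∧
      ∀ i j, (node d G).Edge (f i) (f j) ↔ (node d F).Edge i j := by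
  obtain ⟨e, he, hl⟩ := h.exists_embedding
  have hl' : ∀ a, lookup (e a) (node d G) = lookup a (node d F) := by
    intro a
    cases a with
    | nil => rw [he.nil]; rfl
    | cons i a =>
      obtain ⟨k, b, hb⟩ := he.exists_cons i a
      have := hl (i :: a)
      rw [hb] at this ⊢
      exact this
  have hf : ∀ i, ∃ j, (node d G).addr j = e ((node d F).addr i) ∧
      (node d G).dec j = (node d F).dec i := fun i => by
    rw [← lookup_eq_some_iff, hl', lookup_eq_some_iff]
    exact ⟨i, rfl, rfl⟩
  choose f hf1 hf2 using hf
  refine ⟨f, fun i j hij => ?_, hf2, fun i j => ?_⟩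
  · apply (node d F).addr_injective
    apply he.injective
    rw [← hf1, ← hf1, hij]
  · rw [Edge, Edge, hf1, hf1, he.edge_iff]

/-- The equivalence is symmetric, so there are injections both ways; finiteness makes the first one
bijective. -/
theorem ForestEquiv.exists_isVertexIso {F G : List (DTree D)} (h : ForestEquiv F G) (d : D) :
    ∃ σ, IsVertexIso (node d F) (node d G) σ := by
  obtain ⟨f, hf, hd, he⟩ := h.exists_injection d
  obtain ⟨g, hg, -, -⟩ := h.symm.exists_injection d
  have hcard : Fintype.card (Fin (node d F).size) = Fintype.card (Fin (node d G).size) :=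
    le_antisymm (Fintype.card_le_of_injective f hf) (Fintype.card_le_of_injective g hg)
  exact ⟨Equiv.ofBijective f ((Fintype.bijective_iff_injective_and_card f).mpr ⟨hf, hcard⟩),
    hd, he⟩

/-! #### Trees with isomorphic vertex sets are equivalent -/

/-- The unfolding of a directed graph with decorated vertices at the vertex `x` is the given
tree. -/
inductive Unfolds {X : Type} (δ : X → D) (E : X → X → Prop) : X → DTree D → Prop
  | node (x : X) {n : ℕ} (v : Fin n → X) (s : Fin n → DTree D) : Function.Injective v →
      (∀ y, E x y ↔ ∃ i, v i = y) → (∀ i, Unfolds δ E (v i) (s i)) →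
      Unfolds δ E x (node (δ x) (List.ofFn s))

theorem Unfolds.map {X Y : Type} {δ : X → D} {E : X → X → Prop} {δ' : Y → D}
    {E' : Y → Y → Prop} (σ : X ≃ Y) (hδ : ∀ x, δ' (σ x) = δ x)
    (hE : ∀ x y, E' (σ x) (σ y) ↔ E x y) {x : X} {t : DTree D} (h : Unfolds δ E x t) :
    Unfolds δ' E' (σ x) t := by
  induction h with
  | node x v s hv hy _ ih =>
    rw [← hδ]
    refine Unfolds.node (σ x) (σ ∘ v) s (σ.injective.comp hv) (fun y => ?_) ih
    obtain ⟨y, rfl⟩ := σ.surjective y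
    rw [hE, hy]
    simp

/-- Two unfoldings at x enumerate the same set of children without repetition, so they differ by a
permutation π, and by induction the branches correspond under π. -/
theorem Unfolds.forestEquiv {X : Type} {δ : X → D} {E : X → X → Prop} {x : X} {s t : DTree D}
    (hs : Unfolds δ E x s) (ht : Unfolds δ E x t) : ForestEquiv [s] [t] := by
  induction hs generalizing t with
  | @node x n v s hv hy _ ih =>
    obtain ⟨_, v', s', hv', hy', hs'⟩ := ht
    rename_i n'
    have h1 : ∀ i, ∃ j, v' j = v i := fun i => (hy' _).mp ((hy _).mpr ⟨i, rfl⟩)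
    have h2 : ∀ j, ∃ i, v i = v' j := fun j => (hy _).mp ((hy' _).mpr ⟨j, rfl⟩)
    choose f hf using h1
    choose g hg using h2
    let π : Fin n ≃ Fin n' := ⟨f, g, fun i => hv (by rw [hg, hf]), fun j => hv' (by rw [hf, hg])⟩
    obtain rfl : n = n' := by simpa using Fintype.card_congr π
    refine ForestEquiv.cons _ (ForestEquiv.trans (ForestEquiv.ofFn (t := s' ∘ π) fun i => ?_)
      (ForestEquiv.of_perm (Equiv.Perm.ofFn_comp_perm π s'))) ForestEquiv.nil
    refine ih i ?_
    have := hs' (f i)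
    rwa [hf] at this

/-- Generalized to the subtree at an address p of a fixed vertex set, whose children sit at p ++
[i]; this is the form in which the induction on the tree closes. -/
theorem unfolds_of_addr {X : Type} {δ : X → D} {E : X → X → Prop} {α : X → List ℕ}
    (hα : Function.Injective α) (hE : ∀ x y, E x y ↔ ∃ k, α y = α x ++ [k]) (t : DTree D)
    (p : List ℕ) (ht : ∀ a d, lookup a t = some d ↔ ∃ x, α x = p ++ a ∧ δ x = d) {x : X}
    (hx : α x = p) : Unfolds δ E x t := by
  induction t using DTree.induction_on generalizing p x with
  | h d F ih =>
    have hd : δ x = d := by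
      obtain ⟨y, hy, hyd⟩ := (ht [] d).mp rfl
      rw [List.append_nil, ← hx] at hy
      rw [← hα hy, hyd]
    have hv : ∀ i : Fin F.length, ∃ y, α y = p ++ [(i : ℕ)] := by
      intro i
      obtain ⟨e, he⟩ : ∃ e, lookup [(i : ℕ)] (node d F) = some e := by
        rw [lookup_cons, List.getElem?_eq_getElem i.2]
        cases h : F[(i : ℕ)] with
        | node e G => exact ⟨e, rfl⟩
      obtain ⟨y, hy, -⟩ := (ht _ e).mp he
      exact ⟨y, hy⟩
    choose v hv using hv
    have hF : F = List.ofFn (fun i => F.get i) := (List.ofFn_get F).symm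
    rw [← hd, hF]
    refine Unfolds.node x v _ (fun i j hij => ?_) (fun y => ?_) (fun i => ?_)
    · have := (hv i).symm.trans ((congrArg α hij).trans (hv j))
      simpa [Fin.ext_iff] using this
    · rw [hE, hx]
      constructor
      · rintro ⟨k, hk⟩
        have hl := (ht [k] (δ y)).mpr ⟨y, hk, rfl⟩
        rw [lookup_cons] at hl
        have hkF : k < F.length := by
          by_contra hc
          rw [List.getElem?_eq_none (not_lt.mp hc)] at hl
          simp at hl
        exact ⟨⟨k, hkF⟩, hα (by rw [hv, hk])⟩
      · rintro ⟨i, rfl⟩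
        exact ⟨i, hv i⟩
    · refine ih (F.get i) (List.get_mem F i) (p ++ [(i : ℕ)]) (fun a e => ?_) (hv i)
      have := ht ((i : ℕ) :: a) e
      rw [lookup_cons, List.getElem?_eq_getElem i.2] at this
      rw [List.append_assoc, List.singleton_append, ← this]
      rfl

theorem unfolds_self (t : DTree D) {x : Fin t.size} (hx : t.addr x = []) :
    Unfolds t.dec t.Edge x t :=
  unfolds_of_addr t.addr_injective (fun _ _ => Iff.rfl) t [] (t.lookup_eq_some_iff) hx

theorem exists_root (t : DTree D) : ∃ x, t.addr x = [] := by
  obtain ⟨d, hd⟩ : ∃ d, lookup [] t = some d := by cases t with | node d F => exact ⟨d, rfl⟩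
  obtain ⟨x, hx, -⟩ := (t.lookup_eq_some_iff _ _).mp hd
  exact ⟨x, hx⟩

/-- The root is described by edges alone, hence preserved by vertex isomorphisms. -/
theorem addr_eq_nil_iff (t : DTree D) (x : Fin t.size) : t.addr x = [] ↔ ∀ y, ¬ t.Edge y x := by
  constructor
  · rintro h y ⟨k, hk⟩
    rw [h] at hk
    simp at hk
  · intro h
    rcases List.eq_nil_or_concat (t.addr x) with h0 | ⟨a, k, hk⟩
    · exact h0
    · have h1 := (t.lookup_eq_some_iff (t.addr x) (t.dec x)).mpr ⟨x, rfl, rfl⟩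
      rw [hk, List.concat_eq_append] at h1
      obtain ⟨e, he⟩ := lookup_of_append t h1
      obtain ⟨y, hy, -⟩ := (t.lookup_eq_some_iff _ _).mp he
      exact absurd ⟨k, by rw [hk, hy, List.concat_eq_append]⟩ (h y)

theorem IsVertexIso.forestEquiv {s t : DTree D} {σ : Fin s.size ≃ Fin t.size}
    (h : IsVertexIso s t σ) : ForestEquiv [s] [t] := by
  obtain ⟨x, hx⟩ := s.exists_root
  refine ((s.unfolds_self hx).map σ h.dec h.edge).forestEquiv (t.unfolds_self ?_)
  rw [addr_eq_nil_iff] at hx ⊢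
  intro y
  obtain ⟨y, rfl⟩ := σ.surjective y
  rw [h.edge]
  exact hx y

end DTree

/-! ### Graphon classes of decorated trees -/

section Cells

variable {n : ℕ} (hn : 0 < n)

/-- The half-open cells do not contain 0; truncated subtraction puts that point into the cell
numbered 0, so it is excluded here and treated as a null set below. -/
theorem cellIndex_eq_iff {x : unitInterval} (hx : x ≠ 0) (i : Fin n) :
    cellIndex n hn x = i ↔ (i : ℝ) < n * (x : ℝ) ∧ n * (x : ℝ) ≤ i + 1 := by
  have hx0 : 0 < (x : ℝ) := unitInterval.pos_iff_ne_zero.mpr hx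
  have hc : 0 < ⌈(n : ℝ) * (x : ℝ)⌉₊ := Nat.ceil_pos.mpr (by positivity)
  have h1 : cellIndex n hn x = i ↔ ⌈(n : ℝ) * (x : ℝ)⌉₊ = (i : ℕ) + 1 := by
    rw [cellIndex, Fin.ext_iff]
    simp only
    omega
  rw [h1, Nat.ceil_eq_iff (by omega)]
  simp

/-- The map that moves the cells of `[0, 1]` by translations according to a permutation. -/
noncomputable def moveCells (σ : Equiv.Perm (Fin n)) (x : unitInterval) : unitInterval :=
  if x = 0 then 0 else Set.projIcc 0 1 zero_le_one
    ((x : ℝ) + ((σ (cellIndex n hn x) : ℝ) - (cellIndex n hn x : ℝ)) / n)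

theorem moveCells_zero (σ : Equiv.Perm (Fin n)) : moveCells hn σ 0 = 0 := if_pos rfl

/-- The projection to [0, 1] in the definition is never active, because a point of cell i is
translated into cell σ i. -/
theorem coe_moveCells (σ : Equiv.Perm (Fin n)) {x : unitInterval} (hx : x ≠ 0) :
    (moveCells hn σ x : ℝ) =
      (x : ℝ) + ((σ (cellIndex n hn x) : ℝ) - (cellIndex n hn x : ℝ)) / n := by
  have hn' : (0 : ℝ) < n := Nat.cast_pos.mpr hn
  obtain ⟨h1, h2⟩ := (cellIndex_eq_iff hn hx _).mp rfl
  rw [moveCells, if_neg hx, Set.coe_projIcc]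
  set i := cellIndex n hn x
  have e : (x : ℝ) + ((σ i : ℝ) - (i : ℝ)) / n = (n * (x : ℝ) + (σ i : ℝ) - i) / n := by
    field_simp
    ring
  have h3 : (σ i : ℝ) + 1 ≤ n := by exact_mod_cast (σ i).2
  have h4 : (0 : ℝ) ≤ (σ i : ℝ) := Nat.cast_nonneg _
  rw [e, min_eq_right, max_eq_right]
  · exact div_nonneg (by linarith) hn'.le
  · rw [div_le_one hn']; linarith

theorem moveCells_ne_zero (σ : Equiv.Perm (Fin n)) {x : unitInterval} (hx : x ≠ 0) :
    moveCells hn σ x ≠ 0 := by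
  have hn' : (0 : ℝ) < n := Nat.cast_pos.mpr hn
  obtain ⟨h1, h2⟩ := (cellIndex_eq_iff hn hx _).mp rfl
  rw [← unitInterval.pos_iff_ne_zero, ← unitInterval.coe_pos, coe_moveCells hn σ hx]
  set i := cellIndex n hn x
  have e : (x : ℝ) + ((σ i : ℝ) - (i : ℝ)) / n = (n * (x : ℝ) + (σ i : ℝ) - i) / n := by
    field_simp
    ring
  have h4 : (0 : ℝ) ≤ (σ i : ℝ) := Nat.cast_nonneg _
  rw [e]
  exact div_pos (by linarith) hn'

theorem cellIndex_moveCells (σ : Equiv.Perm (Fin n)) {x : unitInterval} (hx : x ≠ 0) :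
    cellIndex n hn (moveCells hn σ x) = σ (cellIndex n hn x) := by
  have hn' : (0 : ℝ) < n := Nat.cast_pos.mpr hn
  obtain ⟨h1, h2⟩ := (cellIndex_eq_iff hn hx _).mp rfl
  rw [cellIndex_eq_iff hn (moveCells_ne_zero hn σ hx), coe_moveCells hn σ hx, mul_add,
    mul_div_cancel₀ _ hn'.ne']
  constructor <;> linarith

theorem moveCells_moveCells (σ τ : Equiv.Perm (Fin n)) (h : ∀ i, τ (σ i) = i) (x : unitInterval) :
    moveCells hn τ (moveCells hn σ x) = x := by
  by_cases hx : x = 0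
  · rw [hx, moveCells_zero, moveCells_zero]
  · apply Subtype.ext
    rw [coe_moveCells hn τ (moveCells_ne_zero hn σ hx), cellIndex_moveCells hn σ hx, h,
      coe_moveCells hn σ hx]
    ring

theorem measurable_moveCells (σ : Equiv.Perm (Fin n)) : Measurable (moveCells hn σ) := by
  refine Measurable.ite (measurableSet_singleton 0) measurable_const
    (continuous_projIcc.measurable.comp (measurable_subtype_coe.add ?_))
  exact (measurable_of_countable (fun i : Fin n => ((σ i : ℝ) - (i : ℝ)) / n)).comp
    (measurable_cellIndex n hn)

/-- The permutation of cells as an equivalence. -/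
noncomputable def moveCellsEquiv (σ : Equiv.Perm (Fin n)) : unitInterval ≃ᵐ unitInterval where
  toFun := moveCells hn σ
  invFun := moveCells hn σ.symm
  left_inv := moveCells_moveCells hn σ σ.symm (by simp)
  right_inv := moveCells_moveCells hn σ.symm σ (by simp)
  measurable_toFun := measurable_moveCells hn σ
  measurable_invFun := measurable_moveCells hn σ.symm

theorem volume_eq_sum_cells (S : Set unitInterval) :
    (volume : Measure unitInterval) S = ∑ i, volume (cellIndex n hn ⁻¹' {i} ∩ S) := by
  have h := sum_measure_preimage_singleton (μ := (volume : Measure unitInterval).restrict S)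
    Finset.univ (f := cellIndex n hn)
    (fun i _ => measurable_cellIndex n hn (measurableSet_singleton i))
  rw [Finset.coe_univ, Set.preimage_univ, Measure.restrict_apply_univ] at h
  rw [← h]
  exact Finset.sum_congr rfl fun i _ =>
    Measure.restrict_apply (measurable_cellIndex n hn (measurableSet_singleton i))

/-- Away from 0 the map is a translation on each cell, so this is translation invariance of Lebesgue
measure on the line. -/
theorem volume_cell_inter_preimage_moveCells (σ : Equiv.Perm (Fin n)) (i : Fin n)
    (S : Set unitInterval) :
    (volume : Measure unitInterval) (cellIndex n hn ⁻¹' {i} ∩ moveCells hn σ ⁻¹' S) =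
      volume (cellIndex n hn ⁻¹' {σ i} ∩ S) := by
  have h0 : ∀ A : Set unitInterval, (volume : Measure unitInterval) A = volume (A \ {0}) :=
    fun A => (measure_sdiff_null (measure_singleton 0)).symm
  rw [h0, h0 (_ ∩ S), unitInterval.volume_apply, unitInterval.volume_apply,
    ← measure_preimage_add_right volume (((σ i : ℝ) - (i : ℝ)) / n)
      (Subtype.val '' ((cellIndex n hn ⁻¹' {σ i} ∩ S) \ {0}))]
  congr 1
  ext r
  simp only [Set.mem_image, Set.mem_sdiff, Set.mem_inter_iff, Set.mem_preimage,
    Set.mem_singleton_iff]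
  constructor
  · rintro ⟨x, ⟨⟨rfl, hS⟩, hx⟩, rfl⟩
    exact ⟨_, ⟨⟨cellIndex_moveCells hn σ hx, hS⟩, moveCells_ne_zero hn σ hx⟩,
      coe_moveCells hn σ hx⟩
  · rintro ⟨y, ⟨⟨hc, hS⟩, hy⟩, hyr⟩
    refine ⟨moveCells hn σ.symm y, ⟨⟨?_, ?_⟩, moveCells_ne_zero hn _ hy⟩, ?_⟩
    · rw [cellIndex_moveCells hn _ hy, hc, Equiv.symm_apply_apply]
    · rwa [moveCells_moveCells hn σ.symm σ (by simp)]
    · rw [coe_moveCells hn _ hy, hc, Equiv.symm_apply_apply, hyr]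
      ring

theorem measurePreserving_moveCells (σ : Equiv.Perm (Fin n)) :
    MeasurePreserving (moveCells hn σ) volume volume where
  measurable := measurable_moveCells hn σ
  map_eq := by
    ext S hS
    rw [Measure.map_apply (measurable_moveCells hn σ) hS, volume_eq_sum_cells hn,
      volume_eq_sum_cells hn S]
    simp only [volume_cell_inter_preimage_moveCells]
    exact Equiv.sum_comp σ fun i => (volume : Measure unitInterval) (cellIndex n hn ⁻¹' {i} ∩ S)

/-- Cells are exchanged by `moveCells`, hence have equal volume; if one were null, the whole
interval would be. -/
theorem volume_cell_ne_zero (i : Fin n) :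
    (volume : Measure unitInterval) (cellIndex n hn ⁻¹' {i}) ≠ 0 := by
  intro h
  have hall : ∀ j, (volume : Measure unitInterval) (cellIndex n hn ⁻¹' {j}) = 0 := by
    intro j
    have := volume_cell_inter_preimage_moveCells hn (Equiv.swap j i) j Set.univ
    rw [Equiv.swap_apply_left] at this
    simpa [h] using this
  have := volume_eq_sum_cells hn Set.univ
  simp [hall] at this

end Cells

theorem exists_measurePreserving_cellIndex {m n : ℕ} (hm : 0 < m) (hn : 0 < n)
    (τ : Fin m ≃ Fin n) : ∃ e : unitInterval ≃ᵐ unitInterval, MeasurePreserving e volume volume ∧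
      ∀ x, x ≠ 0 → cellIndex n hn (e x) = τ (cellIndex m hm x) := by
  obtain rfl : m = n := by simpa using Fintype.card_congr τ
  exact ⟨moveCellsEquiv hm τ, measurePreserving_moveCells hm τ,
    fun x hx => cellIndex_moveCells hm τ hx⟩

-- Recovering a tree, up to the order of branches, from its graphon class.

section Trees

variable {Φ : FeynmanTheory} {s t : DTree Φ.Decoration}

theorem adjacency_self (t : DTree Φ.Decoration) (i : Fin t.size) :
    adjacency Φ t i i = Φ.weight (t.dec i) := if_pos rfl

open Classical in
theorem adjacency_of_ne (t : DTree Φ.Decoration) {i j : Fin t.size} (h : i ≠ j) :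
    adjacency Φ t i j = if t.Edge i j then 1 else 0 := if_neg h

/-- Diagonal entries lie strictly between 0 and 1, other entries are 0 or 1. The class can therefore
tell one vertex from two. -/
theorem adjacency_self_ne (t : DTree Φ.Decoration) (i : Fin t.size) (u : DTree Φ.Decoration)
    {j k : Fin u.size} (h : j ≠ k) : adjacency Φ t i i ≠ adjacency Φ u j k := by
  rw [adjacency_self, adjacency_of_ne u h]
  split_ifs
  · exact (Φ.weight_lt_one _).ne
  · exact (Φ.weight_pos _).ne'

theorem DTree.not_edge_self (t : DTree Φ.Decoration) (i : Fin t.size) : ¬ t.Edge i i := by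
  rintro ⟨k, hk⟩
  simp at hk

theorem DTree.IsVertexIso.adjacency_eq {σ : Fin s.size ≃ Fin t.size} (h : s.IsVertexIso t σ)
    (i j : Fin s.size) : adjacency Φ t (σ i) (σ j) = adjacency Φ s i j := by
  by_cases hij : i = j
  · subst hij
    rw [adjacency_self, adjacency_self, h.dec]
  · rw [adjacency_of_ne s hij, adjacency_of_ne t (σ.injective.ne hij), h.edge]

theorem DTree.isVertexIso_of_adjacency {σ : Fin s.size ≃ Fin t.size}
    (h : ∀ i j, adjacency Φ t (σ i) (σ j) = adjacency Φ s i j) : s.IsVertexIso t σ where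
  dec i := Φ.weight_injective (by rw [← adjacency_self, ← adjacency_self, h])
  edge i j := by
    by_cases hij : i = j
    · subst hij
      exact iff_of_false (t.not_edge_self _) (s.not_edge_self _)
    · have := h i j
      rw [adjacency_of_ne s hij, adjacency_of_ne t (σ.injective.ne hij)] at this
      by_cases h1 : t.Edge (σ i) (σ j) <;> by_cases h2 : s.Edge i j <;> simp_all

theorem DTree.IsVertexIso.graphonClass_eq {σ : Fin s.size ≃ Fin t.size}
    (h : s.IsVertexIso t σ) : graphonClass Φ s = graphonClass Φ t := by
  refine Quotient.sound ?_
  obtain ⟨e, he, hc⟩ := exists_measurePreserving_cellIndex t.vertices_length_pos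
    s.vertices_length_pos σ.symm
  refine ⟨e, he, ?_⟩
  have h0 : ∀ᵐ x ∂(volume : Measure unitInterval), x ≠ 0 := by
    rw [ae_iff]
    simp
  filter_upwards [Measure.quasiMeasurePreserving_fst.ae h0,
    Measure.quasiMeasurePreserving_snd.ae h0] with p hp1 hp2
  change adjacency Φ t _ _ = adjacency Φ s _ _
  rw [hc _ hp1, hc _ hp2, ← h.adjacency_eq, Equiv.apply_symm_apply, Equiv.apply_symm_apply]

/-- A rearrangement need not map cells to cells. Relate i and j when e carries a set of positive
measure from cell i to cell j. Matrix entries agree on related pairs, and a cell related to two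
different cells would equate a diagonal entry with an off-diagonal one; so the relation is a
bijection. -/
theorem exists_isVertexIso_of_graphonClass_eq (h : graphonClass Φ s = graphonClass Φ t) :
    ∃ σ, s.IsVertexIso t σ := by
  obtain ⟨e, he, hae⟩ := Quotient.exact h
  let R : Fin t.size → Fin s.size → Prop := fun i j =>
    (volume : Measure unitInterval) (cellIndex _ t.vertices_length_pos ⁻¹' {i} ∩
      e ⁻¹' (cellIndex _ s.vertices_length_pos ⁻¹' {j})) ≠ 0
  have hms : ∀ j, MeasurableSet (cellIndex _ s.vertices_length_pos ⁻¹' {j}) := fun j =>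
    measurable_cellIndex _ _ (measurableSet_singleton j)
  have hR : ∀ i i' j j', R i j → R i' j' → adjacency Φ t i i' = adjacency Φ s j j' := by
    intro i i' j j' h1 h2
    -- The rectangle of two overlaps has positive measure, so it contains a point where the almost
    -- everywhere equality holds.
    have h3 : ((volume : Measure unitInterval).prod volume)
        ((cellIndex _ t.vertices_length_pos ⁻¹' {i} ∩
          e ⁻¹' (cellIndex _ s.vertices_length_pos ⁻¹' {j})) ×ˢ
        (cellIndex _ t.vertices_length_pos ⁻¹' {i'} ∩
          e ⁻¹' (cellIndex _ s.vertices_length_pos ⁻¹' {j'}))) ≠ 0 := by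
      rw [Measure.prod_prod]
      exact mul_ne_zero h1 h2
    obtain ⟨p, ⟨⟨hp1, hp2⟩, hp3, hp4⟩, hp⟩ :=
      ((frequently_ae_mem_iff.mpr h3).and_eventually hae).exists
    simp only [Set.mem_preimage, Set.mem_singleton_iff] at hp1 hp2 hp3 hp4
    change adjacency Φ t (cellIndex _ _ p.1) (cellIndex _ _ p.2) =
      adjacency Φ s (cellIndex _ _ (e p.1)) (cellIndex _ _ (e p.2)) at hp
    rwa [hp1, hp2, hp3, hp4] at hp
  have h1 : ∀ i, ∃ j, R i j := by
    intro i
    by_contra! hc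
    simp only [R, not_not] at hc
    apply volume_cell_ne_zero t.vertices_length_pos i
    refine measure_mono_null (fun x hx => ?_) (measure_iUnion_null hc)
    exact Set.mem_iUnion.mpr ⟨cellIndex _ s.vertices_length_pos (e x), hx, rfl⟩
  have h2 : ∀ j, ∃ i, R i j := by
    intro j
    by_contra! hc
    simp only [R, not_not] at hc
    apply volume_cell_ne_zero s.vertices_length_pos j
    rw [← he.measure_preimage (hms j).nullMeasurableSet]
    refine measure_mono_null (fun x hx => ?_) (measure_iUnion_null hc)
    exact Set.mem_iUnion.mpr ⟨cellIndex _ t.vertices_length_pos x, rfl, hx⟩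
  choose f hf using h1
  choose g hg using h2
  -- Both i and g (f i) are related to f i; if they differed, an off-diagonal entry of t would equal
  -- a diagonal entry of s.
  have hfg : ∀ i, g (f i) = i := by
    intro i
    by_contra hne
    exact adjacency_self_ne s (f i) t hne (hR _ _ _ _ (hg (f i)) (hf i)).symm
  have hgf : ∀ j, f (g j) = j := by
    intro j
    by_contra hne
    exact adjacency_self_ne t (g j) s hne (hR _ _ _ _ (hf (g j)) (hg j))
  exact ⟨⟨g, f, hgf, hfg⟩, DTree.isVertexIso_of_adjacency fun i j => hR _ _ _ _ (hg i) (hg j)⟩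

theorem DTree.ForestEquiv.graphonClass_eq {F G : List (DTree Φ.Decoration)}
    (h : DTree.ForestEquiv F G) (d : Φ.Decoration) :
    graphonClass Φ (DTree.node d F) = graphonClass Φ (DTree.node d G) := by
  obtain ⟨σ, hσ⟩ := h.exists_isVertexIso d
  exact hσ.graphonClass_eq

theorem forestEquiv_of_graphonClass_eq (h : graphonClass Φ s = graphonClass Φ t) :
    DTree.ForestEquiv [s] [t] := by
  obtain ⟨σ, hσ⟩ := exists_isVertexIso_of_graphonClass_eq h
  exact hσ.forestEquiv

end Trees

/-! ### The Hopf algebra of Feynman graphons -/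

section Fold

variable {D R : Type} [CommMonoid R]

/-- The evaluation of trees in a commutative monoid, where grafting a forest to a root decorated by
`d` acts by `L d` on the product of the values of the trees. -/
def DTree.fold (L : D → R → R) : DTree D → R
  | DTree.node d F => L d (F.map (DTree.fold L)).prod

theorem DTree.fold_node (L : D → R → R) (d : D) (F : List (DTree D)) :
    DTree.fold L (DTree.node d F) = L d (F.map (DTree.fold L)).prod := by
  rw [DTree.fold]

/-- A criterion for functions of trees to descend to equivalence classes: products absorb
reorderings, and the hypothesis propagates the equality through a root. -/
theorem DTree.ForestEquiv.prod_eq {f : DTree D → R}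
    (hf : ∀ d F G, DTree.ForestEquiv F G → (F.map f).prod = (G.map f).prod →
      f (DTree.node d F) = f (DTree.node d G))
    {F G : List (DTree D)} (h : DTree.ForestEquiv F G) : (F.map f).prod = (G.map f).prod := by
  induction h with
  | nil => rfl
  | cons d h1 _ ih1 ih2 =>
    rw [List.map_cons, List.map_cons, List.prod_cons, List.prod_cons, ih2, hf d _ _ h1 ih1]
  | swap s t F => simp only [List.map_cons, List.prod_cons, mul_left_comm]
  | trans _ _ h1 h2 => exact h1.trans h2

end Fold

-- Grafting, and the Hopf algebra structure derived from it.

section Graphons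

variable {Φ : FeynmanTheory}

/-- The product of the generators given by the trees of a forest. -/
noncomputable def forestGen (Φ : FeynmanTheory) (F : List (DTree Φ.Decoration)) :
    GraphonAlgebra Φ := (F.map (graphonGen Φ)).prod

theorem graphonGen_eq_of_forestEquiv {s t : DTree Φ.Decoration}
    (h : DTree.ForestEquiv [s] [t]) : graphonGen Φ s = graphonGen Φ t := by
  simpa using h.prod_eq (f := graphonGen Φ) fun d F G hFG _ => by
    simp only [graphonGen, hFG.graphonClass_eq d]

/-- A tree that represents a Feynman graphon. -/
noncomputable def representative (x : feynmanGraphons Φ) : DTree Φ.Decoration := x.2.choose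

theorem graphonClass_representative (x : feynmanGraphons Φ) :
    graphonClass Φ (representative x) = x := x.2.choose_spec

theorem graphonGen_representative (x : feynmanGraphons Φ) :
    graphonGen Φ (representative x) = MvPolynomial.X x := by
  simp only [graphonGen, graphonClass_representative]

/-- The grafting operator, which takes a product of generators given by a forest to the generator
given by the tree with the branches in that forest and with a root decorated by `d`. -/
noncomputable def graft (d : Φ.Decoration) : GraphonAlgebra Φ →ₗ[ℂ] GraphonAlgebra Φ :=
  (MvPolynomial.basisMonomials (feynmanGraphons Φ) ℂ).constr ℂ fun m =>
    graphonGen Φ (DTree.node d ((Finsupp.toMultiset m).toList.map representative))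

open Classical in
theorem forestGen_eq_monomial (F : List (DTree Φ.Decoration)) :
    forestGen Φ F = MvPolynomial.monomial
      (Multiset.toFinsupp (F.map fun t => (⟨graphonClass Φ t, t, rfl⟩ : feynmanGraphons Φ))) 1 := by
  induction F with
  | nil => simp [forestGen]
  | cons t F ih =>
    have h : forestGen Φ (t :: F) = graphonGen Φ t * forestGen Φ F := by simp [forestGen]
    rw [h, ih, graphonGen, MvPolynomial.X, MvPolynomial.monomial_mul, mul_one, List.map_cons,
      ← Multiset.cons_coe, ← Multiset.singleton_add, map_add, Multiset.toFinsupp_singleton]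

open Classical in
-- The definition chooses a tree for each graphon; since the class determines the tree up to
-- equivalence, the grafted generator does not depend on the choice.
theorem graft_forestGen (d : Φ.Decoration) (F : List (DTree Φ.Decoration)) :
    graft d (forestGen Φ F) = graphonGen Φ (DTree.node d F) := by
  have hb : ∀ m, graft d (MvPolynomial.monomial m 1) = graphonGen Φ
      (DTree.node d ((Finsupp.toMultiset m).toList.map representative)) := fun m => by
    rw [graft, ← congrFun (MvPolynomial.coe_basisMonomials _ _) m, Module.Basis.constr_basis]
  rw [forestGen_eq_monomial, hb, Multiset.toFinsupp_toMultiset]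
  refine graphonGen_eq_of_forestEquiv (DTree.ForestEquiv.cons d ?_ DTree.ForestEquiv.nil)
  refine (DTree.ForestEquiv.of_perm
    ((Multiset.coe_eq_coe.mp (Multiset.coe_toList _)).map representative)).trans ?_
  induction F with
  | nil => exact DTree.ForestEquiv.nil
  | cons t F ih =>
    exact DTree.ForestEquiv.cons_of_singleton
      (forestEquiv_of_graphonClass_eq (graphonClass_representative _)) ih

open Classical in
theorem span_forestGen : Submodule.span ℂ (Set.range (forestGen Φ)) = ⊤ := by
  rw [← (MvPolynomial.basisMonomials (feynmanGraphons Φ) ℂ).span_eq]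
  refine le_antisymm (by rw [Module.Basis.span_eq]; exact le_top) (Submodule.span_mono ?_)
  rintro _ ⟨m, rfl⟩
  refine ⟨(Finsupp.toMultiset m).toList.map representative, ?_⟩
  rw [forestGen_eq_monomial, List.map_map]
  have h : (fun t => (⟨graphonClass Φ t, t, rfl⟩ : feynmanGraphons Φ)) ∘ representative = id :=
    funext fun x => Subtype.ext (graphonClass_representative x)
  rw [h, List.map_id, Multiset.coe_toList, Finsupp.toMultiset_toFinsupp,
    MvPolynomial.coe_basisMonomials]

theorem induction_forestGen {P : GraphonAlgebra Φ → Prop} (h : ∀ F, P (forestGen Φ F))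
    (hadd : ∀ x y, P x → P y → P (x + y)) (hsmul : ∀ (c : ℂ) x, P x → P (c • x))
    (x : GraphonAlgebra Φ) : P x := by
  have hx : x ∈ Submodule.span ℂ (Set.range (forestGen Φ)) := by
    rw [span_forestGen]
    exact Submodule.mem_top
  induction hx using Submodule.span_induction with
  | mem x hx =>
    obtain ⟨F, rfl⟩ := hx
    exact h F
  | zero => simpa using hsmul 0 _ (h [])
  | add x y _ _ hx hy => exact hadd x y hx hy
  | smul c x _ hx => exact hsmul c x hx

variable {R : Type} [CommSemiring R] [Algebra ℂ R]

theorem map_forestGen (f : GraphonAlgebra Φ →ₐ[ℂ] R) (F : List (DTree Φ.Decoration)) :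
    f (forestGen Φ F) = (F.map fun t => f (graphonGen Φ t)).prod := by
  rw [forestGen, map_list_prod, List.map_map]
  rfl

/-- Every generator is the graft of a product of generators given by its branches, so agreement
spreads from the branches to the tree. -/
theorem algHom_eq_of_graft {f g : GraphonAlgebra Φ →ₐ[ℂ] R}
    (h : ∀ d x, f x = g x → f (graft d x) = g (graft d x)) : f = g := by
  have key : ∀ t, f (graphonGen Φ t) = g (graphonGen Φ t) := by
    intro t
    induction t using DTree.induction_on with
    | h d F ih =>
      rw [← graft_forestGen]
      refine h d _ ?_
      rw [map_forestGen, map_forestGen, List.map_congr_left ih]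
  refine MvPolynomial.algHom_ext fun x => ?_
  rw [← graphonGen_representative]
  exact key _

/-- The universal property of the grafting operators. -/
theorem exists_algHom_graft (L : Φ.Decoration → R →ₗ[ℂ] R) :
    ∃ f : GraphonAlgebra Φ →ₐ[ℂ] R, ∀ d x, f (graft d x) = L d (f x) := by
  let ρ : DTree Φ.Decoration → R := DTree.fold fun d => L d
  let f : GraphonAlgebra Φ →ₐ[ℂ] R := MvPolynomial.aeval fun x => ρ (representative x)
  have hf : ∀ t, f (graphonGen Φ t) = ρ t := by
    intro t
    have h := (forestEquiv_of_graphonClass_eq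
      (graphonClass_representative ⟨graphonClass Φ t, t, rfl⟩)).prod_eq (f := ρ)
      (fun d F G _ h => by simp only [ρ, DTree.fold_node] at h ⊢; rw [h])
    simpa [f, graphonGen] using h
  refine ⟨f, fun d x => ?_⟩
  induction x using induction_forestGen with
  | h F =>
    rw [graft_forestGen, hf, map_forestGen]
    simp only [hf]
    exact DTree.fold_node _ d F
  | hadd x y hx hy => simp only [map_add, hx, hy]
  | hsmul c x hx => simp only [map_smul, hx]

/-! #### The coproduct -/

theorem sum_map_mul_sum_map {M α β : Type} [Semiring M] (l : List α) (k : List β) (f : α → M)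
    (g : β → M) :
    (l.flatMap fun a => k.map fun b => f a * g b).sum = (l.map f).sum * (k.map g).sum := by
  induction l with
  | nil => simp
  | cons a l ih => simp [ih, add_mul, List.sum_map_mul_left]

/-- The choices in different branches are independent, and cutting the edge above a branch t is the
summand [W_t] ⊗ 1 of its coproduct. -/
theorem sum_forestCuts (F : List (DTree Φ.Decoration)) :
    ((DTree.forestCuts F).map fun q => forestGen Φ q.1 ⊗ₜ[ℂ] forestGen Φ q.2).sum =
      (F.map (treeCoproduct Φ)).prod := by
  induction F with
  | nil => simp [DTree.forestCuts, forestGen, Algebra.TensorProduct.one_def]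
  | cons t F ih =>
    rw [List.map_cons, List.prod_cons, ← ih, treeCoproduct, add_mul, ← sum_map_mul_sum_map,
      ← List.sum_map_mul_left, DTree.forestCuts, List.map_append, List.sum_append]
    simp [List.map_flatMap, List.map_map, Function.comp_def, forestGen]

/-- The Hochschild cocycle property of grafting, still at the level of trees: a cut of the tree is a
cut of the forest of branches, with the root added to the trunk. -/
theorem treeCoproduct_node (d : Φ.Decoration) (F : List (DTree Φ.Decoration)) :
    treeCoproduct Φ (DTree.node d F) = graphonGen Φ (DTree.node d F) ⊗ₜ 1 +
      TensorProduct.map LinearMap.id (graft d) (F.map (treeCoproduct Φ)).prod := by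
  rw [treeCoproduct, DTree.cuts, ← sum_forestCuts, map_list_sum, List.map_map, List.map_map]
  simp only [Function.comp_def, TensorProduct.map_tmul, graft_forestGen]
  rfl

/-- This is well-definedness: by the cocycle formula the coproduct of a tree depends on its branches
only through a commutative product, so it is constant on equivalent trees. -/
theorem graphonCoproduct_graphonGen (t : DTree Φ.Decoration) :
    graphonCoproduct Φ (graphonGen Φ t) = treeCoproduct Φ t := by
  have h := (forestEquiv_of_graphonClass_eq
    (graphonClass_representative ⟨graphonClass Φ t, t, rfl⟩)).prod_eq (f := treeCoproduct Φ)
    (fun d F G hFG h => by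
      rw [treeCoproduct_node, treeCoproduct_node, h]
      simp only [graphonGen, hFG.graphonClass_eq d])
  have h2 : graphonCoproduct Φ (graphonGen Φ t) =
      treeCoproduct Φ (representative ⟨graphonClass Φ t, t, rfl⟩) := by
    rw [graphonCoproduct, graphonGen, MvPolynomial.aeval_X]
    rfl
  rw [h2]
  simpa using h

theorem graphonCoproduct_graft (d : Φ.Decoration) (x : GraphonAlgebra Φ) :
    graphonCoproduct Φ (graft d x) = graft d x ⊗ₜ 1 +
      TensorProduct.map LinearMap.id (graft d) (graphonCoproduct Φ x) := by
  induction x using induction_forestGen with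
  | h F =>
    rw [graft_forestGen, graphonCoproduct_graphonGen, treeCoproduct_node, map_forestGen]
    simp only [graphonCoproduct_graphonGen]
  | hadd x y hx hy =>
    simp only [map_add, hx, hy, TensorProduct.add_tmul]
    abel
  | hsmul c x hx => simp only [map_smul, hx, smul_add, TensorProduct.smul_tmul']

theorem graphonCounit_graft (d : Φ.Decoration) (x : GraphonAlgebra Φ) :
    graphonCounit Φ (graft d x) = 0 := by
  induction x using induction_forestGen with
  | h F => rw [graft_forestGen, graphonGen, graphonCounit, MvPolynomial.aeval_X]
  | hadd x y hx hy => rw [map_add, map_add, hx, hy, add_zero]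
  | hsmul c x hx => rw [map_smul, map_smul, hx, smul_zero]

/-- Both sides are algebra homomorphisms, so they need only be compared on a graft B x, assuming
equality at x. Each side is B x ⊗ 1 ⊗ 1 + (id ⊗ B)Δx ⊗ 1 plus id ⊗ id ⊗ B applied to its value at x.
-/
theorem graphonCoproduct_coassoc (x : GraphonAlgebra Φ) :
    TensorProduct.assoc ℂ (GraphonAlgebra Φ) (GraphonAlgebra Φ) (GraphonAlgebra Φ)
      (TensorProduct.map (graphonCoproduct Φ).toLinearMap LinearMap.id (graphonCoproduct Φ x)) =
    TensorProduct.map LinearMap.id (graphonCoproduct Φ).toLinearMap (graphonCoproduct Φ x) := by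
  let f : GraphonAlgebra Φ →ₐ[ℂ] GraphonAlgebra Φ ⊗[ℂ] (GraphonAlgebra Φ ⊗[ℂ] GraphonAlgebra Φ) :=
    (Algebra.TensorProduct.assoc ℂ ℂ ℂ (GraphonAlgebra Φ) (GraphonAlgebra Φ)
      (GraphonAlgebra Φ)).toAlgHom.comp
      ((Algebra.TensorProduct.map (graphonCoproduct Φ) (AlgHom.id ℂ (GraphonAlgebra Φ))).comp
        (graphonCoproduct Φ))
  let g : GraphonAlgebra Φ →ₐ[ℂ] GraphonAlgebra Φ ⊗[ℂ] (GraphonAlgebra Φ ⊗[ℂ] GraphonAlgebra Φ) :=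
    (Algebra.TensorProduct.map (AlgHom.id ℂ (GraphonAlgebra Φ)) (graphonCoproduct Φ)).comp
      (graphonCoproduct Φ)
  have hf : ∀ x, f x = TensorProduct.assoc ℂ (GraphonAlgebra Φ) (GraphonAlgebra Φ)
      (GraphonAlgebra Φ) (TensorProduct.map (graphonCoproduct Φ).toLinearMap LinearMap.id
        (graphonCoproduct Φ x)) := fun _ => rfl
  have hg : ∀ x, g x = TensorProduct.map LinearMap.id (graphonCoproduct Φ).toLinearMap
      (graphonCoproduct Φ x) := fun _ => rfl
  have h1 : ∀ (d : Φ.Decoration) y, TensorProduct.assoc ℂ (GraphonAlgebra Φ) (GraphonAlgebra Φ)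
      (GraphonAlgebra Φ)
      (TensorProduct.map (graphonCoproduct Φ).toLinearMap LinearMap.id
        (TensorProduct.map LinearMap.id (graft d) y)) =
      TensorProduct.map LinearMap.id (TensorProduct.map LinearMap.id (graft d))
        (TensorProduct.assoc ℂ (GraphonAlgebra Φ) (GraphonAlgebra Φ) (GraphonAlgebra Φ)
          (TensorProduct.map (graphonCoproduct Φ).toLinearMap LinearMap.id y)) := by
    intro d y
    induction y using TensorProduct.induction_on with
    | zero => simp only [map_zero]
    | add y z hy hz => simp only [map_add, hy, hz]
    | tmul a b =>
      simp only [TensorProduct.map_tmul, LinearMap.id_apply, AlgHom.toLinearMap_apply]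
      induction graphonCoproduct Φ a using TensorProduct.induction_on with
      | zero => simp only [map_zero, TensorProduct.zero_tmul]
      | add y z hy hz => simp only [map_add, TensorProduct.add_tmul, hy, hz]
      | tmul a c => simp
  have h2 : ∀ (d : Φ.Decoration) y, TensorProduct.map LinearMap.id (graphonCoproduct Φ).toLinearMap
        (TensorProduct.map LinearMap.id (graft d) y) =
      TensorProduct.assoc ℂ (GraphonAlgebra Φ) (GraphonAlgebra Φ) (GraphonAlgebra Φ)
        (TensorProduct.map LinearMap.id (graft d) y ⊗ₜ 1) +
      TensorProduct.map LinearMap.id (TensorProduct.map LinearMap.id (graft d))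
        (TensorProduct.map LinearMap.id (graphonCoproduct Φ).toLinearMap y) := by
    intro d y
    induction y using TensorProduct.induction_on with
    | zero => simp
    | add y z hy hz =>
      simp only [map_add, hy, hz, TensorProduct.add_tmul]
      abel
    | tmul a b =>
      simp only [TensorProduct.map_tmul, LinearMap.id_apply, AlgHom.toLinearMap_apply,
        graphonCoproduct_graft, TensorProduct.tmul_add, TensorProduct.assoc_tmul]
  have hfg : f = g := by
    refine algHom_eq_of_graft (R := GraphonAlgebra Φ ⊗[ℂ] (GraphonAlgebra Φ ⊗[ℂ] GraphonAlgebra Φ))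
      (f := f) (g := g) fun d x hx => ?_
    rw [hf, hg] at hx ⊢
    rw [graphonCoproduct_graft, map_add, map_add, map_add, h1, hx, h2]
    simp only [TensorProduct.map_tmul, LinearMap.id_apply, AlgHom.toLinearMap_apply,
      graphonCoproduct_graft, TensorProduct.add_tmul, map_add, TensorProduct.assoc_tmul, map_one,
      Algebra.TensorProduct.one_def]
    abel
  rw [← hf, ← hg, hfg]

theorem graphonCoproduct_counit_left (x : GraphonAlgebra Φ) :
    TensorProduct.lid ℂ (GraphonAlgebra Φ) (TensorProduct.map (graphonCounit Φ).toLinearMap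
      LinearMap.id (graphonCoproduct Φ x)) = x := by
  let f : GraphonAlgebra Φ →ₐ[ℂ] GraphonAlgebra Φ :=
    (Algebra.TensorProduct.lid ℂ (GraphonAlgebra Φ)).toAlgHom.comp
      ((Algebra.TensorProduct.map (graphonCounit Φ) (AlgHom.id ℂ (GraphonAlgebra Φ))).comp
        (graphonCoproduct Φ))
  have hf : ∀ x, f x = TensorProduct.lid ℂ (GraphonAlgebra Φ)
      (TensorProduct.map (graphonCounit Φ).toLinearMap LinearMap.id (graphonCoproduct Φ x)) :=
    fun _ => rfl
  have h1 : ∀ (d : Φ.Decoration) y, TensorProduct.lid ℂ (GraphonAlgebra Φ)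
      (TensorProduct.map (graphonCounit Φ).toLinearMap LinearMap.id
        (TensorProduct.map LinearMap.id (graft d) y)) =
      graft d (TensorProduct.lid ℂ (GraphonAlgebra Φ)
        (TensorProduct.map (graphonCounit Φ).toLinearMap LinearMap.id y)) := by
    intro d y
    induction y using TensorProduct.induction_on with
    | zero => simp
    | add y z hy hz => simp only [map_add, hy, hz]
    | tmul a b => simp
  have hfg : f = AlgHom.id ℂ _ := by
    refine algHom_eq_of_graft fun d x hx => ?_
    rw [AlgHom.id_apply] at hx ⊢
    rw [hf] at hx ⊢
    rw [graphonCoproduct_graft, map_add, map_add, h1, hx]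
    simp [graphonCounit_graft]
  rw [← hf, hfg, AlgHom.id_apply]

theorem graphonCoproduct_counit_right (x : GraphonAlgebra Φ) :
    TensorProduct.rid ℂ (GraphonAlgebra Φ) (TensorProduct.map LinearMap.id
      (graphonCounit Φ).toLinearMap (graphonCoproduct Φ x)) = x := by
  let f : GraphonAlgebra Φ →ₐ[ℂ] GraphonAlgebra Φ :=
    (Algebra.TensorProduct.rid ℂ ℂ (GraphonAlgebra Φ)).toAlgHom.comp
      ((Algebra.TensorProduct.map (AlgHom.id ℂ (GraphonAlgebra Φ)) (graphonCounit Φ)).comp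
        (graphonCoproduct Φ))
  have hf : ∀ x, f x = TensorProduct.rid ℂ (GraphonAlgebra Φ)
      (TensorProduct.map LinearMap.id (graphonCounit Φ).toLinearMap (graphonCoproduct Φ x)) :=
    fun _ => rfl
  have h1 : ∀ (d : Φ.Decoration) (y : GraphonAlgebra Φ ⊗[ℂ] GraphonAlgebra Φ),
      TensorProduct.map LinearMap.id (graphonCounit Φ).toLinearMap
      (TensorProduct.map LinearMap.id (graft d) y) = 0 := by
    intro d y
    induction y using TensorProduct.induction_on with
    | zero => simp
    | add y z hy hz => simp only [map_add, hy, hz, add_zero]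
    | tmul a b => simp [graphonCounit_graft]
  have hfg : f = AlgHom.id ℂ _ := by
    refine algHom_eq_of_graft fun d x _ => ?_
    rw [AlgHom.id_apply, hf, graphonCoproduct_graft, map_add, h1]
    simp
  rw [← hf, hfg, AlgHom.id_apply]

/-! #### The antipode -/

/-- Algebra homomorphisms on the algebra of Feynman graphons have left inverses with respect to the
convolution product. -/
theorem exists_convolution_left_inverse (φ : GraphonAlgebra Φ →ₐ[ℂ] GraphonAlgebra Φ) :
    ∃ S : GraphonAlgebra Φ →ₐ[ℂ] GraphonAlgebra Φ, ∀ x,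
      LinearMap.mul' ℂ (GraphonAlgebra Φ)
        (TensorProduct.map S.toLinearMap φ.toLinearMap (graphonCoproduct Φ x)) =
      algebraMap ℂ _ (graphonCounit Φ x) := by
  let μ : GraphonAlgebra Φ ⊗[ℂ] GraphonAlgebra Φ →ₐ[ℂ] GraphonAlgebra Φ :=
    (Algebra.TensorProduct.lmul' ℂ).comp
      (Algebra.TensorProduct.map (AlgHom.id ℂ (GraphonAlgebra Φ)) φ)
  let ι : GraphonAlgebra Φ →ₐ[ℂ] GraphonAlgebra Φ ⊗[ℂ] GraphonAlgebra Φ :=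
    Algebra.TensorProduct.includeLeft
  let B (d : Φ.Decoration) : GraphonAlgebra Φ ⊗[ℂ] GraphonAlgebra Φ →ₗ[ℂ]
      GraphonAlgebra Φ ⊗[ℂ] GraphonAlgebra Φ := TensorProduct.map LinearMap.id (graft d)
  -- The map f is to be (S ⊗ id)Δ. On grafts the cocycle property gives B f(x) plus S(B x) ⊗ 1, and
  -- μ f = ε requires S(B x) = -μ(B f(x)); this dictates the operator.
  obtain ⟨f, hf⟩ := exists_algHom_graft fun d =>
    B d - ι.toLinearMap ∘ₗ μ.toLinearMap ∘ₗ B d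
  let ρ : GraphonAlgebra Φ ⊗[ℂ] GraphonAlgebra Φ →ₐ[ℂ] GraphonAlgebra Φ :=
    (Algebra.TensorProduct.rid ℂ ℂ (GraphonAlgebra Φ)).toAlgHom.comp
      (Algebra.TensorProduct.map (AlgHom.id ℂ (GraphonAlgebra Φ)) (graphonCounit Φ))
  have hμι : ∀ x, μ (ι x) = x := fun x => by simp [μ, ι]
  have hρι : ∀ x, ρ (ι x) = x := fun x => by simp [ρ, ι]
  have hρB : ∀ d y, ρ (B d y) = 0 := by
    intro d y
    induction y using TensorProduct.induction_on with
    | zero => simp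
    | add y z hy hz => simp only [map_add, hy, hz, add_zero]
    | tmul a b => simp [ρ, B, graphonCounit_graft]
  let S : GraphonAlgebra Φ →ₐ[ℂ] GraphonAlgebra Φ := ρ.comp f
  let T : GraphonAlgebra Φ ⊗[ℂ] GraphonAlgebra Φ →ₐ[ℂ] GraphonAlgebra Φ ⊗[ℂ] GraphonAlgebra Φ :=
    Algebra.TensorProduct.map S (AlgHom.id ℂ (GraphonAlgebra Φ))
  have hTB : ∀ d y, T (B d y) = B d (T y) := by
    intro d y
    induction y using TensorProduct.induction_on with
    | zero => simp
    | add y z hy hz => simp only [map_add, hy, hz]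
    | tmul a b => simp [T, B]
  -- With S read off from f by applying the counit to the second factor, f is indeed (S ⊗ id)Δ: both
  -- sides satisfy the same recursion on grafts.
  have h1 : T.comp (graphonCoproduct Φ) = f := by
    refine algHom_eq_of_graft fun d x hx => ?_
    have hx' : T (graphonCoproduct Φ x) = f x := hx
    have hS : S (graft d x) = -μ (B d (f x)) := by
      change ρ (f (graft d x)) = _
      rw [hf]
      simp [hρB, hρι]
    have hT : T (graft d x ⊗ₜ 1) = ι (S (graft d x)) := by simp [T, ι]
    change T (graphonCoproduct Φ (graft d x)) = _
    rw [graphonCoproduct_graft, map_add]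
    change _ + T (B d _) = _
    rw [hTB, hx', hT, hS, hf]
    simp only [map_neg, LinearMap.sub_apply, LinearMap.comp_apply, AlgHom.toLinearMap_apply]
    abel
  have h2 : μ.comp f = (Algebra.ofId ℂ _).comp (graphonCounit Φ) := by
    refine algHom_eq_of_graft fun d x _ => ?_
    change μ (f (graft d x)) = algebraMap ℂ _ (graphonCounit Φ (graft d x))
    rw [graphonCounit_graft, hf, map_zero]
    simp only [map_sub, LinearMap.sub_apply, LinearMap.comp_apply, AlgHom.toLinearMap_apply, hμι,
      sub_self]
  have h3 : ∀ y, LinearMap.mul' ℂ (GraphonAlgebra Φ)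
      (TensorProduct.map S.toLinearMap φ.toLinearMap y) = μ (T y) := by
    intro y
    induction y using TensorProduct.induction_on with
    | zero => simp
    | add y z hy hz => simp only [map_add, hy, hz]
    | tmul a b => simp [μ, T]
  refine ⟨S, fun x => ?_⟩
  rw [h3]
  exact (congrArg μ (DFunLike.congr_fun h1 x)).trans (DFunLike.congr_fun h2 x)

theorem graphon_isHopfAlgebra : IsHopfAlgebra (graphonCoproduct Φ) (graphonCounit Φ) where
  coassoc := graphonCoproduct_coassoc
  counit_left := graphonCoproduct_counit_left
  counit_right := graphonCoproduct_counit_right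
  antipode := by
    have hc : ∀ φ ψ x, convolution (graphonCoproduct Φ).toLinearMap
        (LinearMap.mul ℂ (GraphonAlgebra Φ)) φ ψ x = LinearMap.mul' ℂ (GraphonAlgebra Φ)
        (TensorProduct.map φ ψ (graphonCoproduct Φ x)) := by
      intro φ ψ x
      change TensorProduct.lift _ (graphonCoproduct Φ x) = _
      induction graphonCoproduct Φ x using TensorProduct.induction_on with
      | zero => simp
      | add y z hy hz => simp only [map_add, hy, hz]
      | tmul a b => simp
    have ha := isAssoc_convolution (Δ := (graphonCoproduct Φ).toLinearMap)
      (m := LinearMap.mul ℂ (GraphonAlgebra Φ)) graphonCoproduct_coassoc (fun a b c => mul_assoc a b c)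
    have hu := isUnitOf_convolution (Δ := (graphonCoproduct Φ).toLinearMap)
      (ε := (graphonCounit Φ).toLinearMap) (m := LinearMap.mul ℂ (GraphonAlgebra Φ)) (e := 1)
      graphonCoproduct_counit_left graphonCoproduct_counit_right
      (fun a => ⟨one_mul a, mul_one a⟩)
    -- S is a left inverse of the identity and T a left inverse of S. Then T = T * (S * id) = (T *
    -- S) * id = id, so S is a two-sided inverse.
    obtain ⟨S, hS⟩ := exists_convolution_left_inverse (AlgHom.id ℂ (GraphonAlgebra Φ))
    obtain ⟨T, hT⟩ := exists_convolution_left_inverse S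
    have he : ∀ x, (LinearMap.toSpanSingleton ℂ (GraphonAlgebra Φ) 1 ∘ₗ
        (graphonCounit Φ).toLinearMap) x = algebraMap ℂ _ (graphonCounit Φ x) := fun x =>
      (Algebra.algebraMap_eq_smul_one (graphonCounit Φ x)).symm
    have h1 := LinearMap.ext fun x => ((hc S.toLinearMap LinearMap.id x).trans (hS x)).trans
      (he x).symm
    have h2 := LinearMap.ext fun x => ((hc T.toLinearMap S.toLinearMap x).trans (hT x)).trans
      (he x).symm
    have h3 : T.toLinearMap = LinearMap.id := by
      rw [← (hu T.toLinearMap).2, ← h1, ← ha, h2, (hu _).1]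
    exact ⟨S.toLinearMap, fun x => ⟨hS x, by rw [← h3]; exact hT x⟩⟩

open Classical in
-- For the tree with a root and two leaves, all decorated alike, cutting both edges gives p² ⊗ p,
-- where p is the generator of a single vertex. The flipped term p ⊗ p² cannot occur, since trunks
-- are single generators.
theorem graphon_nonCocommutative : NonCocommutative (graphonCoproduct Φ) := by
  obtain ⟨d⟩ := Φ.nonempty
  let p : DTree Φ.Decoration := DTree.node d []
  let x : feynmanGraphons Φ := ⟨graphonClass Φ p, p, rfl⟩
  refine ⟨graphonGen Φ (DTree.node d [p, p]), fun h => ?_⟩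
  have hp : p.cuts = [([], p)] := by simp [p, DTree.cuts, DTree.forestCuts]
  have hx : graphonGen Φ p = MvPolynomial.X x := rfl
  have hc : treeCoproduct Φ (DTree.node d [p, p]) = graphonGen Φ (DTree.node d [p, p]) ⊗ₜ 1 +
      ((graphonGen Φ p ^ 2) ⊗ₜ graphonGen Φ p +
        (graphonGen Φ p ⊗ₜ graphonGen Φ (DTree.node d [p]) +
          (graphonGen Φ p ⊗ₜ graphonGen Φ (DTree.node d [p]) +
            1 ⊗ₜ graphonGen Φ (DTree.node d [p, p])))) := by
    simp [treeCoproduct, DTree.cuts, DTree.forestCuts, hp, sq, ← show p = DTree.node d [] from rfl]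
  have h1 : MvPolynomial.coeff (Finsupp.single x 1) (1 : GraphonAlgebra Φ) = 0 := by
    rw [MvPolynomial.coeff_one, if_neg (Finsupp.single_ne_zero.mpr one_ne_zero).symm]
  have h2 : MvPolynomial.coeff (Finsupp.single x 2) (1 : GraphonAlgebra Φ) = 0 := by
    rw [MvPolynomial.coeff_one, if_neg (Finsupp.single_ne_zero.mpr two_ne_zero).symm]
  have h3 : ∀ s, MvPolynomial.coeff (Finsupp.single x 2) (graphonGen Φ s) = 0 := fun s => by
    rw [graphonGen, MvPolynomial.coeff_X, if_neg (by simp [Finsupp.single_eq_single_iff])]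
  have h4 : MvPolynomial.coeff (Finsupp.single x 2) (graphonGen Φ p ^ 2) = 1 := by
    rw [hx, MvPolynomial.coeff_X_pow, if_pos rfl]
  have h5 : MvPolynomial.coeff (Finsupp.single x 1) (graphonGen Φ p) = 1 := by
    rw [hx, MvPolynomial.coeff_X, if_pos rfl]
  rw [graphonCoproduct_graphonGen, hc] at h
  -- The coefficient of p² ⊗ p is 1 in the coproduct and 0 in its flip.
  have h6 := congrArg (TensorProduct.lift ((LinearMap.mul ℂ ℂ).compl₁₂
    (MvPolynomial.lcoeff ℂ (Finsupp.single x 2)) (MvPolynomial.lcoeff ℂ (Finsupp.single x 1)))) h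
  simp [h1, h2, h3, h4, h5] at h6

end Graphons

theorem mainTheorem8 (Φ : FeynmanTheory) :
    (IsHopfAlgebra (graphonCoproduct Φ) (graphonCounit Φ) ∧
      NonCocommutative (graphonCoproduct Φ) ∧
      (∀ t : DTree Φ.Decoration, graphonCoproduct Φ (graphonGen Φ t) = treeCoproduct Φ t) ∧
      SymplecticModels (graphonCoproduct Φ) (graphonCounit Φ)) ∧
    ∀ (H : Type) [Ring H] [Algebra ℂ H] (Δ : H →ₐ[ℂ] H ⊗[ℂ] H) (ε : H →ₐ[ℂ] ℂ),
      IsHopfAlgebra Δ ε → NonCocommutative Δ → SymplecticModels Δ ε :=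
  ⟨⟨graphon_isHopfAlgebra, graphon_nonCocommutative, graphonCoproduct_graphonGen,
    symplecticModels graphon_isHopfAlgebra graphon_nonCocommutative⟩,
    fun _ _ _ _ _ hH hnc => symplecticModels hH hnc⟩
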